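/- Let $0<\alpha<1$, $\delta=\frac{\alpha}{1-\alpha}$, and set $(\alpha_1,\alpha_2)=(\alpha,1-\alpha)$, $(\beta_1,\beta_2)=(1-\alpha,\alpha)$. Write $(a,d,q)\in\mathbb C^3$ for the symmetric matrix $\begin{pmatrix}a&q\\q&d\end{pmatrix}$, and let $$\hat R(a,d,q)=\delta\big(a(a+\delta^{-1}d)-\delta^{-1}q^2,\ \delta d(a+\delta^{-1}d)-\delta q^2,\ -q^2\big).$$ The homogeneous map $\hat R:\mathbb C^3\to\mathbb C^3$ of degree $2$ induces an algebraically stable rational map $\hat g$ of $\mathbb P^2$ (no iterate $\hat R^n$ vanishes identically on a hypersurface), and the limit $$\hat G(z)=\lim_{n\to\infty}2^{-n}\log\|\hat R^n(z)\|\in[-\infty,\infty)$$ exists for every $z\in\mathbb C^3$; $\hat G$ is the Green function of $\hat R$. Fix a blow-up $\omega=(\omega_1,\omega_2,\dots)\in\{1,2\}^{\mathbb N}$. For counting measures $\nu^{\pm}_{\langle n\rangle}$ of eigenvalues (with multiplicity), the density of states is the measure $\mu$ on $\mathbb R$ with $\mu=\lim_n 2^{-n}\nu^+_{\langle n\rangle}=\lim_n2^{-n}\nu^-_{\langle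 n\rangle}$ (vague limits). **Lattice case.** Let $m_0,m_1>0$, $b=m_0\delta_0+m_1\delta_1$, $I_b=\mathrm{diag}(m_0,m_1)$, $A=\begin{pmatrix}1&-1\\-1&1\end{pmatrix}$. Let $F_{\langle n\rangle}$ be the chain of $2^n+1$ points whose $2^n$ consecutive pairs are the cells, labelled from left to right by the words $j\in\{1,2\}^n$ in lexicographic order, and put $$A_{\langle n\rangle}=\sum_{j}\alpha_{\omega_1}\cdots\alpha_{\omega_n}\,\alpha_{j_1}^{-1}\cdots\alpha_{j_n}^{-1}A_{\langle n\rangle,j},\qquad b_{\langle n\rangle}=\sum_j\beta_{\omega_1}^{-1}\cdots\beta_{\omega_n}^{-1}\,\beta_{j_1}\cdots\beta_{j_n}\,b_{\langle n\rangle,j},$$ where $A_{\langle n\rangle,j}$, $b_{\langle n\rangle,j}$ are the copies of $A$, $b$ on the cell $j$. Let $H^+_{\langle n\rangle}$ be given by $\langle A_{\langle n\rangle}f,g\rangle=-\int (H^+_{\langle n\rangle}f)\,g\,db_{\langle n\rangle}$, and let $H^-_{\langle n\rangle}$ be its restriction to the functions vanishing at the two end points of the chain. Let $\nu^\pm_{\langle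 n\rangle}$ be the counting measure of the eigenvalues of $H^\pm_{\langle n\rangle}$. Then the density of states $\mu$ exists, does not depend on $\omega$, and, with $\hat\phi(\lambda)=A+\lambda I_b$, $$\mu=\frac1{2\pi}\Delta(\hat G\circ\hat\phi)\quad\text{on }\mathbb C,$$ where $\Delta$ is the distributional Laplacian, $\hat G\circ\hat\phi$ is almost everywhere finite and locally integrable, and $\mu$ is regarded as a measure on $\mathbb C\supset\mathbb R$. **Continuous case.** There is a probability measure $m$ on $[0,1]$ with $\int f\,dm=\beta_1\int f(\alpha x)\,dm(x)+\beta_2\int f(1+(1-\alpha)(x-1))\,dm(x)$. For such $m$, let $a(f,f)=\int_0^1(f')^2dx$ on $\mathcal D=\{f\in L^2(m): f'\in L^2([0,1],dx)\}$ and $\mathcal D^-=\{f\in\mathcal D: f(0)=f(1)=0\}$. Let $\nu^{+}_{\langle n\rangle}$ and $\nu^-_{\langle n\rangle}$ be the counting measures of the eigenvalues of the generators $H^\pm_{\langle n\rangle}$ of the form $\alpha_{\omega_1}\cdots\alpha_{\omega_n}\,a$ on $L^2(\beta_{\omega_1}^{-1}\cdots\beta_{\omega_n}^{-1}m)$ with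 domain $\mathcal D$, respectively $\mathcal D^-$. Let $\lambda_1^-<0$ be the largest eigenvalue of the generator of $(a,\mathcal D^-)$ on $L^2(m)$. For real $\lambda\ge0$ let $A_{(\lambda)}$ be the symmetric $2\times2$ matrix with $$\langle A_{(\lambda)}v,v\rangle=\inf\Big\{\int_0^1(f')^2dx+\lambda\int f^2dm:\ f\in\mathcal D,\ (f(0),f(1))=v\Big\}\qquad(v\in\mathbb R^2).$$ Then $\lambda\mapsto A_{(\lambda)}$ extends analytically to the disc $B(0,|\lambda_1^-|)\subset\mathbb C$, the density of states $\mu$ exists and does not depend on $\omega$, and, with $\hat\phi(\lambda)=A_{(\lambda)}$, $$\mu=\frac1{2\pi}\Delta(\hat G\circ\hat\phi)\quad\text{on }B(0,|\lambda_1^-|),$$ again in the sense of distributions, with $\hat G\circ\hat\phi$ almost everywhere finite and locally integrable on that disc. -/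

import Mathlib

open MeasureTheory Filter Topology
open scoped ENNReal

namespace SelfSimilarInterval

noncomputable section

/-! ### Iteration of homogeneous maps of `ℂ³` and their Green functions -/

/-- Algebraic stability of the rational map of `ℙ²` induced by a homogeneous map `R` of `ℂ³`: no
iterate of `R` vanishes identically on the zero set of a nonzero homogeneous polynomial of positive
degree.  (An iterate vanishes on a hypersurface exactly when some iterate of the induced rational
map sends that hypersurface into the indeterminacy set.) -/
def IsAlgebraicallyStable (R : (Fin 3 → ℂ) → (Fin 3 → ℂ)) : Prop :=
  ∀ (n k : ℕ) (P : MvPolynomial (Fin 3) ℂ), P ≠ 0 → 0 < k → P.IsHomogeneous k →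
    ∃ z : Fin 3 → ℂ, z ≠ 0 ∧ MvPolynomial.eval z P = 0 ∧ R^[n] z ≠ 0

/-- `d⁻ⁿ log ‖Rⁿ z‖`, with the value `-∞` where `Rⁿ z = 0`.  (The choice of the norm on `ℂ³` does
not matter for the limit.) -/
def greenApprox (R : (Fin 3 → ℂ) → (Fin 3 → ℂ)) (d n : ℕ) (z : Fin 3 → ℂ) : EReal :=
  ((((d : ℝ) ^ n)⁻¹ : ℝ) : EReal) * ENNReal.log ‖R^[n] z‖ₑ

/-- The Green function `lim d⁻ⁿ log ‖Rⁿ z‖` of a homogeneous map of degree `d`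
(that the limit exists is asserted separately). -/
def greenFunction (R : (Fin 3 → ℂ) → (Fin 3 → ℂ)) (d : ℕ) (z : Fin 3 → ℂ) : EReal :=
  limsup (fun n => greenApprox R d n z) atTop

/-! ### The distributional Laplacian -/

/-- `ν = (1/2π) Δ u` in the sense of distributions on the open set `U ⊆ ℂ`, where `u` is
almost everywhere finite and locally integrable on `U`. -/
def IsLaplacianMeasureOn (U : Set ℂ) (u : ℂ → EReal) (ν : Measure ℂ) : Prop :=
  (∀ᵐ z ∂(volume.restrict U), u z ≠ ⊥ ∧ u z ≠ ⊤) ∧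
  LocallyIntegrableOn (fun z => (u z).toReal) U volume ∧
  ∀ ψ : ℂ → ℝ, ContDiff ℝ (⊤ : ℕ∞) ψ → HasCompactSupport ψ → tsupport ψ ⊆ U →
    ∫ z, ψ z ∂ν = (2 * Real.pi)⁻¹ * ∫ z, (u z).toReal * Laplacian.laplacian ψ z

/-! ### The density of states -/

/-- Vague convergence `c n • ν n → μ` of (locally finite) measures on `ℝ`. -/
def VaguelyTendsto (c : ℕ → ℝ) (ν : ℕ → Measure ℝ) (μ : Measure ℝ) : Prop :=
  (∀ n, IsFiniteMeasureOnCompacts (ν n)) ∧ IsFiniteMeasureOnCompacts μ ∧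
  ∀ f : ℝ → ℝ, Continuous f → HasCompactSupport f →
    Tendsto (fun n => c n * ∫ x, f x ∂(ν n)) atTop (𝓝 (∫ x, f x ∂μ))

/-- `μ` is the density of states: the common limit of `2⁻ⁿ ν⁺ₙ` and `2⁻ⁿ ν⁻ₙ`. -/
def IsDensityOfStates (νN νD : ℕ → Measure ℝ) (μ : Measure ℝ) : Prop :=
  VaguelyTendsto (fun n => ((2 : ℝ) ^ n)⁻¹) νN μ ∧ VaguelyTendsto (fun n => ((2 : ℝ) ^ n)⁻¹) νD μ

/-- The counting measure `∑ δ_x` of a family of real eigenvalues, where `x` is repeated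
`mult x` times. -/
def countingMeasure (mult : ℝ → ℕ) : Measure ℝ :=
  Measure.sum fun x : ℝ => (mult x : ℝ≥0∞) • Measure.dirac x

/-! ### The scaling factors and the renormalization map -/

/-- The energy weights `(α₁, α₂) = (α, 1 - α)`; the index `0` is the left cell. -/
def energyWeight (α : ℝ) : Fin 2 → ℝ := ![α, 1 - α]

/-- The measure weights `(β₁, β₂) = (1 - α, α)`. -/
def measureWeight (α : ℝ) : Fin 2 → ℝ := ![1 - α, α]

/-- The renormalization map, in the coordinates `(a, d, q)` of the symmetric matrix
`Q = [[a, q], [q, d]]`, with `δ = α / (1 - α)`: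
`δ (a(a + δ⁻¹d) - δ⁻¹q², δd(a + δ⁻¹d) - δq², -q²)`. -/
def Rhat (α : ℝ) (Q : Fin 3 → ℂ) : Fin 3 → ℂ :=
  let δ : ℂ := (α : ℂ) / (1 - (α : ℂ))
  let a := Q 0
  let d := Q 1
  let q := Q 2
  ![δ * (a * (a + δ⁻¹ * d) - δ⁻¹ * q ^ 2),
    δ * (δ * d * (a + δ⁻¹ * d) - δ * q ^ 2),
    δ * (-q ^ 2)]

/-- The Green function of `Rhat`, which has degree `2`. -/
def Ghat (α : ℝ) : (Fin 3 → ℂ) → EReal := greenFunction (Rhat α) 2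

/-! ### The lattice case -/

/-- The points of the `n`-th lattice are `0, 1, …, 2ⁿ`, in the order in which they lie on the line.
A word `j ∈ {1, 2}ⁿ` names a cell, whose position from the left has the binary digits `j`, and
consecutive cells share an end point: `vertex n j x` is the left (`x = 0`) or right (`x = 1`)
end point of the cell `j`. -/
def vertex (n : ℕ) (j : Fin n → Fin 2) (x : Fin 2) : Fin (2 ^ n + 1) :=
  if x = 0 then (finFunctionFinEquiv j).castSucc else (finFunctionFinEquiv j).succ

/-- The discrete Laplace operator of the basic cell. -/
def cellLaplacian : Matrix (Fin 2) (Fin 2) ℝ := !![1, -1; -1, 1]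

/-- `A_<n> = ∑_j α_{ω₁} ⋯ α_{ωₙ} α_{j₁}⁻¹ ⋯ α_{jₙ}⁻¹ A_{<n>,j}`, where `A_{<n>,j}` is the copy of
the cell operator on the cell `j`. -/
def latticeEnergy (α : ℝ) (ω : ℕ → Fin 2) (n : ℕ) :
    Matrix (Fin (2 ^ n + 1)) (Fin (2 ^ n + 1)) ℝ :=
  fun u v => ∑ j : Fin n → Fin 2,
    (∏ k ∈ Finset.range n, energyWeight α (ω k)) * (∏ k, energyWeight α (j k))⁻¹ *
      ∑ x : Fin 2, ∑ y : Fin 2,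
        if vertex n j x = u ∧ vertex n j y = v then cellLaplacian x y else 0

/-- `b_<n> = ∑_j β_{ω₁}⁻¹ ⋯ β_{ωₙ}⁻¹ β_{j₁} ⋯ β_{jₙ} b_{<n>,j}`, where `b_{<n>,j}` is the copy on the
cell `j` of the measure `b = b 0 • δ₀ + b 1 • δ₁`. -/
def latticeMass (α : ℝ) (b : Fin 2 → ℝ) (ω : ℕ → Fin 2) (n : ℕ) : Fin (2 ^ n + 1) → ℝ :=
  fun u => ∑ j : Fin n → Fin 2,
    (∏ k ∈ Finset.range n, measureWeight α (ω k))⁻¹ * (∏ k, measureWeight α (j k)) *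
      ∑ x : Fin 2, if vertex n j x = u then b x else 0

/-- The Neumann operator `H⁺_<n>`, defined by `⟨A_<n> f, g⟩ = -∫ (H⁺_<n> f) g db_<n>`. -/
def latticeNeumann (α : ℝ) (b : Fin 2 → ℝ) (ω : ℕ → Fin 2) (n : ℕ) :
    Matrix (Fin (2 ^ n + 1)) (Fin (2 ^ n + 1)) ℝ :=
  fun u v => -(latticeMass α b ω n u)⁻¹ * latticeEnergy α ω n u v

/-- The Dirichlet operator `H⁻_<n>`: the restriction of `H⁺_<n>` to the functions that vanish at
the two boundary points. -/
def latticeDirichlet (α : ℝ) (b : Fin 2 → ℝ) (ω : ℕ → Fin 2) (n : ℕ) :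
    Matrix {u : Fin (2 ^ n + 1) // u ≠ 0 ∧ u ≠ Fin.last (2 ^ n)}
      {u : Fin (2 ^ n + 1) // u ≠ 0 ∧ u ≠ Fin.last (2 ^ n)} ℝ :=
  (latticeNeumann α b ω n).submatrix Subtype.val Subtype.val

/-- The counting measure `ν⁺_<n>` of the Neumann eigenvalues. -/
def latticeNuNeumann (α : ℝ) (b : Fin 2 → ℝ) (ω : ℕ → Fin 2) (n : ℕ) : Measure ℝ :=
  countingMeasure fun x =>
    Module.finrank ℝ (Module.End.eigenspace (Matrix.toLin' (latticeNeumann α b ω n)) x)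

/-- The counting measure `ν⁻_<n>` of the Dirichlet eigenvalues. -/
def latticeNuDirichlet (α : ℝ) (b : Fin 2 → ℝ) (ω : ℕ → Fin 2) (n : ℕ) : Measure ℝ :=
  countingMeasure fun x =>
    Module.finrank ℝ (Module.End.eigenspace (Matrix.toLin' (latticeDirichlet α b ω n)) x)

/-- The curve `x ↦ A + x I_b`, in the coordinates `(a, d, q)`. -/
def latticePhi (b : Fin 2 → ℝ) (x : ℂ) : Fin 3 → ℂ :=
  ![1 + x * (b 0 : ℂ), 1 + x * (b 1 : ℂ), -1]

/-! ### The continuous case -/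

/-- `m` is the self-similar probability measure on `[0, 1]`:
`∫ f dm = (1 - α) ∫ f ∘ Ψ₁ dm + α ∫ f ∘ Ψ₂ dm` with `Ψ₁ x = α x` and
`Ψ₂ x = 1 + (x - 1)(1 - α)`. -/
def IsSelfSimilarMeasure (α : ℝ) (m : Measure ℝ) : Prop :=
  IsProbabilityMeasure m ∧ m (Set.Icc 0 1)ᶜ = 0 ∧
  m = ENNReal.ofReal (measureWeight α 0) • m.map (fun x => α * x) +
    ENNReal.ofReal (measureWeight α 1) • m.map (fun x => 1 + (x - 1) * (1 - α))

/-- `f` belongs to the form domain `𝒟` (functions on `[0, 1]`, extended by `0` to `ℝ`, with a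
square integrable derivative on `[0, 1]`), and `f' = g` on `[0, 1]`. -/
def InDomain (f g : ℝ → ℝ) : Prop :=
  (∀ x ∉ Set.Icc (0 : ℝ) 1, f x = 0) ∧ MemLp g 2 (volume.restrict (Set.Icc 0 1)) ∧
  ∀ x ∈ Set.Icc (0 : ℝ) 1, f x = f 0 + ∫ t in (0 : ℝ)..x, g t

/-- The measure `m_<n> = β_{ω₁}⁻¹ ⋯ β_{ωₙ}⁻¹ m` (the level-`n` set being identified with
`[0, 1]`). -/
def levelMeasure (α : ℝ) (m : Measure ℝ) (ω : ℕ → Fin 2) (n : ℕ) : Measure ℝ :=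
  ENNReal.ofReal ((∏ k ∈ Finset.range n, measureWeight α (ω k))⁻¹) • m

/-- `f` is an eigenfunction (or zero) for the eigenvalue `x` of the generator `H⁺_<n>` of the
Dirichlet form `a_<n>(f, h) = α_{ω₁} ⋯ α_{ωₙ} ∫₀¹ f' h'` on `L²(m_<n>)` with domain `𝒟`:
`a_<n>(f, h) = -x ∫ f h dm_<n>` for all `h ∈ 𝒟`. -/
def IsNeumannEigen (α : ℝ) (m : Measure ℝ) (ω : ℕ → Fin 2) (n : ℕ) (x : ℝ) (f : ℝ → ℝ) : Prop :=
  ∃ g, InDomain f g ∧ ∀ h k, InDomain h k →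
    (∏ i ∈ Finset.range n, energyWeight α (ω i)) * ∫ t in (0 : ℝ)..1, g t * k t =
      -x * ∫ t, f t * h t ∂(levelMeasure α m ω n)

/-- The same for `H⁻_<n>`, the generator with domain `𝒟⁻ = {f ∈ 𝒟 : f(0) = f(1) = 0}`. -/
def IsDirichletEigen (α : ℝ) (m : Measure ℝ) (ω : ℕ → Fin 2) (n : ℕ) (x : ℝ) (f : ℝ → ℝ) : Prop :=
  ∃ g, InDomain f g ∧ f 0 = 0 ∧ f 1 = 0 ∧ ∀ h k, InDomain h k → h 0 = 0 → h 1 = 0 →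
    (∏ i ∈ Finset.range n, energyWeight α (ω i)) * ∫ t in (0 : ℝ)..1, g t * k t =
      -x * ∫ t, f t * h t ∂(levelMeasure α m ω n)

/-- The counting measure `ν⁺_<n>`; multiplicities are dimensions of eigenspaces. -/
def contNuNeumann (α : ℝ) (m : Measure ℝ) (ω : ℕ → Fin 2) (n : ℕ) : Measure ℝ :=
  countingMeasure fun x =>
    Module.finrank ℝ (Submodule.span ℝ {f : ℝ → ℝ | IsNeumannEigen α m ω n x f})

/-- The counting measure `ν⁻_<n>`. -/
def contNuDirichlet (α : ℝ) (m : Measure ℝ) (ω : ℕ → Fin 2) (n : ℕ) : Measure ℝ :=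
  countingMeasure fun x =>
    Module.finrank ℝ (Submodule.span ℝ {f : ℝ → ℝ | IsDirichletEigen α m ω n x f})

/-- The spectrum of `H⁻ = H⁻_<0>` (at level `0` the blow-up plays no role). -/
def dirichletSpectrum (α : ℝ) (m : Measure ℝ) : Set ℝ :=
  {x | ∃ f : ℝ → ℝ, f ≠ 0 ∧ IsDirichletEigen α m (fun _ => 0) 0 x f}

/-- The symmetric matrix with coordinates `Q = (a, d, q)` is `A_(x)` for the real number `x ≥ 0`,
i.e. the trace on `{0, 1}` of the form `a_x(f, f) = ∫₀¹ (f')² + x ∫ f² dm`: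
`⟨Q v, v⟩ = inf {a_x(f, f) : f ∈ 𝒟, f(0) = v₀, f(1) = v₁}`. -/
def IsTraceMatrix (m : Measure ℝ) (x : ℝ) (Q : Fin 3 → ℝ) : Prop :=
  ∀ v₀ v₁ : ℝ,
    IsGLB {e : ℝ | ∃ f g, InDomain f g ∧ f 0 = v₀ ∧ f 1 = v₁ ∧
        e = (∫ t in (0 : ℝ)..1, g t ^ 2) + x * ∫ t, f t ^ 2 ∂m}
      (Q 0 * v₀ ^ 2 + Q 1 * v₁ ^ 2 + 2 * Q 2 * v₀ * v₁)

/-- `Φ` is the curve `x ↦ A_(x)` on the ball `B(0, r)`: the analytic continuation of the trace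
matrices `A_(x)`, `0 ≤ x < r` (it is unique on the ball by the identity theorem). -/
def IsTraceCurve (m : Measure ℝ) (r : ℝ) (Φ : ℂ → Fin 3 → ℂ) : Prop :=
  DifferentiableOn ℂ Φ (Metric.ball 0 r) ∧
  ∀ x : ℝ, 0 ≤ x → x < r → ∃ Q : Fin 3 → ℝ, IsTraceMatrix m x Q ∧ ∀ i, Φ (x : ℂ) i = (Q i : ℂ)

end

end SelfSimilarInterval

open SelfSimilarInterval

/-! Describe a cell by its transfer matrix M(λ) = [[a,b],[c,d]], which carries Cauchy data (u,p)
from the left end to the right end. It is entire in λ and has determinant 1. Gluing two copies of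
lengths α and 1-α gives the operation `double`. Since bc = ad - 1, the new a and d depend only on
the old a and d, and `Rhat` sends (a,d,-1) to δ times the vector of the doubled matrix
(`Rhat_toVec`). Hence Ĝ(a,d,-1) equals log δ plus the limit of 2⁻ⁿ log ‖(aₙ,dₙ,-1)‖, where aₙ, bₙ,
cₙ, dₙ are the entries of the n-fold double.

Neumann eigenvalues of level n are the zeros of cₙ, Dirichlet eigenvalues those of bₙ. The blow-up ω
drops out because βᵢ = α(1-α)/αᵢ, so that energy and mass carry the same power of the weights. In
the lattice case (a,d,-1) is exactly A + λ I_b. In the continuous case M comes from the Volterra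
series of the string equation, and self-similarity says that doubling replaces λ by λ/(α(1-α)).

The analytic core is the flux Im(ū p). Across a cell it grows by Im λ times a positive form. So the
zeros of bₙ and cₙ are real and simple, and off the real line |bₙ| and |cₙ| are comparable with
‖(aₙ,dₙ,-1)‖ up to constants of size θⁿ|Im λ|, where θ = min(α,1-α) (`Expansive.bounds`). The
logarithm of such a constant is linear in n and disappears after division by 2ⁿ. Therefore 2⁻ⁿ
log|bₙ| and 2⁻ⁿ log|cₙ| both converge to Ĝ(a,d,-1) - log δ for Im λ ≠ 0, with the locally integrable
majorant C + |log|Im λ|| (`hasLogLimit_aux`).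

Since (2π)⁻¹ Δ log|f| counts the zeros of f (`integral_log_norm_mul_laplacian`), dominated
convergence against Δψ gives the same limit for both counting measures. Test functions are dense
enough, and the masses of compact sets bounded enough, for vague convergence; Riesz-Markov then
produces μ (`HasLogLimit.exists_measure`).

For the string, the trace matrix is (a,d,-1)/b, so Ĝ changes by -log|b|, which is harmonic on the
disc because b vanishes only at Dirichlet eigenvalues. That such an eigenvalue exists is proved from
the doubling relations (`exists_realB_eq_zero`). -/

namespace SelfSimilarInterval

/-! ### The renormalization map: homogeneity, growth, algebraic stability -/

noncomputable section

/-- The ratio `δ = α / (1 - α)`. -/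
def ratio (α : ℝ) : ℝ := α / (1 - α)

lemma ratio_pos {α : ℝ} (h0 : 0 < α) (h1 : α < 1) : 0 < ratio α :=
  div_pos h0 (by linarith)

lemma Rhat_eq (α : ℝ) (z : Fin 3 → ℂ) :
    Rhat α z = ![(ratio α : ℂ) * (z 0 * (z 0 + (ratio α : ℂ)⁻¹ * z 1) - (ratio α : ℂ)⁻¹ * z 2 ^ 2),
      (ratio α : ℂ) * ((ratio α : ℂ) * z 1 * (z 0 + (ratio α : ℂ)⁻¹ * z 1) - (ratio α : ℂ) * z 2 ^ 2),
      (ratio α : ℂ) * (-z 2 ^ 2)] := by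
  simp [Rhat, ratio]

lemma Rhat_smul (α : ℝ) (c : ℂ) (z : Fin 3 → ℂ) : Rhat α (c • z) = c ^ 2 • Rhat α z := by
  rw [Rhat_eq, Rhat_eq]
  ext i
  fin_cases i <;> simp <;> ring

lemma Rhat_iterate_smul (α : ℝ) (c : ℂ) (z : Fin 3 → ℂ) (n : ℕ) :
    (Rhat α)^[n] (c • z) = c ^ (2 ^ n) • (Rhat α)^[n] z := by
  induction n with
  | zero => simp
  | succ n ih =>
    rw [Function.iterate_succ_apply', Function.iterate_succ_apply', ih, Rhat_smul, ← pow_mul,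
      pow_succ]

lemma continuous_Rhat (α : ℝ) : Continuous (Rhat α) := by
  have : Rhat α = fun z => ![(ratio α : ℂ) * (z 0 * (z 0 + (ratio α : ℂ)⁻¹ * z 1) - (ratio α : ℂ)⁻¹ * z 2 ^ 2),
      (ratio α : ℂ) * ((ratio α : ℂ) * z 1 * (z 0 + (ratio α : ℂ)⁻¹ * z 1) - (ratio α : ℂ) * z 2 ^ 2),
      (ratio α : ℂ) * (-z 2 ^ 2)] := funext (Rhat_eq α)
  rw [this]
  refine continuous_pi fun i => ?_
  fin_cases i <;> simp <;> fun_prop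

/-- By homogeneity the maximum on the unit sphere suffices. Taking K ≥ 1 makes log K nonnegative. -/
lemma exists_norm_Rhat_le (α : ℝ) : ∃ K : ℝ, 1 ≤ K ∧ ∀ z, ‖Rhat α z‖ ≤ K * ‖z‖ ^ 2 := by
  obtain ⟨K, hK⟩ := (isCompact_sphere (0 : Fin 3 → ℂ) 1).exists_bound_of_continuousOn
    (continuous_Rhat α).continuousOn
  refine ⟨max K 1, le_max_right _ _, fun z => ?_⟩
  by_cases hz : z = 0
  · subst hz
    have : Rhat α 0 = 0 := by simpa using Rhat_smul α 0 0
    simp [this]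
  have hz' : ‖z‖ ≠ 0 := norm_ne_zero_iff.2 hz
  have h1 : z = (‖z‖ : ℂ) • ((‖z‖ : ℂ)⁻¹ • z) := by
    rw [smul_smul, mul_inv_cancel₀ (by exact_mod_cast hz'), one_smul]
  have h2 : ‖(‖z‖ : ℂ)⁻¹ • z‖ = 1 := by
    rw [norm_smul, norm_inv, Complex.norm_real, norm_norm, inv_mul_cancel₀ hz']
  have h3 := hK ((‖z‖ : ℂ)⁻¹ • z) (by simp [h2])
  calc ‖Rhat α z‖ = ‖z‖ ^ 2 * ‖Rhat α ((‖z‖ : ℂ)⁻¹ • z)‖ := by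
        conv_lhs => rw [h1]
        rw [Rhat_smul, norm_smul, norm_pow, Complex.norm_real, norm_norm]
    _ ≤ ‖z‖ ^ 2 * max K 1 := by gcongr; exact h3.trans (le_max_left _ _)
    _ = _ := mul_comm _ _

/-- The third coordinate decouples: q ↦ -δq². Its explicit orbit keeps points with q ≠ 0 away from 0
and bounds the Green function from below. -/
lemma Rhat_iterate_two (α : ℝ) (z : Fin 3 → ℂ) (n : ℕ) :
    ‖(Rhat α)^[n] z 2‖ = |ratio α| ^ (2 ^ n - 1) * ‖z 2‖ ^ (2 ^ n) := by
  induction n with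
  | zero => simp
  | succ n ih =>
    rw [Function.iterate_succ_apply', Rhat_eq]
    have : 2 ^ (n + 1) - 1 = (2 ^ n - 1) * 2 + 1 := by
      have := Nat.one_le_two_pow (n := n)
      rw [pow_succ]; omega
    simp only [Matrix.cons_val, norm_mul, Complex.norm_real, Real.norm_eq_abs, norm_neg, norm_pow,
      ih, this]
    ring

lemma Rhat_iterate_ne_zero {α : ℝ} (h0 : 0 < α) (h1 : α < 1) {z : Fin 3 → ℂ} (hz : z 2 ≠ 0)
    (n : ℕ) : (Rhat α)^[n] z ≠ 0 := by
  intro h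
  have h2 := Rhat_iterate_two α z n
  rw [h] at h2
  have := ratio_pos h0 h1
  have h3 : 0 < |ratio α| ^ (2 ^ n - 1) * ‖z 2‖ ^ (2 ^ n) := by positivity
  simp at h2
  rcases h2 with h2 | h2
  · exact this.ne' h2.1
  · exact hz h2

lemma Rhat_zero_apply (α : ℝ) : Rhat α 0 = 0 := by simpa using Rhat_smul α 0 0

lemma Rhat_iterate_diagonal {α : ℝ} (h0 : 0 < α) (h1 : α < 1) (n : ℕ) :
    ∃ x y : ℝ, 0 < x ∧ 0 < y ∧ (Rhat α)^[n] ![1, 1, 0] = ![(x : ℂ), (y : ℂ), 0] := by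
  have hd := ratio_pos h0 h1
  induction n with
  | zero => exact ⟨1, 1, one_pos, one_pos, by simp⟩
  | succ n ih =>
    obtain ⟨x, y, hx, hy, h⟩ := ih
    refine ⟨ratio α * (x * (x + (ratio α)⁻¹ * y)),
      ratio α * (ratio α * y * (x + (ratio α)⁻¹ * y)), by positivity, by positivity, ?_⟩
    rw [Function.iterate_succ_apply', h, Rhat_eq]
    ext i
    fin_cases i <;> simp

/-- A point with nonzero third coordinate is never sent to 0, and neither is (1,1,0), whose orbit
stays diagonal and positive. Every hypersurface contains (1,1,0) or meets the affine line (t,t,1).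
-/
theorem isAlgebraicallyStable_Rhat {α : ℝ} (h0 : 0 < α) (h1 : α < 1) :
    IsAlgebraicallyStable (Rhat α) := by
  intro n k P hP hk hPk
  by_cases hP1 : MvPolynomial.eval ![1, 1, 0] P = 0
  · refine ⟨![1, 1, 0], fun h => one_ne_zero (congrFun h 0), hP1, ?_⟩
    obtain ⟨x, y, hx, hy, h⟩ := Rhat_iterate_diagonal h0 h1 n
    rw [h]
    intro h'
    have := congrFun h' 0
    simp at this
    exact hx.ne' this
  -- a one-parameter family of points off the plane on which the third coordinate vanishes
  let p : Polynomial ℂ := MvPolynomial.aeval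
    ![(Polynomial.X : Polynomial ℂ), Polynomial.X, 1] P
  have hp : ∀ t, p.eval t = MvPolynomial.eval ![t, t, 1] P := by
    intro t
    rw [← Polynomial.coe_evalRingHom, ← MvPolynomial.eval₂_id]
    change Polynomial.evalRingHom t (MvPolynomial.aeval _ P) = _
    rw [MvPolynomial.aeval_def, MvPolynomial.hom_eval₂]
    congr 1
    · ext; simp
    · ext i; fin_cases i <;> simp
  -- If p were a nonzero constant c, homogeneity would give P(1,1,s) = c sᵏ, and s → 0 would yield
  -- P(1,1,0) = 0.
  obtain ⟨t, ht⟩ : ∃ t, p.IsRoot t := by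
    apply IsAlgClosed.exists_root
    intro hdeg
    obtain ⟨c, hc⟩ : ∃ c, p = Polynomial.C c := ⟨_, Polynomial.eq_C_of_degree_eq_zero hdeg⟩
    have hhom : ∀ t : ℂ, t ≠ 0 → MvPolynomial.eval ![1, 1, t⁻¹] P * t ^ k = c := by
      intro t ht
      have := hp t
      rw [hc, Polynomial.eval_C] at this
      rw [this]
      have h2 : MvPolynomial.eval (t • ![1, 1, t⁻¹]) P = t ^ k * MvPolynomial.eval ![1, 1, t⁻¹] P := by
          rw [MvPolynomial.eval_eq, MvPolynomial.eval_eq, Finset.mul_sum]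
          refine Finset.sum_congr rfl fun d hd => ?_
          have hdk : ∑ i ∈ d.support, d i = k := by
            have := hPk (MvPolynomial.mem_support_iff.1 hd)
            rw [← this, Finsupp.weight_apply, Finsupp.sum]
            simp
          simp only [Pi.smul_apply, smul_eq_mul, mul_pow, Finset.prod_mul_distrib]
          rw [Finset.prod_pow_eq_pow_sum, hdk]
          ring
      rw [mul_comm, ← h2]
      congr 2
      ext i; fin_cases i <;> simp [ht]
    have hlim : Tendsto (fun s : ℂ => MvPolynomial.eval ![1, 1, s] P) (𝓝[≠] 0)
        (𝓝 (MvPolynomial.eval ![1, 1, 0] P)) := by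
      have hc : Continuous fun s : ℂ => MvPolynomial.eval (![1, 1, s] : Fin 3 → ℂ) P := by
        refine (MvPolynomial.continuous_eval P).comp (continuous_pi fun i => ?_)
        fin_cases i <;> simp <;> fun_prop
      exact (hc.tendsto 0).mono_left nhdsWithin_le_nhds
    have hlim' : Tendsto (fun s : ℂ => c * s ^ k) (𝓝[≠] 0) (𝓝 0) := by
      have hc : Continuous fun s : ℂ => c * s ^ k := by fun_prop
      have := hc.tendsto 0
      rw [zero_pow hk.ne', mul_zero] at this
      exact this.mono_left nhdsWithin_le_nhds
    refine hP1 (tendsto_nhds_unique hlim (hlim'.congr' ?_))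
    filter_upwards [self_mem_nhdsWithin] with s hs
    have := hhom s⁻¹ (inv_ne_zero hs)
    rw [← this, inv_inv, mul_assoc, inv_pow, inv_mul_cancel₀ (pow_ne_zero _ hs), mul_one]
  refine ⟨![t, t, 1], fun h => one_ne_zero (congrFun h 2), ?_, ?_⟩
  · rw [← hp]; exact ht
  · exact Rhat_iterate_ne_zero h0 h1 (by simp) n

/-! ### Existence and bounds of the Green function -/

/-- The real-valued approximations `2⁻ⁿ log ‖Rⁿ z‖`. -/
def greenSeq (α : ℝ) (n : ℕ) (z : Fin 3 → ℂ) : ℝ :=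
  ((2 : ℝ) ^ n)⁻¹ * Real.log ‖(Rhat α)^[n] z‖

lemma greenApprox_eq {α : ℝ} {n : ℕ} {z : Fin 3 → ℂ} (h : (Rhat α)^[n] z ≠ 0) :
    greenApprox (Rhat α) 2 n z = (greenSeq α n z : EReal) := by
  have h1 : (0 : ℝ) < ‖(Rhat α)^[n] z‖ := norm_pos_iff.2 h
  rw [greenApprox, greenSeq, EReal.coe_mul]
  congr 1
  rw [← ofReal_norm, ENNReal.log_ofReal_of_pos h1]

lemma Rhat_iterate_ne_zero_of_le {α : ℝ} {m n : ℕ} (hmn : m ≤ n) {z : Fin 3 → ℂ}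
    (h : (Rhat α)^[n] z ≠ 0) : (Rhat α)^[m] z ≠ 0 := by
  intro h'
  obtain ⟨k, rfl⟩ := Nat.exists_eq_add_of_le hmn
  rw [add_comm, Function.iterate_add_apply, h', Function.iterate_fixed (Rhat_zero_apply α)] at h
  exact h rfl

/-- Divide log ‖R w‖ ≤ log K + 2 log ‖w‖ by 2ⁿ⁺¹. The correction 2⁻ⁿ log K absorbs the constant and
tends to 0. -/
lemma greenSeq_succ_le {α K : ℝ} (hK : 1 ≤ K) (hR : ∀ z, ‖Rhat α z‖ ≤ K * ‖z‖ ^ 2) {n : ℕ}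
    {z : Fin 3 → ℂ} (h : (Rhat α)^[n + 1] z ≠ 0) :
    greenSeq α (n + 1) z + ((2 : ℝ) ^ (n + 1))⁻¹ * Real.log K ≤
      greenSeq α n z + ((2 : ℝ) ^ n)⁻¹ * Real.log K := by
  have hn := Rhat_iterate_ne_zero_of_le n.le_succ h
  have h1 : (0 : ℝ) < ‖(Rhat α)^[n] z‖ := norm_pos_iff.2 hn
  have h2 : (0 : ℝ) < ‖(Rhat α)^[n + 1] z‖ := norm_pos_iff.2 h
  have h3 : Real.log ‖(Rhat α)^[n + 1] z‖ ≤ Real.log K + 2 * Real.log ‖(Rhat α)^[n] z‖ := by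
    have h4 := hR ((Rhat α)^[n] z)
    rw [← Function.iterate_succ_apply' (Rhat α)] at h4
    have h5 := Real.log_le_log h2 h4
    rwa [Real.log_mul (by positivity) (by positivity), Real.log_pow, Nat.cast_ofNat] at h5
  have h4 : ((2 : ℝ) ^ n)⁻¹ = 2 * ((2 : ℝ) ^ (n + 1))⁻¹ := by
    rw [pow_succ]; field_simp
  rw [greenSeq, greenSeq, h4]
  have h5 : (0 : ℝ) < ((2 : ℝ) ^ (n + 1))⁻¹ := by positivity
  nlinarith

lemma greenSeq_antitone {α K : ℝ} (hK : 1 ≤ K) (hR : ∀ z, ‖Rhat α z‖ ≤ K * ‖z‖ ^ 2)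
    {z : Fin 3 → ℂ} (h : ∀ n, (Rhat α)^[n] z ≠ 0) :
    Antitone fun n => greenSeq α n z + ((2 : ℝ) ^ n)⁻¹ * Real.log K :=
  antitone_nat_of_succ_le fun n => greenSeq_succ_le hK hR (h (n + 1))

lemma tendsto_inv_two_pow : Tendsto (fun n : ℕ => ((2 : ℝ) ^ n)⁻¹) atTop (𝓝 0) := by
  simpa [inv_pow] using tendsto_pow_atTop_nhds_zero_of_lt_one (r := (2 : ℝ)⁻¹) (by norm_num)
    (by norm_num)

/-- Up to a vanishing correction the sequence decreases, so it converges or tends to -∞. An orbit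
that reaches 0 stays there, and the value is -∞ from then on. -/
theorem tendsto_greenApprox (α : ℝ) (z : Fin 3 → ℂ) :
    Tendsto (fun n => greenApprox (Rhat α) 2 n z) atTop (𝓝 (Ghat α z)) := by
  suffices h : ∃ l, Tendsto (fun n => greenApprox (Rhat α) 2 n z) atTop (𝓝 l) by
    obtain ⟨l, hl⟩ := h
    rwa [Ghat, greenFunction, hl.limsup_eq]
  by_cases hz : ∀ n, (Rhat α)^[n] z ≠ 0
  · obtain ⟨K, hK, hR⟩ := exists_norm_Rhat_le α
    have h1 := tendsto_inv_two_pow.mul_const (Real.log K)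
    rw [zero_mul] at h1
    have h2 : (fun n => greenApprox (Rhat α) 2 n z) = fun n => ((greenSeq α n z : ℝ) : EReal) :=
      funext fun n => greenApprox_eq (hz n)
    rw [h2]
    rcases tendsto_atTop_of_antitone (greenSeq_antitone hK hR hz) with h | ⟨l, hl⟩
    · refine ⟨⊥, EReal.tendsto_coe_nhds_bot_iff.2 ?_⟩
      refine tendsto_atBot_mono (fun n => ?_) h
      have : 0 ≤ ((2 : ℝ) ^ n)⁻¹ * Real.log K := mul_nonneg (by positivity) (Real.log_nonneg hK)
      linarith
    · refine ⟨(l : EReal), EReal.tendsto_coe.2 ?_⟩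
      have := hl.sub h1
      simpa using this
  · push Not at hz
    obtain ⟨n, hn⟩ := hz
    refine ⟨⊥, tendsto_const_nhds.congr' ?_⟩
    filter_upwards [eventually_ge_atTop n] with k hk
    have : (Rhat α)^[k] z = 0 := by
      by_contra h
      exact Rhat_iterate_ne_zero_of_le hk h hn
    rw [greenApprox, this, enorm_zero, ENNReal.log_zero, EReal.coe_mul_bot_of_pos (by positivity)]

lemma le_greenSeq {α : ℝ} (h0 : 0 < α) (h1 : α < 1) {z : Fin 3 → ℂ} (hz : z 2 ≠ 0) (n : ℕ) :
    -|Real.log (ratio α)| + Real.log ‖z 2‖ ≤ greenSeq α n z := by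
  have hd := ratio_pos h0 h1
  have hz' : 0 < ‖z 2‖ := norm_pos_iff.2 hz
  have h2 : Real.log (ratio α ^ (2 ^ n - 1) * ‖z 2‖ ^ (2 ^ n)) ≤
      Real.log ‖(Rhat α)^[n] z‖ := by
    refine Real.log_le_log (by positivity) ?_
    have := Rhat_iterate_two α z n
    rw [abs_of_pos hd] at this
    rw [← this]
    exact norm_le_pi_norm _ 2
  rw [Real.log_mul (by positivity) (by positivity), Real.log_pow, Real.log_pow,
    Nat.cast_sub Nat.one_le_two_pow] at h2
  push_cast at h2
  rw [greenSeq]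
  have h3 : (0 : ℝ) < 2 ^ n := by positivity
  have h4 : (1 : ℝ) ≤ 2 ^ n := one_le_pow₀ (by norm_num)
  rw [← div_eq_inv_mul, le_div_iff₀ h3]
  refine le_trans ?_ h2
  have := neg_abs_le (Real.log (ratio α))
  have h5 := abs_nonneg (Real.log (ratio α))
  nlinarith

lemma exists_greenSeq_le (α : ℝ) : ∃ K : ℝ, 0 ≤ K ∧ ∀ (z : Fin 3 → ℂ) (n : ℕ),
    (Rhat α)^[n] z ≠ 0 → greenSeq α n z ≤ Real.log ‖z‖ + K := by
  obtain ⟨K, hK, hR⟩ := exists_norm_Rhat_le α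
  have hK0 := Real.log_nonneg hK
  refine ⟨Real.log K, hK0, fun z n hn => ?_⟩
  have h : greenSeq α n z + ((2 : ℝ) ^ n)⁻¹ * Real.log K ≤ Real.log ‖z‖ + Real.log K := by
    induction n with
    | zero => simp [greenSeq]
    | succ n ih =>
      exact (greenSeq_succ_le hK hR hn).trans (ih (Rhat_iterate_ne_zero_of_le n.le_succ hn))
  have : 0 ≤ ((2 : ℝ) ^ n)⁻¹ * Real.log K := by positivity
  linarith

lemma tendsto_greenSeq {α : ℝ} (h0 : 0 < α) (h1 : α < 1) {z : Fin 3 → ℂ} (hz : z 2 ≠ 0) :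
    Ghat α z ≠ ⊥ ∧ Ghat α z ≠ ⊤ ∧
      Tendsto (fun n => greenSeq α n z) atTop (𝓝 (Ghat α z).toReal) := by
  have hne := Rhat_iterate_ne_zero h0 h1 hz
  have h2 : (fun n => greenApprox (Rhat α) 2 n z) = fun n => ((greenSeq α n z : ℝ) : EReal) :=
    funext fun n => greenApprox_eq (hne n)
  have h3 := tendsto_greenApprox α z
  rw [h2] at h3
  obtain ⟨K, -, hK⟩ := exists_greenSeq_le α
  have hb : Ghat α z ≠ ⊥ := by
    have := ge_of_tendsto' h3 fun n => EReal.coe_le_coe_iff.2 (le_greenSeq h0 h1 hz n)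
    exact ne_bot_of_le_ne_bot (EReal.coe_ne_bot _) this
  have ht : Ghat α z ≠ ⊤ := by
    have := le_of_tendsto' h3 fun n => EReal.coe_le_coe_iff.2 (hK z n (hne n))
    exact ne_top_of_le_ne_top (EReal.coe_ne_top _) this
  refine ⟨hb, ht, ?_⟩
  have := (EReal.tendsto_toReal ht hb).comp h3
  simpa [Function.comp_def] using this

/-- Logarithmic homogeneity. It compares the vector (a,d,-1) with the trace matrix (a,d,-1)/b at the
cost of log|b|. -/
lemma Ghat_smul_toReal {α : ℝ} (h0 : 0 < α) (h1 : α < 1) {z : Fin 3 → ℂ} (hz : z 2 ≠ 0) {c : ℂ}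
    (hc : c ≠ 0) : (Ghat α (c • z)).toReal = Real.log ‖c‖ + (Ghat α z).toReal := by
  have hcz : (c • z) 2 ≠ 0 := by simp [hc, hz]
  refine tendsto_nhds_unique (tendsto_greenSeq h0 h1 hcz).2.2 ?_
  refine ((tendsto_greenSeq h0 h1 hz).2.2.const_add (Real.log ‖c‖)).congr fun n => ?_
  have h2 : (0 : ℝ) < ‖(Rhat α)^[n] z‖ := norm_pos_iff.2 (Rhat_iterate_ne_zero h0 h1 hz n)
  rw [greenSeq, greenSeq, Rhat_iterate_smul, norm_smul, norm_pow,
    Real.log_mul (pow_ne_zero _ (norm_ne_zero_iff.2 hc)) h2.ne', Real.log_pow]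
  push_cast
  field_simp

lemma Ghat_toReal_bounds {α : ℝ} (h0 : 0 < α) (h1 : α < 1) : ∃ K : ℝ, 0 ≤ K ∧
    ∀ z : Fin 3 → ℂ, z 2 ≠ 0 →
      -K + Real.log ‖z 2‖ ≤ (Ghat α z).toReal ∧ (Ghat α z).toReal ≤ Real.log ‖z‖ + K := by
  obtain ⟨K, hK0, hK⟩ := exists_greenSeq_le α
  refine ⟨max |Real.log (ratio α)| K, le_max_of_le_left (abs_nonneg _), fun z hz => ⟨?_, ?_⟩⟩
  · refine le_trans ?_ (ge_of_tendsto' (tendsto_greenSeq h0 h1 hz).2.2 fun n => le_greenSeq h0 h1 hz n)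
    have := le_max_left |Real.log (ratio α)| K
    linarith
  · refine le_trans (le_of_tendsto' (tendsto_greenSeq h0 h1 hz).2.2
      fun n => hK z n (Rhat_iterate_ne_zero h0 h1 hz n)) ?_
    have := le_max_right |Real.log (ratio α)| K
    linarith

/-! ### Transfer matrices -/

/-- A transfer matrix `[[a, b], [c, d]]`, acting on Cauchy data `(u, p)`. -/
@[ext]
structure Transfer where
  a : ℂ
  b : ℂ
  c : ℂ
  d : ℂ

namespace Transfer

/-- The value of the solution at the right end point. -/
def fst (M : Transfer) (u p : ℂ) : ℂ := M.a * u + M.b * p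

/-- The derivative of the solution at the right end point. -/
def snd (M : Transfer) (u p : ℂ) : ℂ := M.c * u + M.d * p

/-- The determinant of a transfer matrix. -/
def det (M : Transfer) : ℂ := M.a * M.d - M.b * M.c

/-- The transfer matrix of the same string, with its length scaled by `s`. -/
def scale (s : ℝ) (M : Transfer) : Transfer := ⟨M.a, s * M.b, M.c / s, M.d⟩

/-- The product of transfer matrices: `M` comes after `N`. -/
def comp (M N : Transfer) : Transfer :=
  ⟨M.a * N.a + M.b * N.c, M.a * N.b + M.b * N.d, M.c * N.a + M.d * N.c, M.c * N.b + M.d * N.d⟩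

/-- The transfer matrix of the string that consists of two copies, with lengths `α` and `1 - α`. -/
def double (α : ℝ) (M : Transfer) : Transfer := (M.scale (1 - α)).comp (M.scale α)

/-- The point `(a, d, -1)`: the trace matrix up to the factor `b`. -/
def toVec (M : Transfer) : Fin 3 → ℂ := ![M.a, M.d, -1]

/-- The Hermitian form `Im (conj u * p)`. -/
def flux (u p : ℂ) : ℝ := ((starRingEnd ℂ) u * p).im

lemma comp_fst (M N : Transfer) (u p : ℂ) : (M.comp N).fst u p = M.fst (N.fst u p) (N.snd u p) := by
  simp only [comp, fst, snd]; ring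

lemma comp_snd (M N : Transfer) (u p : ℂ) : (M.comp N).snd u p = M.snd (N.fst u p) (N.snd u p) := by
  simp only [comp, fst, snd]; ring

lemma scale_fst {s : ℝ} (M : Transfer) (u p : ℂ) :
    (M.scale s).fst u p = M.fst u (s * p) := by
  simp only [scale, fst]; ring

lemma scale_snd {s : ℝ} (hs : 0 < s) (M : Transfer) (u p : ℂ) :
    (M.scale s).snd u p = M.snd u (s * p) / s := by
  have : (s : ℂ) ≠ 0 := by exact_mod_cast hs.ne'
  simp only [scale, snd]; field_simp

lemma det_scale {s : ℝ} (hs : 0 < s) (M : Transfer) : (M.scale s).det = M.det := by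
  have : (s : ℂ) ≠ 0 := by exact_mod_cast hs.ne'
  simp only [det, scale]; field_simp

lemma det_comp (M N : Transfer) : (M.comp N).det = M.det * N.det := by
  simp only [det, comp]; ring

lemma det_double {α : ℝ} (h0 : 0 < α) (h1 : α < 1) {M : Transfer} (h : M.det = 1) :
    (M.double α).det = 1 := by
  rw [double, det_comp, det_scale (by linarith), det_scale h0, h, one_mul]

lemma double_b (α : ℝ) (M : Transfer) :
    (M.double α).b = M.b * (α * M.a + (1 - α) * M.d) := by
  simp only [double, comp, scale]; push_cast; ring

/-- The products bc that arise from gluing are eliminated through ad - bc = 1, so doubling closes up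
on the pair (a,d) and becomes the quadratic map `Rhat`. -/
lemma Rhat_toVec {α : ℝ} (h0 : 0 < α) (h1 : α < 1) {M : Transfer} (h : M.det = 1) :
    Rhat α M.toVec = (ratio α : ℂ) • (M.double α).toVec := by
  have ha : (α : ℂ) ≠ 0 := by exact_mod_cast h0.ne'
  have ha' : (1 - α : ℂ) ≠ 0 := by
    have : (1 - α : ℝ) ≠ 0 := by linarith
    exact_mod_cast this
  have hbc : M.b * M.c = M.a * M.d - 1 := by rw [← h, det]; ring
  rw [Rhat_eq]
  ext i
  fin_cases i
  · simp [toVec, double, comp, scale, ratio]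
    field_simp
    left
    linear_combination (1 - (α : ℂ)) * (-hbc)
  · simp [toVec, double, comp, scale, ratio]
    field_simp
    left
    linear_combination (-(α : ℂ)) * hbc
  · simp [toVec]

lemma det_double_iterate {α : ℝ} (h0 : 0 < α) (h1 : α < 1) {M : Transfer} (h : M.det = 1) (n : ℕ) :
    ((double α)^[n] M).det = 1 := by
  induction n with
  | zero => simpa
  | succ n ih => rw [Function.iterate_succ_apply']; exact det_double h0 h1 ih

/-- The exponent solves e(n+1) = 2e(n) + 1, so after division by 2ⁿ the factor contributes log δ in
the limit. -/
lemma Rhat_iterate_toVec {α : ℝ} (h0 : 0 < α) (h1 : α < 1) {M : Transfer} (h : M.det = 1) (n : ℕ) :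
    (Rhat α)^[n] M.toVec = ((ratio α : ℂ) ^ (2 ^ n - 1)) • ((double α)^[n] M).toVec := by
  induction n with
  | zero => simp
  | succ n ih =>
    have : 2 ^ (n + 1) - 1 = (2 ^ n - 1) * 2 + 1 := by
      have := Nat.one_le_two_pow (n := n)
      rw [pow_succ]; omega
    rw [Function.iterate_succ_apply', Function.iterate_succ_apply', ih, Rhat_smul,
      Rhat_toVec h0 h1 (det_double_iterate h0 h1 h n), smul_smul, this]
    congr 1
    ring

lemma one_le_norm_toVec (M : Transfer) : 1 ≤ ‖M.toVec‖ := by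
  simpa [toVec] using norm_le_pi_norm M.toVec 2

lemma norm_toVec_le {M : Transfer} {x : ℝ} (ha : ‖M.a‖ ≤ x) (hd : ‖M.d‖ ≤ x) (h : 1 ≤ x) :
    ‖M.toVec‖ ≤ x := by
  rw [pi_norm_le_iff_of_nonneg (by linarith)]
  intro i
  fin_cases i <;> simpa [toVec]

/-! ### Quantitative expansion of the flux -/

/-- `M` increases `s` times the flux. -/
def Expansive (s κ : ℝ) (M : Transfer) : Prop :=
  ∀ u p : ℂ, κ * (‖u‖ ^ 2 + ‖p‖ ^ 2) ≤ s * (flux (M.fst u p) (M.snd u p) - flux u p) ∧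
    κ * (‖M.fst u p‖ ^ 2 + ‖M.snd u p‖ ^ 2) ≤ s * (flux (M.fst u p) (M.snd u p) - flux u p)

lemma flux_smul_div {t : ℝ} (u p : ℂ) : flux u (p / t) = flux u p / t := by
  rw [flux, flux, mul_div_assoc', Complex.div_ofReal_im]

lemma flux_smul {t : ℝ} (u p : ℂ) : flux u (t * p) = t * flux u p := by
  rw [flux, flux, mul_left_comm, Complex.im_ofReal_mul]

lemma abs_flux_le (u p : ℂ) : |flux u p| ≤ ‖u‖ * ‖p‖ := by
  refine (Complex.abs_im_le_norm _).trans ?_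
  rw [norm_mul, RCLike.norm_conj]

lemma scale_flux_sub {t : ℝ} (ht : 0 < t) (M : Transfer) (u p : ℂ) :
    flux ((M.scale t).fst u p) ((M.scale t).snd u p) - flux u p =
      (flux (M.fst u (t * p)) (M.snd u (t * p)) - flux u (t * p)) / t := by
  rw [scale_fst, scale_snd ht, flux_smul_div, flux_smul u p]
  field_simp

/-- Scaling conjugates M by diag(1,t) and divides the flux increment by t. Since t² ≤ 1, comparing
the weighted norms costs only a factor t. -/
lemma Expansive.scale {s κ t : ℝ} (hκ : 0 ≤ κ) (h0 : 0 < t) (h1 : t < 1) {M : Transfer}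
    (h : M.Expansive s κ) : (M.scale t).Expansive s (t * κ) := by
  intro u p
  have h2 := h u (t * p)
  rw [scale_flux_sub h0, mul_div_assoc', le_div_iff₀ h0, le_div_iff₀ h0]
  have h3 : ‖(t : ℂ) * p‖ = t * ‖p‖ := by rw [norm_mul, Complex.norm_real, Real.norm_of_nonneg h0.le]
  rw [h3] at h2
  have ht2 : t ^ 2 ≤ 1 := pow_le_one₀ h0.le h1.le
  refine ⟨le_trans ?_ h2.1, le_trans ?_ h2.2⟩
  · have : t * κ * (‖u‖ ^ 2 + ‖p‖ ^ 2) * t = κ * (t ^ 2 * ‖u‖ ^ 2 + (t * ‖p‖) ^ 2) := by ring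
    rw [this]
    gcongr
    exact mul_le_of_le_one_left (by positivity) ht2
  · rw [scale_fst, scale_snd h0, norm_div, Complex.norm_real, Real.norm_of_nonneg h0.le]
    set x := ‖M.fst u (t * p)‖
    set y := ‖M.snd u (t * p)‖
    have : t * κ * (x ^ 2 + (y / t) ^ 2) * t = κ * (t ^ 2 * x ^ 2 + y ^ 2) := by field_simp
    rw [this]
    gcongr
    exact mul_le_of_le_one_left (by positivity) ht2

/-- The two halves raise the signed flux separately and the increments add up. The left half
controls the incoming data and the right half the outgoing data, so only min α (1 - α) is lost per
doubling. -/
lemma Expansive.double {s κ α : ℝ} (hκ : 0 ≤ κ) (h0 : 0 < α) (h1 : α < 1) {M : Transfer}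
    (h : M.Expansive s κ) : (M.double α).Expansive s (min α (1 - α) * κ) := by
  have hL := h.scale hκ h0 h1
  have hR := h.scale hκ (t := 1 - α) (by linarith) (by linarith)
  intro u p
  rw [Transfer.double, comp_fst, comp_snd]
  set N := M.scale α
  have hL' := hL u p
  have hR' := hR (N.fst u p) (N.snd u p)
  have hm1 : min α (1 - α) * κ ≤ α * κ := mul_le_mul_of_nonneg_right (min_le_left _ _) hκ
  have hm2 : min α (1 - α) * κ ≤ (1 - α) * κ := mul_le_mul_of_nonneg_right (min_le_right _ _) hκ
  have hm : 0 ≤ min α (1 - α) * κ := mul_nonneg (le_min h0.le (by linarith)) hκ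
  have e1 := mul_le_mul_of_nonneg_right hm1 (by positivity : 0 ≤ ‖u‖ ^ 2 + ‖p‖ ^ 2)
  have e2 := mul_le_mul_of_nonneg_right hm2
    (by positivity : 0 ≤ ‖(M.scale (1 - α)).fst (N.fst u p) (N.snd u p)‖ ^ 2 +
      ‖(M.scale (1 - α)).snd (N.fst u p) (N.snd u p)‖ ^ 2)
  have e3 : 0 ≤ min α (1 - α) * κ * (‖u‖ ^ 2 + ‖p‖ ^ 2) := by positivity
  have e4 := mul_nonneg hm
    (by positivity : 0 ≤ ‖(M.scale (1 - α)).fst (N.fst u p) (N.snd u p)‖ ^ 2 +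
      ‖(M.scale (1 - α)).snd (N.fst u p) (N.snd u p)‖ ^ 2)
  constructor <;> linarith [hL'.1, hR'.2]

lemma Expansive.double_iterate {s κ α : ℝ} (hκ : 0 ≤ κ) (h0 : 0 < α) (h1 : α < 1) {M : Transfer}
    (h : M.Expansive s κ) (n : ℕ) :
    ((Transfer.double α)^[n] M).Expansive s (min α (1 - α) ^ n * κ) := by
  have hm : 0 < min α (1 - α) := lt_min h0 (by linarith)
  induction n with
  | zero => simpa
  | succ n ih =>
    rw [Function.iterate_succ_apply', pow_succ', mul_assoc]
    exact ih.double (by positivity) h0 h1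

lemma comparable_of_mul_ge {κ x y z : ℝ} (hκ : 0 < κ) (hx : 0 ≤ x) (hy : 0 ≤ y)
    (h : κ * (x ^ 2 + y ^ 2) ≤ z) (hz : z ≤ x * y) : κ * y ≤ x ∧ κ * x ≤ y := by
  constructor
  · rcases hy.eq_or_lt with rfl | hy
    · simpa
    · have : κ * y * y ≤ x * y := by nlinarith [mul_nonneg hκ.le (sq_nonneg x)]
      exact le_of_mul_le_mul_right this hy
  · rcases hx.eq_or_lt with rfl | hx
    · simpa
    · have : κ * x * x ≤ y * x := by nlinarith [mul_nonneg hκ.le (sq_nonneg y)]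
      exact le_of_mul_le_mul_right this hx

lemma abs_mul_flux_le {s : ℝ} (hs : |s| = 1) (u p : ℂ) : s * flux u p ≤ ‖u‖ * ‖p‖ := by
  refine (le_abs_self _).trans ?_
  rw [abs_mul, hs, one_mul]
  exact abs_flux_le u p

/-- The entries of an expansive transfer matrix are comparable. -/
lemma Expansive.bounds {s κ : ℝ} (hs : |s| = 1) (hκ : 0 < κ) {M : Transfer}
    (hM : M.det = 1) (h : M.Expansive s κ) :
    (κ / 2 * ‖M.toVec‖ ≤ ‖M.b‖ ∧ ‖M.b‖ ≤ ‖M.toVec‖ / κ) ∧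
    (κ / 2 * ‖M.toVec‖ ≤ ‖M.c‖ ∧ ‖M.c‖ ≤ ‖M.toVec‖ / κ) := by
  have hs' : |(-s)| = 1 := by rwa [abs_neg]
  have hdet : M.a * M.d - M.b * M.c = 1 := hM
  have f0 : ∀ z, flux 0 z = 0 := fun z => by simp [flux]
  have f1 : ∀ z, flux z 0 = 0 := fun z => by simp [flux]
  -- Each of the data (0,1), (1,0), (-b,a), (d,-c) has zero flux at one end, so the expansion
  -- inequality compares the moduli of the two components at the other end.
  have hbd : κ * ‖M.d‖ ≤ ‖M.b‖ ∧ κ * ‖M.b‖ ≤ ‖M.d‖ := by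
    have h1 := (h 0 1).2
    simp only [fst, snd, mul_zero, zero_add, mul_one, f0, sub_zero] at h1
    exact comparable_of_mul_ge hκ (norm_nonneg _) (norm_nonneg _) h1 (abs_mul_flux_le hs _ _)
  have hac : κ * ‖M.c‖ ≤ ‖M.a‖ ∧ κ * ‖M.a‖ ≤ ‖M.c‖ := by
    have h1 := (h 1 0).2
    simp only [fst, snd, mul_zero, add_zero, mul_one, f1, sub_zero] at h1
    exact comparable_of_mul_ge hκ (norm_nonneg _) (norm_nonneg _) h1 (abs_mul_flux_le hs _ _)
  have hba : κ * ‖M.a‖ ≤ ‖M.b‖ ∧ κ * ‖M.b‖ ≤ ‖M.a‖ := by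
    have h1 := (h (-M.b) M.a).1
    have e1 : M.fst (-M.b) M.a = 0 := by simp only [fst]; ring
    rw [e1, f0, zero_sub, mul_neg, ← neg_mul] at h1
    have h2 := h1.trans (abs_mul_flux_le hs' _ _)
    rw [norm_neg] at h2 h1
    exact comparable_of_mul_ge hκ (norm_nonneg _) (norm_nonneg _) h2 le_rfl
  have hdc : κ * ‖M.c‖ ≤ ‖M.d‖ ∧ κ * ‖M.d‖ ≤ ‖M.c‖ := by
    have h1 := (h M.d (-M.c)).1
    have e1 : M.snd M.d (-M.c) = 0 := by simp only [snd]; ring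
    rw [e1, f1, zero_sub, mul_neg, ← neg_mul] at h1
    have h2 := h1.trans (abs_mul_flux_le hs' _ _)
    rw [norm_neg] at h2 h1
    exact comparable_of_mul_ge hκ (norm_nonneg _) (norm_nonneg _) h2 le_rfl
  -- The determinant prevents all four entries from being small. This is needed because the third
  -- coordinate of `toVec` has modulus 1.
  have hone : 1 ≤ ‖M.a‖ * ‖M.d‖ + ‖M.b‖ * ‖M.c‖ := by
    have := norm_sub_le (M.a * M.d) (M.b * M.c)
    rwa [hdet, norm_one, norm_mul, norm_mul] at this
  obtain ⟨a0, b0, c0, d0⟩ : 0 ≤ ‖M.a‖ ∧ 0 ≤ ‖M.b‖ ∧ 0 ≤ ‖M.c‖ ∧ 0 ≤ ‖M.d‖ :=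
    ⟨norm_nonneg _, norm_nonneg _, norm_nonneg _, norm_nonneg _⟩
  have hle : ‖M.a‖ ≤ ‖M.toVec‖ := by simpa [toVec] using norm_le_pi_norm M.toVec 0
  -- Source of the constant κ/2: for y = x/κ ≥ 0, the inequality 2y² ≥ 1 implies 2y ≥ 1.
  have key : ∀ x : ℝ, 0 ≤ x → 1 ≤ 2 * (x / κ) ^ 2 → 1 ≤ x / (κ / 2) := by
    intro x hx h
    have e : x / (κ / 2) = 2 * (x / κ) := by field_simp
    have : 0 ≤ x / κ := by positivity
    rw [e]; nlinarith
  have ha1 : ‖M.toVec‖ ≤ ‖M.b‖ / (κ / 2) := by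
    have ha : ‖M.a‖ ≤ ‖M.b‖ / κ := by rw [le_div_iff₀ hκ]; linarith
    have hd : ‖M.d‖ ≤ ‖M.b‖ / κ := by rw [le_div_iff₀ hκ]; linarith
    have hc : ‖M.b‖ * ‖M.c‖ ≤ (‖M.b‖ / κ) ^ 2 := by
      have h1 : ‖M.c‖ ≤ ‖M.a‖ / κ := by rw [le_div_iff₀ hκ]; linarith
      calc ‖M.b‖ * ‖M.c‖ ≤ ‖M.b‖ * (‖M.b‖ / κ / κ) := by gcongr; exact h1.trans (by gcongr)
        _ = _ := by field_simp
    have h2 : ‖M.a‖ * ‖M.d‖ ≤ (‖M.b‖ / κ) ^ 2 := by rw [sq]; gcongr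
    have h3 : ‖M.b‖ / κ ≤ ‖M.b‖ / (κ / 2) := by gcongr; linarith
    refine norm_toVec_le (ha.trans h3) (hd.trans h3) (key _ b0 (by linarith))
  have hc1 : ‖M.toVec‖ ≤ ‖M.c‖ / (κ / 2) := by
    have ha : ‖M.a‖ ≤ ‖M.c‖ / κ := by rw [le_div_iff₀ hκ]; linarith
    have hd : ‖M.d‖ ≤ ‖M.c‖ / κ := by rw [le_div_iff₀ hκ]; linarith
    have hc : ‖M.b‖ * ‖M.c‖ ≤ (‖M.c‖ / κ) ^ 2 := by
      have h1 : ‖M.b‖ ≤ ‖M.a‖ / κ := by rw [le_div_iff₀ hκ]; linarith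
      calc ‖M.b‖ * ‖M.c‖ ≤ ‖M.c‖ / κ / κ * ‖M.c‖ := by gcongr; exact h1.trans (by gcongr)
        _ = _ := by field_simp
    have h2 : ‖M.a‖ * ‖M.d‖ ≤ (‖M.c‖ / κ) ^ 2 := by rw [sq]; gcongr
    have h3 : ‖M.c‖ / κ ≤ ‖M.c‖ / (κ / 2) := by gcongr; linarith
    refine norm_toVec_le (ha.trans h3) (hd.trans h3) (key _ c0 (by linarith))
  rw [le_div_iff₀ (by positivity)] at ha1 hc1
  refine ⟨⟨by linarith, ?_⟩, ⟨by linarith, ?_⟩⟩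
  · rw [le_div_iff₀ hκ]; linarith
  · rw [le_div_iff₀ hκ]; linarith

end Transfer

open Transfer

/-- An entire family of real transfer matrices of determinant `1`, such that the flux increases
by `Im x` times a positive form. -/
structure IsTransferFamily (M : ℂ → Transfer) (Q : ℂ → ℂ → ℂ → ℝ) : Prop where
  diff_a : Differentiable ℂ fun x => (M x).a
  diff_b : Differentiable ℂ fun x => (M x).b
  diff_c : Differentiable ℂ fun x => (M x).c
  diff_d : Differentiable ℂ fun x => (M x).d
  det_eq : ∀ x, (M x).det = 1
  flux_sub : ∀ x u p, flux ((M x).fst u p) ((M x).snd u p) - flux u p = x.im * Q x u p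
  cont : Continuous fun y : ℂ × ℂ × ℂ => Q y.1 y.2.1 y.2.2
  hom : ∀ x c u p, Q x (c * u) (c * p) = ‖c‖ ^ 2 * Q x u p
  pos : ∀ x u p, (u ≠ 0 ∨ p ≠ 0) → 0 < Q x u p

/-! ### Transfer families: doubling, uniform expansion, real simple zeros -/

namespace IsTransferFamily

variable {M : ℂ → Transfer} {Q : ℂ → ℂ → ℂ → ℝ}

lemma nonneg (h : IsTransferFamily M Q) (x u p : ℂ) : 0 ≤ Q x u p := by
  by_cases hu : u ≠ 0 ∨ p ≠ 0
  · exact (h.pos x u p hu).le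
  · push Not at hu
    have := h.hom x 0 0 0
    simp only [mul_zero, norm_zero, ne_eq, OfNat.ofNat_ne_zero, not_false_eq_true, zero_pow,
      zero_mul] at this
    rw [hu.1, hu.2, this]

lemma continuous_fst (h : IsTransferFamily M Q) :
    Continuous fun y : ℂ × ℂ × ℂ => (M y.1).fst y.2.1 y.2.2 := by
  have h1 := h.diff_a.continuous
  have h2 := h.diff_b.continuous
  have h3 : Continuous fun y : ℂ × ℂ × ℂ => (M y.1).a := h1.comp _root_.continuous_fst
  have h4 : Continuous fun y : ℂ × ℂ × ℂ => (M y.1).b := h2.comp _root_.continuous_fst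
  simp only [fst]
  fun_prop

lemma continuous_snd (h : IsTransferFamily M Q) :
    Continuous fun y : ℂ × ℂ × ℂ => (M y.1).snd y.2.1 y.2.2 := by
  have h1 := h.diff_c.continuous
  have h2 := h.diff_d.continuous
  have h3 : Continuous fun y : ℂ × ℂ × ℂ => (M y.1).c := h1.comp _root_.continuous_fst
  have h4 : Continuous fun y : ℂ × ℂ × ℂ => (M y.1).d := h2.comp _root_.continuous_fst
  simp only [snd]
  fun_prop

/-- The form of the doubled family is the sum of the rescaled forms of the two halves. The left
summand alone is already positive definite. -/
lemma double (h : IsTransferFamily M Q) {α : ℝ} (h0 : 0 < α) (h1 : α < 1) :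
    IsTransferFamily (fun x => (M x).double α) fun x u p =>
      Q x u (α * p) / α + Q x (((M x).scale α).fst u p)
        ((1 - α : ℝ) * ((M x).scale α).snd u p) / (1 - α) := by
  have h1' : 0 < 1 - α := by linarith
  have ha := h.diff_a
  have hb := h.diff_b
  have hc := h.diff_c
  have hd := h.diff_d
  refine ⟨?_, ?_, ?_, ?_, fun x => det_double h0 h1 (h.det_eq x), ?_, ?_, ?_, ?_⟩
  · simp only [Transfer.double, comp, Transfer.scale]; fun_prop
  · simp only [Transfer.double, comp, Transfer.scale]; fun_prop
  · simp only [Transfer.double, comp, Transfer.scale]; fun_prop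
  · simp only [Transfer.double, comp, Transfer.scale]; fun_prop
  · intro x u p
    rw [Transfer.double, comp_fst, comp_snd]
    have e1 := scale_flux_sub h0 (M x) u p
    have e2 := scale_flux_sub h1' (M x) (((M x).scale α).fst u p) (((M x).scale α).snd u p)
    rw [h.flux_sub] at e1 e2
    linear_combination e1 + e2
  · have hq := h.cont
    have hf := h.continuous_fst
    have hs := h.continuous_snd
    have hsc : Continuous fun y : ℂ × ℂ × ℂ => (y.1, y.2.1, (α : ℂ) * y.2.2) := by fun_prop
    have hf' : Continuous fun y : ℂ × ℂ × ℂ => ((M y.1).scale α).fst y.2.1 y.2.2 := by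
      simp only [scale_fst]
      exact hf.comp hsc
    have hs' : Continuous fun y : ℂ × ℂ × ℂ => ((M y.1).scale α).snd y.2.1 y.2.2 := by
      simp only [scale_snd h0]
      exact (hs.comp hsc).div_const _
    refine ((hq.comp hsc).div_const _).add (Continuous.div_const ?_ _)
    exact hq.comp (_root_.continuous_fst.prodMk (hf'.prodMk (continuous_const.mul hs')))
  · intro x c u p
    have e1 : ((M x).scale α).fst (c * u) (c * p) = c * ((M x).scale α).fst u p := by
      simp only [fst]; ring
    have e2 : ((M x).scale α).snd (c * u) (c * p) = c * ((M x).scale α).snd u p := by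
      simp only [snd]; ring
    rw [e1, e2, mul_left_comm, h.hom, mul_left_comm _ c, h.hom]
    ring
  · intro x u p hup
    have e1 : 0 < Q x u (α * p) := by
      refine h.pos _ _ _ (hup.imp_right fun hp => mul_ne_zero ?_ hp)
      exact_mod_cast h0.ne'
    have e2 := h.nonneg x (((M x).scale α).fst u p) ((1 - α : ℝ) * ((M x).scale α).snd u p)
    positivity

lemma double_iterate (h : IsTransferFamily M Q) {α : ℝ} (h0 : 0 < α) (h1 : α < 1) (n : ℕ) :
    ∃ Q', IsTransferFamily (fun x => (Transfer.double α)^[n] (M x)) Q' := by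
  induction n with
  | zero => exact ⟨Q, h⟩
  | succ n ih =>
    obtain ⟨Q', h'⟩ := ih
    simp only [Function.iterate_succ_apply']
    exact ⟨_, h'.double h0 h1⟩

/-- Compactness of a ball times the unit sphere, then homogeneity in (u,p). The constant is linear
in |Im x|; this is the origin of the |log|Im x|| in all later bounds. -/
lemma exists_expansive (h : IsTransferFamily M Q) (R : ℝ) : ∃ c : ℝ, 0 < c ∧
    ∀ x : ℂ, ‖x‖ ≤ R → ∀ s : ℝ, s * x.im = |x.im| → (M x).Expansive s (c * |x.im|) := by
  by_cases hR : 0 ≤ R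
  swap
  · exact ⟨1, one_pos, fun x hx => absurd ((norm_nonneg x).trans hx) hR⟩
  let K : Set (ℂ × ℂ × ℂ) := Metric.closedBall 0 R ×ˢ Metric.sphere 0 1
  have hK : IsCompact K := (isCompact_closedBall _ _).prod (isCompact_sphere _ _)
  have hKne : K.Nonempty := ⟨(0, 1, 0), by simp [K, hR, Prod.norm_def]⟩
  obtain ⟨y, hyK, hy⟩ := hK.exists_isMinOn hKne h.cont.continuousOn
  have hq : 0 < Q y.1 y.2.1 y.2.2 := by
    refine h.pos _ _ _ ?_
    by_contra! hc
    have h2 : ‖y.2‖ = 1 := by simpa using hyK.2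
    have : y.2 = 0 := Prod.ext hc.1 hc.2
    simp [this] at h2
  have hcont : Continuous fun y : ℂ × ℂ × ℂ => ‖y.2.1‖ ^ 2 + ‖y.2.2‖ ^ 2 +
      (‖(M y.1).fst y.2.1 y.2.2‖ ^ 2 + ‖(M y.1).snd y.2.1 y.2.2‖ ^ 2) := by
    have := h.continuous_fst
    have := h.continuous_snd
    fun_prop
  obtain ⟨C, hC⟩ := hK.exists_bound_of_continuousOn hcont.continuousOn
  set q := Q y.1 y.2.1 y.2.2
  have hC1 : 0 < max C 1 := by positivity
  have key : ∀ x : ℂ, ‖x‖ ≤ R → ∀ u p : ℂ, q / max C 1 * (‖u‖ ^ 2 + ‖p‖ ^ 2 +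
      (‖(M x).fst u p‖ ^ 2 + ‖(M x).snd u p‖ ^ 2)) ≤ Q x u p := by
    intro x hx u p
    by_cases hup : (u, p) = (0 : ℂ × ℂ)
    · obtain ⟨rfl, rfl⟩ := Prod.mk.inj hup
      simpa [fst, snd] using h.nonneg x 0 0
    have hr : (0 : ℝ) < ‖((u, p) : ℂ × ℂ)‖ := norm_pos_iff.2 hup
    set r := ‖((u, p) : ℂ × ℂ)‖
    have hrc : (r : ℂ) ≠ 0 := by exact_mod_cast hr.ne'
    have hmem : (x, (r : ℂ)⁻¹ * u, (r : ℂ)⁻¹ * p) ∈ K := by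
      refine ⟨by simpa using hx, ?_⟩
      have : (((r : ℂ)⁻¹ * u, (r : ℂ)⁻¹ * p) : ℂ × ℂ) = (r : ℂ)⁻¹ • (u, p) := rfl
      rw [mem_sphere_zero_iff_norm, this, norm_smul, norm_inv, Complex.norm_real,
        Real.norm_of_nonneg hr.le, inv_mul_cancel₀ hr.ne']
    have h2 := hC _ hmem
    have h3 : q ≤ _ := hy hmem
    simp only [h.hom] at h3
    have e1 : (M x).fst ((r : ℂ)⁻¹ * u) ((r : ℂ)⁻¹ * p) = (r : ℂ)⁻¹ * (M x).fst u p := by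
      simp only [fst]; ring
    have e2 : (M x).snd ((r : ℂ)⁻¹ * u) ((r : ℂ)⁻¹ * p) = (r : ℂ)⁻¹ * (M x).snd u p := by
      simp only [snd]; ring
    have e3 : ‖(r : ℂ)⁻¹‖ = r⁻¹ := by rw [norm_inv, Complex.norm_real, Real.norm_of_nonneg hr.le]
    rw [e1, e2] at h2
    simp only [norm_mul, e3, mul_pow] at h2 h3
    rw [← mul_add, ← mul_add, ← mul_add, Real.norm_of_nonneg (by positivity)] at h2
    set T := ‖u‖ ^ 2 + ‖p‖ ^ 2 + (‖(M x).fst u p‖ ^ 2 + ‖(M x).snd u p‖ ^ 2)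
    have hT : T ≤ r ^ 2 * max C 1 := by
      have := h2.trans (le_max_left C 1)
      rwa [inv_pow, inv_mul_le_iff₀ (by positivity)] at this
    have h3' : r ^ 2 * q ≤ Q x u p := by
      rwa [inv_pow, le_inv_mul_iff₀ (by positivity)] at h3
    calc q / max C 1 * T ≤ q / max C 1 * (r ^ 2 * max C 1) := by gcongr
      _ = r ^ 2 * q := by field_simp
      _ ≤ _ := h3'
  refine ⟨q / max C 1, by positivity, fun x hx s hs u p => ?_⟩
  rw [h.flux_sub, ← mul_assoc, hs, mul_right_comm, mul_right_comm _ |x.im|, mul_comm |x.im|]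
  have h4 := key x hx u p
  have h5 : 0 < q / max C 1 := by positivity
  rw [mul_add] at h4
  constructor
  · gcongr
    refine le_trans ?_ h4
    have : 0 ≤ q / max C 1 * (‖(M x).fst u p‖ ^ 2 + ‖(M x).snd u p‖ ^ 2) := by positivity
    linarith
  · gcongr
    refine le_trans ?_ h4
    have : 0 ≤ q / max C 1 * (‖u‖ ^ 2 + ‖p‖ ^ 2) := by positivity
    linarith

/-- Approach x vertically: if f'(x) = 0 then |f(x+it)|/t → 0, whereas the hypothesis bounds
|f(x+it)| |g(x+it)|/t below by a positive limit. -/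
lemma deriv_ne_zero_of_le {f g : ℂ → ℂ} {q : ℂ → ℝ} {x : ℝ} (hf : DifferentiableAt ℂ f x)
    (hfx : f x = 0) (hg : ContinuousAt g x) (hq : ContinuousAt q x) (hqx : 0 < q x)
    (h : ∀ y : ℂ, |y.im| * q y ≤ ‖f y‖ * ‖g y‖) : deriv f x ≠ 0 := by
  intro hd
  have h1 := hf.hasDerivAt
  rw [hd, hasDerivAt_iff_tendsto_slope] at h1
  have hline : Tendsto (fun t : ℝ => (x : ℂ) + t * Complex.I) (𝓝[>] 0) (𝓝[≠] (x : ℂ)) := by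
    refine tendsto_nhdsWithin_iff.2 ⟨?_, ?_⟩
    · have : Continuous fun t : ℝ => (x : ℂ) + t * Complex.I := by fun_prop
      simpa using (this.tendsto 0).mono_left nhdsWithin_le_nhds
    · filter_upwards [self_mem_nhdsWithin] with t ht
      simp [(Set.mem_Ioi.1 ht).ne']
  have h2 := (h1.comp hline).norm
  have h3 := (hg.tendsto.comp (hline.mono_right nhdsWithin_le_nhds)).norm
  have h4 := hq.tendsto.comp (hline.mono_right nhdsWithin_le_nhds)
  have h5 := h2.mul h3
  rw [norm_zero, zero_mul] at h5
  refine absurd (le_of_tendsto_of_tendsto h4 h5 ?_) (not_le.2 hqx)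
  filter_upwards [self_mem_nhdsWithin] with t ht
  have ht' : 0 < t := ht
  have := h (x + t * Complex.I)
  simp only [Function.comp, slope_def_field, hfx, sub_zero, add_sub_cancel_left, norm_div, norm_mul,
    Complex.norm_real, Complex.norm_I, mul_one, Real.norm_of_nonneg ht'.le]
  simp only [Complex.add_im, Complex.ofReal_im, Complex.mul_im, Complex.ofReal_re, Complex.I_im,
    mul_one, Complex.I_re, mul_zero, add_zero, zero_add, abs_of_pos ht'] at this
  rw [div_mul_eq_mul_div, le_div_iff₀ ht']
  linarith

/-- With data (0,1) the flux vanishes at both ends when b = 0, and its increment is Im x times a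
positive number. -/
lemma im_eq_zero_of_b_eq_zero (h : IsTransferFamily M Q) {x : ℂ} (hx : (M x).b = 0) : x.im = 0 := by
  have := h.flux_sub x 0 1
  simp only [fst, snd, hx, mul_zero, mul_one, zero_add, flux, map_zero, zero_mul, Complex.zero_im,
    sub_self] at this
  have hp := h.pos x 0 1 (Or.inr one_ne_zero)
  exact (mul_eq_zero.1 this.symm).resolve_right hp.ne'

lemma im_eq_zero_of_c_eq_zero (h : IsTransferFamily M Q) {x : ℂ} (hx : (M x).c = 0) : x.im = 0 := by
  have := h.flux_sub x 1 0
  simp only [fst, snd, hx, mul_zero, zero_mul, zero_add, flux, Complex.zero_im,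
    sub_self] at this
  have hp := h.pos x 1 0 (Or.inl one_ne_zero)
  exact (mul_eq_zero.1 this.symm).resolve_right hp.ne'

lemma continuous_slice (h : IsTransferFamily M Q) (u p : ℂ) : Continuous fun x => Q x u p :=
  h.cont.comp (by fun_prop : Continuous fun x : ℂ => (x, u, p))

lemma deriv_b_ne_zero (h : IsTransferFamily M Q) {x : ℝ} (hx : (M x).b = 0) :
    deriv (fun y => (M y).b) x ≠ 0 := by
  refine deriv_ne_zero_of_le (g := fun y => (M y).d) h.diff_b.differentiableAt hx
    h.diff_d.continuous.continuousAt (h.continuous_slice 0 1).continuousAt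
    (h.pos x 0 1 (Or.inr one_ne_zero)) fun y => ?_
  have h1 := h.flux_sub y 0 1
  have h2 := abs_flux_le ((M y).b) ((M y).d)
  have h3 : flux (0 : ℂ) 1 = 0 := by simp [flux]
  simp only [fst, snd, mul_zero, mul_one, zero_add, h3, sub_zero] at h1
  rwa [h1, abs_mul, abs_of_pos (h.pos y 0 1 (Or.inr one_ne_zero))] at h2

lemma deriv_c_ne_zero (h : IsTransferFamily M Q) {x : ℝ} (hx : (M x).c = 0) :
    deriv (fun y => (M y).c) x ≠ 0 := by
  refine deriv_ne_zero_of_le (g := fun y => (M y).a) h.diff_c.differentiableAt hx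
    h.diff_a.continuous.continuousAt (h.continuous_slice 1 0).continuousAt
    (h.pos x 1 0 (Or.inl one_ne_zero)) fun y => ?_
  have h1 := h.flux_sub y 1 0
  have h2 := abs_flux_le ((M y).a) ((M y).c)
  have h3 : flux (1 : ℂ) 0 = 0 := by simp [flux]
  simp only [fst, snd, mul_zero, mul_one, add_zero, h3, sub_zero] at h1
  rw [h1, abs_mul, abs_of_pos (h.pos y 1 0 (Or.inl one_ne_zero))] at h2
  linarith

end IsTransferFamily

/-! ### The logarithmic asymptotics -/

/-- Entire functions with real simple zeros, such that `2⁻ⁿ log |fₙ|` converges to `G` off the real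
line, with a locally integrable bound. -/
structure HasLogLimit (f : ℕ → ℂ → ℂ) (G : ℂ → ℝ) : Prop where
  diff : ∀ n, Differentiable ℂ (f n)
  im_eq_zero : ∀ n x, f n x = 0 → x.im = 0
  deriv_ne_zero : ∀ n (x : ℝ), f n x = 0 → deriv (f n) x ≠ 0
  tendsto : ∀ x : ℂ, x.im ≠ 0 → Tendsto (fun n => ((2 : ℝ) ^ n)⁻¹ * Real.log ‖f n x‖) atTop (𝓝 (G x))
  bound : ∀ R : ℝ, ∃ C : ℝ, ∀ n (x : ℂ), ‖x‖ ≤ R → x.im ≠ 0 →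
    |((2 : ℝ) ^ n)⁻¹ * Real.log ‖f n x‖| ≤ C + |Real.log (|x.im|)|

lemma greenSeq_toVec {α : ℝ} (h0 : 0 < α) (h1 : α < 1) {M : Transfer} (h : M.det = 1) (n : ℕ) :
    greenSeq α n M.toVec = ((2 : ℝ) ^ n)⁻¹ * Real.log ‖((double α)^[n] M).toVec‖ +
      (1 - ((2 : ℝ) ^ n)⁻¹) * Real.log (ratio α) := by
  have hd := ratio_pos h0 h1
  have h2 := one_le_norm_toVec ((double α)^[n] M)
  rw [greenSeq, Rhat_iterate_toVec h0 h1 h, norm_smul, norm_pow, Complex.norm_real,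
    Real.norm_of_nonneg hd.le, Real.log_mul (by positivity) (by positivity), Real.log_pow,
    Nat.cast_sub Nat.one_le_two_pow]
  push_cast
  field_simp
  ring

lemma abs_log_sub_le {κ x y : ℝ} (hκ : 0 < κ) (hy : 1 ≤ y) (h1 : κ / 2 * y ≤ x) (h2 : x ≤ y / κ) :
    |Real.log x - Real.log y| ≤ Real.log 2 - Real.log κ := by
  have hx : 0 < x := lt_of_lt_of_le (by positivity) h1
  have e1 := Real.log_le_log (by positivity) h1
  have e2 := Real.log_le_log hx h2
  rw [Real.log_mul (by positivity) (by positivity), Real.log_div hκ.ne' (by norm_num)] at e1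
  rw [Real.log_div (by positivity) hκ.ne'] at e2
  have e3 := Real.log_nonneg (one_le_two : (1 : ℝ) ≤ 2)
  rw [abs_le]
  constructor <;> linarith

/-- At level n the expansion constant is θⁿ c |Im x|, so log|fₙ| and log ‖toVec‖ differ by O(n) +
|log|Im x||. Division by 2ⁿ leaves the Green function. -/
lemma hasLogLimit_aux {M : ℂ → Transfer} {Q : ℂ → ℂ → ℂ → ℝ} (h : IsTransferFamily M Q) {α : ℝ}
    (h0 : 0 < α) (h1 : α < 1) {f : ℕ → ℂ → ℂ} (hdiff : ∀ n, Differentiable ℂ (f n))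
    (him : ∀ n x, f n x = 0 → x.im = 0) (hder : ∀ n (x : ℝ), f n x = 0 → deriv (f n) x ≠ 0)
    (hf : ∀ n x s κ, |s| = 1 → 0 < κ → ((Transfer.double α)^[n] (M x)).Expansive s κ →
      κ / 2 * ‖((Transfer.double α)^[n] (M x)).toVec‖ ≤ ‖f n x‖ ∧
      ‖f n x‖ ≤ ‖((Transfer.double α)^[n] (M x)).toVec‖ / κ) :
    HasLogLimit f fun x => (Ghat α (M x).toVec).toReal - Real.log (ratio α) := by
  have hθ : 0 < min α (1 - α) := lt_min h0 (by linarith)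
  have hz : ∀ x, (M x).toVec 2 ≠ 0 := fun x => by simp [toVec]
  set θ := min α (1 - α)
  have key : ∀ R : ℝ, ∃ C : ℝ, 0 ≤ C ∧ ∀ n (x : ℂ), ‖x‖ ≤ R → x.im ≠ 0 →
      |((2 : ℝ) ^ n)⁻¹ * Real.log ‖f n x‖ - (greenSeq α n (M x).toVec - Real.log (ratio α))| ≤
        ((2 : ℝ) ^ n)⁻¹ * (C + n * |Real.log θ| + |Real.log (|x.im|)|) := by
    intro R
    obtain ⟨c, hc, hexp⟩ := h.exists_expansive R
    refine ⟨Real.log 2 + |Real.log c| + |Real.log (ratio α)|, ?_, ?_⟩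
    · have e3 := Real.log_nonneg (one_le_two : (1 : ℝ) ≤ 2)
      positivity
    intro n x hx hxi
    have hxi' : 0 < |x.im| := abs_pos.2 hxi
    -- s is the sign of Im x: in the lower half plane the flux decreases.
    obtain ⟨s, hs, hs'⟩ : ∃ s : ℝ, |s| = 1 ∧ s * x.im = |x.im| := by
      rcases lt_or_gt_of_ne hxi with hl | hl
      · exact ⟨-1, by simp, by rw [abs_of_neg hl]; ring⟩
      · exact ⟨1, by simp, by rw [abs_of_pos hl]; ring⟩
    have h2 := (hexp x hx s hs').double_iterate (by positivity) h0 h1 n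
    obtain ⟨h3, h4⟩ := hf n x s _ hs (by positivity) h2
    have h5 := abs_log_sub_le (by positivity) (one_le_norm_toVec _) h3 h4
    rw [Real.log_mul (by positivity) (by positivity), Real.log_mul (by positivity) (by positivity),
      Real.log_pow] at h5
    rw [greenSeq_toVec h0 h1 (h.det_eq x)]
    have e : ∀ a b t l : ℝ, t * a - (t * b + (1 - t) * l - l) = t * ((a - b) + l) := by
      intros; ring
    have ht : (0 : ℝ) < ((2 : ℝ) ^ n)⁻¹ := by positivity
    rw [e, abs_mul, abs_of_pos ht]
    refine mul_le_mul_of_nonneg_left ?_ ht.le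
    refine (abs_add_le _ _).trans ?_
    have e1 := neg_abs_le (Real.log c)
    have e2 := neg_abs_le (Real.log (|x.im|))
    have e3 : -(n * Real.log θ) ≤ n * |Real.log θ| := by
      rw [← mul_neg]
      exact mul_le_mul_of_nonneg_left (neg_le_abs _) (Nat.cast_nonneg n)
    linarith
  -- This turns the O(n) error into a bound that is uniform in n.
  have hn2 : ∀ n : ℕ, (n : ℝ) ≤ 2 ^ n := fun n => by exact_mod_cast (Nat.lt_two_pow_self).le
  refine ⟨hdiff, him, hder, fun x hx => ?_, fun R => ?_⟩
  · obtain ⟨C, hC0, hC⟩ := key ‖x‖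
    have hlim := (tendsto_greenSeq h0 h1 (hz x)).2.2.sub_const (Real.log (ratio α))
    have hz : Tendsto (fun n : ℕ => ((2 : ℝ) ^ n)⁻¹ * (C + n * |Real.log θ| + |Real.log (|x.im|)|))
        atTop (𝓝 0) := by
      have e1 := tendsto_inv_two_pow.mul_const (C + |Real.log (|x.im|)|)
      have e2 : Tendsto (fun n : ℕ => (n : ℝ) * (2⁻¹ : ℝ) ^ n) atTop (𝓝 0) :=
        tendsto_self_mul_const_pow_of_lt_one (by norm_num) (by norm_num)
      have e3 := e1.add (e2.mul_const |Real.log θ|)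
      rw [zero_mul, zero_mul, add_zero] at e3
      refine e3.congr fun n => ?_
      rw [inv_pow]; ring
    have h2 := squeeze_zero_norm (fun n => (Real.norm_eq_abs _).trans_le (hC n x le_rfl hx)) hz
    have h3 := h2.add hlim
    simpa using h3
  · obtain ⟨C, hC0, hC⟩ := key R
    obtain ⟨K, hK0, hK⟩ := exists_greenSeq_le α
    have hcont : Continuous fun x => Real.log ‖(M x).toVec‖ := by
      refine Continuous.log (Continuous.norm (continuous_pi fun i => ?_)) fun x => ?_
      · have := h.diff_a.continuous
        have := h.diff_d.continuous
        fin_cases i <;> simp [toVec] <;> fun_prop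
      · exact (lt_of_lt_of_le one_pos (one_le_norm_toVec _)).ne'
    obtain ⟨D, hD⟩ := (isCompact_closedBall (0 : ℂ) R).exists_bound_of_continuousOn
      hcont.continuousOn
    refine ⟨C + |Real.log θ| + (|Real.log (ratio α)| + (D + K)) + |Real.log (ratio α)|,
      fun n x hx hxi => ?_⟩
    have e1 := hC n x hx hxi
    have e2 : |greenSeq α n (M x).toVec| ≤ |Real.log (ratio α)| + (D + K) := by
      have hDx := hD x (by simpa using hx)
      have hDx' := (le_abs_self _).trans hDx
      have hD0 := (norm_nonneg _).trans hDx
      have u1 := hK (M x).toVec n (Rhat_iterate_ne_zero h0 h1 (hz x) n)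
      have u2 := le_greenSeq h0 h1 (hz x) n
      have u3 : Real.log ‖(M x).toVec 2‖ = 0 := by simp [toVec]
      rw [u3] at u2
      have := abs_nonneg (Real.log (ratio α))
      rw [abs_le]
      constructor <;> linarith
    have e3 : ((2 : ℝ) ^ n)⁻¹ * (C + n * |Real.log θ| + |Real.log (|x.im|)|) ≤
        C + |Real.log θ| + |Real.log (|x.im|)| := by
      have hp : (1 : ℝ) ≤ 2 ^ n := one_le_pow₀ (by norm_num)
      rw [inv_mul_le_iff₀ (by positivity)]
      have w1 := mul_le_mul_of_nonneg_right (hn2 n) (abs_nonneg (Real.log θ))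
      have w2 := mul_le_mul_of_nonneg_right hp hC0
      have w3 := mul_le_mul_of_nonneg_right hp (abs_nonneg (Real.log (|x.im|)))
      linarith
    have e4 := abs_sub_abs_le_abs_sub (((2 : ℝ) ^ n)⁻¹ * Real.log ‖f n x‖)
      (greenSeq α n (M x).toVec - Real.log (ratio α))
    have e5 := abs_sub (greenSeq α n (M x).toVec) (Real.log (ratio α))
    linarith

namespace IsTransferFamily

variable {M : ℂ → Transfer} {Q : ℂ → ℂ → ℂ → ℝ}

lemma hasLogLimit_b (h : IsTransferFamily M Q) {α : ℝ} (h0 : 0 < α) (h1 : α < 1) :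
    HasLogLimit (fun n x => ((Transfer.double α)^[n] (M x)).b)
      fun x => (Ghat α (M x).toVec).toReal - Real.log (ratio α) := by
  refine hasLogLimit_aux h h0 h1 (fun n => ?_) (fun n x hx => ?_) (fun n x hx => ?_)
    fun n x s κ hs hκ hexp =>
      (hexp.bounds hs hκ (det_double_iterate h0 h1 (h.det_eq x) n)).1
  all_goals obtain ⟨Q', h'⟩ := h.double_iterate h0 h1 n
  · exact h'.diff_b
  · exact h'.im_eq_zero_of_b_eq_zero hx
  · exact h'.deriv_b_ne_zero hx

lemma hasLogLimit_c (h : IsTransferFamily M Q) {α : ℝ} (h0 : 0 < α) (h1 : α < 1) :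
    HasLogLimit (fun n x => ((Transfer.double α)^[n] (M x)).c)
      fun x => (Ghat α (M x).toVec).toReal - Real.log (ratio α) := by
  refine hasLogLimit_aux h h0 h1 (fun n => ?_) (fun n x hx => ?_) (fun n x hx => ?_)
    fun n x s κ hs hκ hexp =>
      (hexp.bounds hs hκ (det_double_iterate h0 h1 (h.det_eq x) n)).2
  all_goals obtain ⟨Q', h'⟩ := h.double_iterate h0 h1 n
  · exact h'.diff_c
  · exact h'.im_eq_zero_of_c_eq_zero hx
  · exact h'.deriv_c_ne_zero hx

end IsTransferFamily

/-! ### Integration by parts against test functions -/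

lemma integrable_of_continuousOn_support {F : ℂ → ℝ} {K : Set ℂ} (hK : IsCompact K)
    (hF : ContinuousOn F K) (hs : Function.support F ⊆ K) : Integrable F := by
  rw [← integrableOn_iff_integrable_of_support_subset hs]
  exact hF.integrableOn_compact hK

/-- Two integrations by parts. Regularity of h is asked only on the support of ψ, so that h may be
log|g| with g vanishing elsewhere. -/
lemma integral_mul_second_deriv {ψ ψ' ψ'' h h' h'' : ℂ → ℝ} {v : ℂ} (hcs : HasCompactSupport ψ)
    (c0 : Continuous ψ) (c1 : Continuous ψ') (c2 : Continuous ψ'')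
    (d1 : ∀ z, HasLineDerivAt ℝ ψ (ψ' z) z v) (d2 : ∀ z, HasLineDerivAt ℝ ψ' (ψ'' z) z v)
    (s1 : tsupport ψ' ⊆ tsupport ψ) (s2 : tsupport ψ'' ⊆ tsupport ψ)
    (k0 : ContinuousOn h (tsupport ψ)) (k1 : ContinuousOn h' (tsupport ψ))
    (k2 : ContinuousOn h'' (tsupport ψ))
    (e1 : ∀ z ∈ tsupport ψ, HasLineDerivAt ℝ h (h' z) z v)
    (e2 : ∀ z ∈ tsupport ψ, HasLineDerivAt ℝ h' (h'' z) z v) :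
    ∫ z, h z * ψ'' z = ∫ z, h'' z * ψ z := by
  have hint : ∀ {a b : ℂ → ℝ}, ContinuousOn a (tsupport ψ) → Continuous b →
      tsupport b ⊆ tsupport ψ → Integrable fun z => a z * b z := by
    intro a b ha hb hab
    refine integrable_of_continuousOn_support hcs (ha.mul hb.continuousOn) ?_
    exact (Function.support_mul_subset_right a b).trans ((subset_tsupport b).trans hab)
  have i1 := integral_bilinear_hasLineDerivAt_right_eq_neg_left_of_integrable
    (μ := volume) (f := h) (f' := h') (g := ψ') (g' := ψ'') (v := v)
    (B := ContinuousLinearMap.mul ℝ ℝ) (hint k1 c1 s1) (hint k0 c2 s2) (hint k0 c1 s1)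
    (fun z hz => e1 z (s1 hz)) (fun z _ => d2 z)
  have i2 := integral_bilinear_hasLineDerivAt_right_eq_neg_left_of_integrable
    (μ := volume) (f := h') (f' := h'') (g := ψ) (g' := ψ') (v := v)
    (B := ContinuousLinearMap.mul ℝ ℝ) (hint k2 c0 subset_rfl) (hint k1 c1 s1)
    (hint k1 c0 subset_rfl) e2 (fun z _ => d1 z)
  simp only [ContinuousLinearMap.mul_apply'] at i1 i2
  rw [i1, i2, neg_neg]

/-- The second derivative in the direction `v`. -/
def secondDeriv (f : ℂ → ℝ) (v z : ℂ) : ℝ := iteratedFDeriv ℝ 2 f z ![v, v]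

lemma laplacian_eq (f : ℂ → ℝ) (z : ℂ) :
    Laplacian.laplacian f z = secondDeriv f 1 z + secondDeriv f Complex.I z := by
  rw [InnerProductSpace.laplacian_eq_iteratedFDeriv_complexPlane]; rfl

lemma secondDeriv_eq (f : ℂ → ℝ) (v z : ℂ) :
    secondDeriv f v z = fderiv ℝ (fderiv ℝ f) z v v := by
  rw [secondDeriv, iteratedFDeriv_two_apply]; rfl

lemma hasLineDerivAt_fderiv {f : ℂ → ℝ} {z : ℂ} (hf : ContDiffAt ℝ 2 f z) (v : ℂ) :
    HasLineDerivAt ℝ f (fderiv ℝ f z v) z v ∧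
    HasLineDerivAt ℝ (fun y => fderiv ℝ f y v) (secondDeriv f v z) z v := by
  refine ⟨(hf.differentiableAt (by norm_num)).hasFDerivAt.hasLineDerivAt v, ?_⟩
  have h1 : DifferentiableAt ℝ (fderiv ℝ f) z :=
    (hf.fderiv_right (m := 1) (by norm_num)).differentiableAt (by norm_num)
  rw [secondDeriv_eq]
  have h2 := (h1.hasFDerivAt.clm_apply (hasFDerivAt_const v z)).hasLineDerivAt v
  simpa using h2

lemma continuousAt_secondDeriv {f : ℂ → ℝ} {z : ℂ} (hf : ContDiffAt ℝ 2 f z) (v : ℂ) :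
    ContinuousAt (fun y => fderiv ℝ f y v) z ∧ ContinuousAt (secondDeriv f v) z := by
  have h1 : ContDiffAt ℝ 1 (fderiv ℝ f) z := hf.fderiv_right (by norm_num)
  have h2 : ContDiffAt ℝ 0 (fderiv ℝ (fderiv ℝ f)) z := h1.fderiv_right (by norm_num)
  refine ⟨h1.continuousAt.clm_apply continuousAt_const, ?_⟩
  have : secondDeriv f v = fun y => fderiv ℝ (fderiv ℝ f) y v v := funext (secondDeriv_eq f v)
  rw [this]
  exact (h2.continuousAt.clm_apply continuousAt_const).clm_apply continuousAt_const

/-- A smooth function with compact support. -/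
structure IsTest (ψ : ℂ → ℝ) : Prop where
  smooth : ContDiff ℝ (⊤ : ℕ∞) ψ
  compact : HasCompactSupport ψ

namespace IsTest

variable {ψ : ℂ → ℝ}

lemma contDiffAt (h : IsTest ψ) (z : ℂ) : ContDiffAt ℝ 2 ψ z :=
  ((contDiff_infty.1 h.smooth 2).contDiffAt : ContDiffAt ℝ ((2 : ℕ) : WithTop ℕ∞) ψ z)

lemma continuous_fderiv_apply (h : IsTest ψ) (v : ℂ) : Continuous fun z => fderiv ℝ ψ z v :=
  continuous_iff_continuousAt.2 fun z => (continuousAt_secondDeriv (h.contDiffAt z) v).1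

lemma continuous_secondDeriv (h : IsTest ψ) (v : ℂ) : Continuous (secondDeriv ψ v) :=
  continuous_iff_continuousAt.2 fun z => (continuousAt_secondDeriv (h.contDiffAt z) v).2

lemma tsupport_fderiv_apply (v : ℂ) : tsupport (fun z => fderiv ℝ ψ z v) ⊆ tsupport ψ :=
  tsupport_fderiv_apply_subset ℝ v

lemma tsupport_secondDeriv (v : ℂ) : tsupport (secondDeriv ψ v) ⊆ tsupport ψ := by
  refine closure_minimal (fun z hz => ?_) (isClosed_tsupport ψ)
  by_contra hz'
  refine hz ?_
  rw [secondDeriv_eq]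
  have : fderiv ℝ (fderiv ℝ ψ) z = 0 := by
    by_contra hne
    exact hz' (support_fderiv_subset ℝ (f := ψ) |> fun _ =>
      tsupport_fderiv_subset ℝ (f := ψ) (support_fderiv_subset ℝ (f := fderiv ℝ ψ) hne))
  rw [this]; rfl

lemma continuous_laplacian (h : IsTest ψ) : Continuous (Laplacian.laplacian ψ) := by
  have : Laplacian.laplacian ψ = fun z => secondDeriv ψ 1 z + secondDeriv ψ Complex.I z :=
    funext (laplacian_eq ψ)
  rw [this]
  exact (h.continuous_secondDeriv 1).add (h.continuous_secondDeriv _)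

lemma support_laplacian : Function.support (Laplacian.laplacian ψ) ⊆ tsupport ψ := by
  intro z hz
  by_contra hz'
  refine hz ?_
  rw [laplacian_eq]
  have h1 : ∀ v, secondDeriv ψ v z = 0 := fun v => by
    by_contra h
    exact hz' (tsupport_secondDeriv v (subset_tsupport _ h))
  rw [h1, h1, add_zero]

lemma hasCompactSupport_laplacian (h : IsTest ψ) : HasCompactSupport (Laplacian.laplacian ψ) :=
  HasCompactSupport.of_support_subset_isCompact h.compact IsTest.support_laplacian

/-- Green's identity: `∫ h Δψ = ∫ (∂₁∂₁h + ∂₂∂₂h) ψ`. -/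
lemma integral_mul_laplacian (hψ : IsTest ψ) {h : ℂ → ℝ} {h' h'' : ℂ → ℂ → ℝ}
    (k0 : ContinuousOn h (tsupport ψ)) (k1 : ∀ v, ContinuousOn (h' v) (tsupport ψ))
    (k2 : ∀ v, ContinuousOn (h'' v) (tsupport ψ))
    (e1 : ∀ v, ∀ z ∈ tsupport ψ, HasLineDerivAt ℝ h (h' v z) z v)
    (e2 : ∀ v, ∀ z ∈ tsupport ψ, HasLineDerivAt ℝ (h' v) (h'' v z) z v) :
    ∫ z, h z * Laplacian.laplacian ψ z = ∫ z, (h'' 1 z + h'' Complex.I z) * ψ z := by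
  have key : ∀ v, ∫ z, h z * secondDeriv ψ v z = ∫ z, h'' v z * ψ z := fun v =>
    integral_mul_second_deriv hψ.compact hψ.smooth.continuous (hψ.continuous_fderiv_apply v)
      (hψ.continuous_secondDeriv v) (fun z => (hasLineDerivAt_fderiv (hψ.contDiffAt z) v).1)
      (fun z => (hasLineDerivAt_fderiv (hψ.contDiffAt z) v).2) (tsupport_fderiv_apply v)
      (tsupport_secondDeriv v) k0 (k1 v) (k2 v) (e1 v) (e2 v)
  have int1 : ∀ v, Integrable fun z => h z * secondDeriv ψ v z := fun v =>
    integrable_of_continuousOn_support hψ.compact (k0.mul (hψ.continuous_secondDeriv v).continuousOn)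
      ((Function.support_mul_subset_right _ _).trans ((subset_tsupport _).trans
        (tsupport_secondDeriv v)))
  have int2 : ∀ v, Integrable fun z => h'' v z * ψ z := fun v =>
    integrable_of_continuousOn_support hψ.compact ((k2 v).mul hψ.smooth.continuous.continuousOn)
      ((Function.support_mul_subset_right _ _).trans (subset_tsupport _))
  simp only [laplacian_eq, mul_add, add_mul]
  rw [integral_add (int1 _) (int1 _), integral_add (int2 _) (int2 _), key, key]

lemma integral_harmonic_mul_laplacian (hψ : IsTest ψ) {h : ℂ → ℝ}
    (hh : ∀ z ∈ tsupport ψ, InnerProductSpace.HarmonicAt h z) :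
    ∫ z, h z * Laplacian.laplacian ψ z = 0 := by
  rw [hψ.integral_mul_laplacian (h' := fun v z => fderiv ℝ h z v) (h'' := fun v z => secondDeriv h v z)
    (fun z hz => (hh z hz).1.continuousAt.continuousWithinAt)
    (fun v z hz => (continuousAt_secondDeriv (hh z hz).1 v).1.continuousWithinAt)
    (fun v z hz => (continuousAt_secondDeriv (hh z hz).1 v).2.continuousWithinAt)
    (fun v z hz => (hasLineDerivAt_fderiv (hh z hz).1 v).1)
    (fun v z hz => (hasLineDerivAt_fderiv (hh z hz).1 v).2)]
  refine integral_eq_zero_of_ae (Eventually.of_forall fun z => ?_)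
  by_cases hz : z ∈ tsupport ψ
  · have := (hh z hz).2.self_of_nhds
    rw [laplacian_eq] at this
    simp only [this, Pi.zero_apply, zero_mul]
  · simp [image_eq_zero_of_notMem_tsupport hz]

end IsTest

/-! ### The fundamental solution -/

lemma ae_im_ne_zero : ∀ᵐ z : ℂ, z.im ≠ 0 := by
  have h := Measure.addHaar_submodule (volume : Measure ℂ) (LinearMap.ker Complex.imLm) ?_
  · rw [ae_iff]
    convert h using 2
    ext z; simp
  · intro h
    have : Complex.I ∈ LinearMap.ker Complex.imLm := by rw [h]; trivial
    simp at this

/-- Integrability of the common majorant: in the coordinates (re, im) it is log|y|, integrable on an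
interval. -/
lemma integrableOn_log_im (R : ℝ) :
    IntegrableOn (fun z : ℂ => |Real.log (|z.im|)|) (Metric.closedBall 0 R) := by
  have h1 : IntegrableOn (fun y : ℝ => |Real.log y|) (Set.Icc (-|R|) |R|) := by
    have := (intervalIntegral.intervalIntegrable_log' (a := -|R|) (b := |R|)).norm
    rw [intervalIntegrable_iff_integrableOn_Icc_of_le (by linarith [abs_nonneg R])] at this
    simpa using this
  have h2 : IntegrableOn (fun p : ℝ × ℝ => |Real.log p.2|)
      (Set.Icc (-|R|) |R| ×ˢ Set.Icc (-|R|) |R|) := by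
    have h3 : IntegrableOn (fun _ : ℝ => (1 : ℝ)) (Set.Icc (-|R|) |R|) :=
      integrableOn_const (by simp)
    rw [IntegrableOn, Measure.volume_eq_prod, ← Measure.prod_restrict]
    simpa using Integrable.mul_prod h3 h1
  have h4 := (Complex.volume_preserving_equiv_real_prod.integrableOn_comp_preimage
    Complex.measurableEquivRealProd.measurableEmbedding).2 h2
  refine IntegrableOn.mono_set (h4.congr_fun (fun z _ => ?_) ?_) ?_
  · simp [Complex.measurableEquivRealProd_apply, Real.log_abs]
  · exact Complex.measurableEquivRealProd.measurable (measurableSet_Icc.prod measurableSet_Icc)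
  · intro z hz
    have hz' : ‖z‖ ≤ R := by simpa using hz
    have h5 := (Complex.abs_re_le_norm z).trans (hz'.trans (le_abs_self R))
    have h6 := (Complex.abs_im_le_norm z).trans (hz'.trans (le_abs_self R))
    simp only [Set.mem_preimage, Complex.measurableEquivRealProd_apply, Set.mem_prod, Set.mem_Icc]
    exact ⟨abs_le.1 h5, abs_le.1 h6⟩

lemma integrableOn_log_im_bound (C R : ℝ) :
    IntegrableOn (fun z : ℂ => C + |Real.log (|z.im|)|) (Metric.closedBall 0 R) :=
  (integrableOn_const (by exact (isCompact_closedBall _ _).measure_lt_top.ne)).add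
    (integrableOn_log_im R)

lemma IsTest.exists_bound {ψ : ℂ → ℝ} (hψ : IsTest ψ) : ∃ R D : ℝ, 0 ≤ D ∧
    (∀ z, z ∉ Metric.closedBall (0 : ℂ) R → Laplacian.laplacian ψ z = 0 ∧ ψ z = 0) ∧
    (∀ z, |Laplacian.laplacian ψ z| ≤ D) ∧ tsupport ψ ⊆ Metric.closedBall 0 R := by
  obtain ⟨R, hR⟩ := hψ.compact.isBounded.subset_closedBall 0
  obtain ⟨D, hD⟩ := hψ.hasCompactSupport_laplacian.exists_bound_of_continuous
    hψ.continuous_laplacian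
  refine ⟨R, D, (norm_nonneg _).trans (hD 0), fun z hz => ⟨?_, ?_⟩, hD, hR⟩
  · by_contra h
    exact hz (hR (IsTest.support_laplacian h))
  · by_contra h
    exact hz (hR (subset_tsupport _ h))

/-- Dominated convergence against the Laplacian of a test function. -/
lemma IsTest.tendsto_integral {ψ : ℂ → ℝ} (hψ : IsTest ψ) {f : ℕ → ℂ → ℝ} {g : ℂ → ℝ}
    (hmeas : ∀ n, AEStronglyMeasurable (f n) volume)
    (hb : ∀ R : ℝ, ∃ C : ℝ, ∀ n (x : ℂ), ‖x‖ ≤ R → x.im ≠ 0 → |f n x| ≤ C + |Real.log (|x.im|)|)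
    (hlim : ∀ x : ℂ, x.im ≠ 0 → Tendsto (fun n => f n x) atTop (𝓝 (g x))) :
    Tendsto (fun n => ∫ z, f n z * Laplacian.laplacian ψ z) atTop
      (𝓝 (∫ z, g z * Laplacian.laplacian ψ z)) := by
  obtain ⟨R, D, hD0, h0, hD, -⟩ := hψ.exists_bound
  obtain ⟨C, hC⟩ := hb R
  refine tendsto_integral_of_dominated_convergence
    ((Metric.closedBall 0 R).indicator fun z => (C + |Real.log (|z.im|)|) * D) (fun n => ?_) ?_
    (fun n => ?_) ?_
  · exact (hmeas n).mul hψ.continuous_laplacian.aestronglyMeasurable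
  · rw [integrable_indicator_iff Metric.isClosed_closedBall.measurableSet]
    exact (integrableOn_log_im_bound C R).mul_const D
  · filter_upwards [ae_im_ne_zero] with z hz
    by_cases hzR : z ∈ Metric.closedBall 0 R
    · rw [Set.indicator_of_mem hzR, norm_mul, Real.norm_eq_abs, Real.norm_eq_abs]
      have := hC n z (by simpa using hzR) hz
      exact mul_le_mul this (hD z) (abs_nonneg _) ((abs_nonneg _).trans this)
    · rw [Set.indicator_of_notMem hzR, (h0 z hzR).1, mul_zero, norm_zero]
  · filter_upwards [ae_im_ne_zero] with z hz
    exact (hlim z hz).mul_const _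

lemma IsTest.integrable_mul {ψ : ℂ → ℝ} (hψ : IsTest ψ) {f : ℂ → ℝ}
    (hmeas : AEStronglyMeasurable f volume)
    (hb : ∀ R : ℝ, ∃ C : ℝ, ∀ (x : ℂ), ‖x‖ ≤ R → x.im ≠ 0 → |f x| ≤ C + |Real.log (|x.im|)|) :
    Integrable fun z => f z * Laplacian.laplacian ψ z := by
  obtain ⟨R, D, hD0, h0, hD, -⟩ := hψ.exists_bound
  obtain ⟨C, hC⟩ := hb R
  refine Integrable.mono' (g := (Metric.closedBall 0 R).indicator
    fun z => (C + |Real.log (|z.im|)|) * D) ?_ ?_ ?_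
  · rw [integrable_indicator_iff Metric.isClosed_closedBall.measurableSet]
    exact (integrableOn_log_im_bound C R).mul_const D
  · exact hmeas.mul hψ.continuous_laplacian.aestronglyMeasurable
  · filter_upwards [ae_im_ne_zero] with z hz
    by_cases hzR : z ∈ Metric.closedBall 0 R
    · rw [Set.indicator_of_mem hzR, norm_mul, Real.norm_eq_abs, Real.norm_eq_abs]
      have := hC z (by simpa using hzR) hz
      exact mul_le_mul this (hD z) (abs_nonneg _) ((abs_nonneg _).trans this)
    · rw [Set.indicator_of_notMem hzR, (h0 z hzR).1, mul_zero, norm_zero]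

/-- The integrand is the Laplacian of ½ log(|w|² + 1). In polar coordinates 2r/(r² + 1)² has the
primitive -(r² + 1)⁻¹, and its mass 2π is the constant of the fundamental solution. -/
lemma integral_mass : ∫ w : ℂ, 2 / (‖w‖ ^ 2 + 1) ^ 2 = 2 * Real.pi := by
  have h := integral_fun_norm_addHaar (volume : Measure ℂ) fun r : ℝ => 2 / (r ^ 2 + 1) ^ 2
  rw [h]
  have h2 : ∫ y in Set.Ioi (0 : ℝ), y ^ (Module.finrank ℝ ℂ - 1) • (2 / (y ^ 2 + 1) ^ 2) = 1 := by
    have hd : ∀ x ∈ Set.Ici (0 : ℝ), HasDerivAt (fun y : ℝ => -(y ^ 2 + 1)⁻¹)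
        (x ^ (Module.finrank ℝ ℂ - 1) • (2 / (x ^ 2 + 1) ^ 2)) x := by
      intro x _
      have h3 : HasDerivAt (fun y : ℝ => y ^ 2 + 1) (2 * x) x := by
        simpa using (hasDerivAt_pow 2 x).add_const 1
      have h4 := (h3.inv (by positivity)).neg
      refine h4.congr_deriv ?_
      simp [Complex.finrank_real_complex]
      field_simp
    have hlim : Tendsto (fun y : ℝ => -(y ^ 2 + 1)⁻¹) atTop (𝓝 0) := by
      have : Tendsto (fun y : ℝ => y ^ 2 + 1) atTop atTop :=
        tendsto_atTop_add_const_right _ _ (tendsto_pow_atTop two_ne_zero)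
      simpa using this.inv_tendsto_atTop.neg
    rw [integral_Ioi_of_hasDerivAt_of_nonneg' hd (fun x hx => ?_) hlim]
    · norm_num
    · have : (0 : ℝ) < x := hx
      positivity
  rw [h2]
  simp [Complex.finrank_real_complex, Measure.real, mul_comm]

lemma integrable_mass : Integrable fun w : ℂ => 2 / (‖w‖ ^ 2 + 1) ^ 2 := by
  by_contra h
  have := integral_mass
  rw [integral_undef h] at this
  have := Real.pi_pos
  linarith

/-- The smooth potential ½ log(|z-x|² + ε²) has Laplacian 2ε²/(|z-x|² + ε²)². Integrate by parts and
substitute z = x + εw. -/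
lemma integral_regularized_laplacian {ψ : ℂ → ℝ} (hψ : IsTest ψ) (x : ℂ) {ε : ℝ} (hε : 0 < ε) :
    ∫ z, Real.log (‖z - x‖ ^ 2 + ε ^ 2) / 2 * Laplacian.laplacian ψ z =
      ∫ w : ℂ, 2 / (‖w‖ ^ 2 + 1) ^ 2 * ψ (x + ε • w) := by
  have hpos : ∀ z : ℂ, 0 < ‖z - x‖ ^ 2 + ε ^ 2 := fun z => by positivity
  have hn : ∀ z : ℂ, ‖z - x‖ ^ 2 = (z.re - x.re) ^ 2 + (z.im - x.im) ^ 2 := fun z => by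
    rw [← Complex.normSq_eq_norm_sq, Complex.normSq_apply]; simp; ring
  let r : ℂ → ℂ → ℝ := fun v z => (z.re - x.re) * v.re + (z.im - x.im) * v.im
  let n : ℂ → ℝ := fun z => (z.re - x.re) ^ 2 + (z.im - x.im) ^ 2 + ε ^ 2
  have hnpos : ∀ z, 0 < n z := fun z => by have := hpos z; rwa [hn] at this
  have hr' : ∀ v z, HasDerivAt (fun t : ℝ => r v (z + t • v)) (v.re ^ 2 + v.im ^ 2) 0 := by
    intro v z
    have h1 : HasDerivAt (fun t : ℝ => r v z + t * (v.re ^ 2 + v.im ^ 2))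
        (1 * (v.re ^ 2 + v.im ^ 2)) 0 := ((hasDerivAt_id 0).mul_const _).const_add _
    rw [one_mul] at h1
    refine h1.congr_of_eventuallyEq (Eventually.of_forall fun t => ?_)
    simp [r]; ring
  have hn' : ∀ v z, HasDerivAt (fun t : ℝ => n (z + t • v)) (2 * r v z) 0 := by
    intro v z
    have h1 : HasDerivAt (fun t : ℝ => n z + t * (2 * r v z) + t ^ 2 * (v.re ^ 2 + v.im ^ 2))
        (1 * (2 * r v z) + (2 : ℕ) * (0 : ℝ) ^ (2 - 1) * (v.re ^ 2 + v.im ^ 2)) 0 :=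
      (((hasDerivAt_id 0).mul_const _).const_add _).add ((hasDerivAt_pow 2 0).mul_const _)
    simp only [one_mul, Nat.cast_ofNat, Nat.add_one_sub_one, pow_one, mul_zero, zero_mul,
      add_zero] at h1
    refine h1.congr_of_eventuallyEq (Eventually.of_forall fun t => ?_)
    simp [r, n]; ring
  have hcn : Continuous n := by
    have := Complex.continuous_re
    have := Complex.continuous_im
    fun_prop
  have hcr : ∀ v, Continuous (r v) := fun v => by
    have := Complex.continuous_re
    have := Complex.continuous_im
    fun_prop
  have hL := hψ.integral_mul_laplacian (h := fun z => Real.log (n z) / 2)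
    (h' := fun v z => r v z / n z)
    (h'' := fun v z => ((v.re ^ 2 + v.im ^ 2) * n z - r v z * (2 * r v z)) / n z ^ 2)
    ((hcn.log fun z => (hnpos z).ne').div_const 2).continuousOn
    (fun v => ((hcr v).div hcn fun z => (hnpos z).ne').continuousOn)
    (fun v => (((continuous_const.mul hcn).sub ((hcr v).mul (continuous_const.mul (hcr v)))).div
      (hcn.pow 2) fun z => (pow_pos (hnpos z) 2).ne').continuousOn)
    (fun v z _ => by
      have := (hn' v z).log (by simpa using (hnpos z).ne')
      have := this.div_const 2
      simp only [zero_smul, add_zero] at this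
      rw [HasLineDerivAt]
      refine this.congr_deriv ?_
      field_simp)
    (fun v z _ => by
      have := (hr' v z).div (hn' v z) (by simpa using (hnpos z).ne')
      simp only [zero_smul, add_zero] at this
      exact this)
  have e1 : (fun z => Real.log (‖z - x‖ ^ 2 + ε ^ 2) / 2 * Laplacian.laplacian ψ z) =
      fun z => Real.log (n z) / 2 * Laplacian.laplacian ψ z := by
    ext z; rw [hn]
  rw [e1, hL]
  -- The integrand after translation by x; rescaling by ε multiplies area by ε² and yields the fixed
  -- density of `integral_mass`.
  let G : ℂ → ℝ := fun z => 2 * ε ^ 2 / (‖z‖ ^ 2 + ε ^ 2) ^ 2 * ψ (x + z)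
  have e2 : ∫ z, G z = ∫ z, G (z - x) := (integral_sub_right_eq_self G x).symm
  have e3 : ∫ w : ℂ, G (ε • w) = |(ε ^ Module.finrank ℝ ℂ)⁻¹| • ∫ z, G z :=
    Measure.integral_comp_smul volume G ε
  rw [Complex.finrank_real_complex, abs_of_pos (by positivity), smul_eq_mul] at e3
  have e4 : ∫ w : ℂ, 2 / (‖w‖ ^ 2 + 1) ^ 2 * ψ (x + ε • w) = ε ^ 2 * ∫ w : ℂ, G (ε • w) := by
    rw [← integral_const_mul]
    congr 1; ext w
    simp only [G, norm_smul, Real.norm_of_nonneg hε.le, mul_pow]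
    have : ε ^ 2 * ‖w‖ ^ 2 + ε ^ 2 = ε ^ 2 * (‖w‖ ^ 2 + 1) := by ring
    rw [this, mul_pow]
    field_simp
  rw [e4, e3, ← mul_assoc, mul_inv_cancel₀ (by positivity), one_mul, e2]
  congr 1; ext z
  simp only [G, add_sub_cancel]
  congr 1
  have : n z = ‖z - x‖ ^ 2 + ε ^ 2 := by rw [hn]
  rw [← this, ← add_div]
  congr 1
  simp [r, n]
  ring

/-- `(2π)⁻¹ log |z - x|` is the fundamental solution of the Laplacian. -/
theorem integral_log_norm_sub_mul_laplacian {ψ : ℂ → ℝ} (hψ : IsTest ψ) (x : ℝ) :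
    ∫ z : ℂ, Real.log ‖z - x‖ * Laplacian.laplacian ψ z = 2 * Real.pi * ψ x := by
  let ε : ℕ → ℝ := fun n => 1 / ((n : ℝ) + 1)
  have hε : ∀ n, 0 < ε n := fun n => by positivity
  have hε1 : ∀ n, ε n ≤ 1 := fun n => by
    rw [div_le_one (by positivity)]; linarith [(Nat.cast_nonneg n : (0 : ℝ) ≤ n)]
  have hε0 : Tendsto ε atTop (𝓝 0) := tendsto_one_div_add_atTop_nhds_zero_nat
  have h1 : Tendsto (fun n => ∫ z : ℂ, Real.log (‖z - x‖ ^ 2 + ε n ^ 2) / 2 *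
      Laplacian.laplacian ψ z) atTop (𝓝 (∫ z : ℂ, Real.log ‖z - x‖ * Laplacian.laplacian ψ z)) := by
    refine hψ.tendsto_integral (fun n => ?_) (fun R => ?_) (fun z hz => ?_)
    · refine Continuous.aestronglyMeasurable ?_
      refine (Continuous.log (by fun_prop) fun z => ?_).div_const 2
      have := hε n
      positivity
    -- Below, |Im z| ≤ |z - x| because x is real, uniformly in ε; above, log t ≤ t.
    · refine ⟨(R + |x|) ^ 2 + 1, fun n z hzR hz => ?_⟩
      have hz' : 0 < |z.im| := abs_pos.2 hz
      have him : |z.im| ≤ ‖z - x‖ := by simpa using Complex.abs_im_le_norm (z - x)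
      have hup : ‖z - x‖ ≤ R + |x| := (norm_sub_le _ _).trans (by simpa using hzR)
      have hsq : ε n ^ 2 ≤ 1 := pow_le_one₀ (hε n).le (hε1 n)
      have hp : 0 < ‖z - x‖ ^ 2 + ε n ^ 2 := by have := hε n; positivity
      have l1 : Real.log (|z.im| ^ 2) ≤ Real.log (‖z - x‖ ^ 2 + ε n ^ 2) := by
        refine Real.log_le_log (by positivity) ?_
        have := pow_le_pow_left₀ hz'.le him 2
        have := sq_nonneg (ε n)
        linarith
      rw [Real.log_pow] at l1
      push_cast at l1
      have l2 : Real.log (‖z - x‖ ^ 2 + ε n ^ 2) ≤ (R + |x|) ^ 2 + 1 := by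
        refine (Real.log_le_self hp.le).trans ?_
        have := pow_le_pow_left₀ (norm_nonneg _) hup 2
        linarith
      have l3 := neg_abs_le (Real.log (|z.im|))
      have l4 := abs_nonneg (Real.log (|z.im|))
      have l5 : 0 ≤ (R + |x|) ^ 2 + 1 := by positivity
      rw [abs_le]
      constructor <;> linarith
    · have hne : ‖z - x‖ ≠ 0 := by
        have him : |z.im| ≤ ‖z - x‖ := by simpa using Complex.abs_im_le_norm (z - x)
        have := abs_pos.2 hz
        linarith
      have h2 : Tendsto (fun n => ‖z - x‖ ^ 2 + ε n ^ 2) atTop (𝓝 (‖z - x‖ ^ 2)) := by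
        simpa using (hε0.pow 2).const_add (‖z - x‖ ^ 2)
      have h3 := (h2.log (pow_ne_zero 2 hne)).div_const 2
      rw [Real.log_pow] at h3
      simpa using h3
  have h2 : Tendsto (fun n => ∫ w : ℂ, 2 / (‖w‖ ^ 2 + 1) ^ 2 * ψ (x + ε n • w)) atTop
      (𝓝 (∫ w : ℂ, 2 / (‖w‖ ^ 2 + 1) ^ 2 * ψ x)) := by
    obtain ⟨D, hD⟩ := hψ.compact.exists_bound_of_continuous hψ.smooth.continuous
    refine tendsto_integral_of_dominated_convergence (fun w => 2 / (‖w‖ ^ 2 + 1) ^ 2 * D)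
      (fun n => ?_) (integrable_mass.mul_const D) (fun n => ?_) ?_
    · refine integrable_mass.aestronglyMeasurable.mul ?_
      exact (hψ.smooth.continuous.comp (by fun_prop)).aestronglyMeasurable
    · refine Eventually.of_forall fun w => ?_
      rw [norm_mul, Real.norm_of_nonneg (by positivity)]
      exact mul_le_mul_of_nonneg_left (hD _) (by positivity)
    · refine Eventually.of_forall fun w => ?_
      refine Tendsto.const_mul _ ?_
      have : Tendsto (fun n => (x : ℂ) + ε n • w) atTop (𝓝 ((x : ℂ) + (0 : ℝ) • w)) :=
        (hε0.smul_const w).const_add _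
      rw [zero_smul, add_zero] at this
      exact (hψ.smooth.continuous.tendsto _).comp this
  rw [integral_mul_const, integral_mass] at h2
  refine tendsto_nhds_unique h1 (h2.congr fun n => ?_)
  exact (integral_regularized_laplacian hψ x (hε n)).symm

/-! ### The logarithm of an entire function with simple real zeros -/

/-- Zeros are divided out one at a time; `dslope` is the entire quotient, with the removable
singularity filled in. -/
lemma exists_factorization {f : ℂ → ℂ} (hf : Differentiable ℂ f) (F : Finset ℝ)
    (hF : ∀ x ∈ F, f x = 0) :
    ∃ g : ℂ → ℂ, Differentiable ℂ g ∧ ∀ z, f z = (∏ x ∈ F, (z - x)) * g z := by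
  classical
  induction F using Finset.induction_on with
  | empty => exact ⟨f, hf, fun z => by simp⟩
  | insert a F ha ih =>
    obtain ⟨g, hg, hfg⟩ := ih fun x hx => hF x (Finset.mem_insert_of_mem hx)
    have hga : g a = 0 := by
      have h1 := hF a (Finset.mem_insert_self _ _)
      rw [hfg] at h1
      refine (mul_eq_zero.1 h1).resolve_left (Finset.prod_ne_zero_iff.2 fun x hx => ?_)
      rw [sub_ne_zero]
      intro h
      exact ha (by rwa [Complex.ofReal_injective h])
    refine ⟨dslope g a, ?_, fun z => ?_⟩
    · rw [← differentiableOn_univ] at hg ⊢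
      exact (Complex.differentiableOn_dslope univ_mem).2 hg
    · have := sub_smul_dslope g a z
      rw [hga, sub_zero, smul_eq_mul] at this
      rw [hfg z, Finset.prod_insert ha, ← this]
      ring

/-- Infinitely many zeros in a compact set would accumulate, and the identity theorem would give f =
0. -/
lemma finite_real_zeros {f : ℂ → ℂ} (hf : Differentiable ℂ f) (hne : ∃ z, f z ≠ 0) {K : Set ℝ}
    (hK : IsCompact K) : {x : ℝ | x ∈ K ∧ f x = 0}.Finite := by
  have h1 : AnalyticOnNhd ℂ f Set.univ := fun z _ => hf.analyticAt z
  by_contra hinf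
  obtain ⟨a, haK, ha⟩ := Set.Infinite.exists_accPt_of_subset_isCompact hinf hK fun x hx => hx.1
  rw [accPt_iff_frequently_nhdsNE] at ha
  have h2 : ∃ᶠ z in 𝓝[≠] (a : ℂ), f z = 0 := by
    have ht : Tendsto (fun x : ℝ => (x : ℂ)) (𝓝[≠] a) (𝓝[≠] (a : ℂ)) := by
      refine tendsto_nhdsWithin_iff.2 ⟨?_, ?_⟩
      · exact (Complex.continuous_ofReal.tendsto a).mono_left nhdsWithin_le_nhds
      · filter_upwards [self_mem_nhdsWithin] with x hx
        simpa using hx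
    exact ht.frequently (ha.mono fun x hx => hx.2)
  have h3 := h1.eqOn_zero_of_preconnected_of_frequently_eq_zero isPreconnected_univ
    (Set.mem_univ (a : ℂ)) h2
  obtain ⟨z, hz⟩ := hne
  exact hz (h3 (Set.mem_univ z))

/-- The Laplacian of `log |f|` is `2π` times the counting measure of the zeros. -/
theorem integral_log_norm_mul_laplacian {f : ℂ → ℂ} (hf : Differentiable ℂ f)
    (him : ∀ z, f z = 0 → z.im = 0) (hder : ∀ x : ℝ, f x = 0 → deriv f x ≠ 0)
    {ψ : ℂ → ℝ} (hψ : IsTest ψ) (F : Finset ℝ) (hF : ∀ x ∈ F, f x = 0)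
    (hF' : ∀ x : ℝ, f x = 0 → (x : ℂ) ∈ tsupport ψ → x ∈ F) :
    ∫ z, Real.log ‖f z‖ * Laplacian.laplacian ψ z = 2 * Real.pi * ∑ x ∈ F, ψ x := by
  obtain ⟨g, hg, hfg⟩ := exists_factorization hf F hF
  -- A zero of g on the support is a real zero of f, hence lies in F, hence is a multiple zero of f.
  -- Therefore log|g| is harmonic on the support.
  have hg0 : ∀ z ∈ tsupport ψ, g z ≠ 0 := by
    intro z hz hgz
    have hfz : f z = 0 := by rw [hfg, hgz, mul_zero]
    obtain ⟨x, rfl⟩ : ∃ x : ℝ, z = x := ⟨z.re, Complex.ext rfl (by simpa using him z hfz)⟩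
    have hxF := hF' x hfz hz
    refine hder x hfz ?_
    have hfun : f = fun z => (∏ x ∈ F, (z - (x : ℂ))) * g z := funext hfg
    have hp : DifferentiableAt ℂ (fun z : ℂ => ∏ x ∈ F, (z - (x : ℂ))) x := by fun_prop
    have h2 := hp.hasDerivAt.mul (hg x).hasDerivAt
    have h3 : ∏ y ∈ F, ((x : ℂ) - (y : ℂ)) = 0 := Finset.prod_eq_zero hxF (sub_self _)
    rw [hgz, h3, mul_zero, zero_mul, add_zero] at h2
    rw [hfun]
    exact h2.deriv
  have hharm : ∫ z, Real.log ‖g z‖ * Laplacian.laplacian ψ z = 0 :=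
    hψ.integral_harmonic_mul_laplacian fun z hz => (hg.analyticAt z).harmonicAt_log_norm (hg0 z hz)
  have hint1 : Integrable fun z => Real.log ‖g z‖ * Laplacian.laplacian ψ z := by
    refine integrable_of_continuousOn_support hψ.compact ?_
      ((Function.support_mul_subset_right _ _).trans IsTest.support_laplacian)
    refine ContinuousOn.mul (ContinuousOn.log hg.continuous.norm.continuousOn fun z hz => ?_)
      hψ.continuous_laplacian.continuousOn
    exact norm_ne_zero_iff.2 (hg0 z hz)
  have hint2 : ∀ x ∈ F, Integrable fun z : ℂ => Real.log ‖z - x‖ * Laplacian.laplacian ψ z := by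
    intro x _
    refine hψ.integrable_mul (Measurable.aestronglyMeasurable (by fun_prop)) fun R => ?_
    refine ⟨R + |x|, fun z hzR hz => ?_⟩
    have hz' : 0 < |z.im| := abs_pos.2 hz
    have hup : ‖z - x‖ ≤ R + |x| := (norm_sub_le _ _).trans (by simpa using hzR)
    have him' : |z.im| ≤ ‖z - x‖ := by simpa using Complex.abs_im_le_norm (z - x)
    have l1 := Real.log_le_log hz' him'
    have l2 := (Real.log_le_self (norm_nonneg (z - x))).trans hup
    have l3 := neg_abs_le (Real.log (|z.im|))
    have l4 := abs_nonneg (Real.log (|z.im|))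
    have l5 : 0 ≤ R + |x| := (norm_nonneg _).trans hup
    rw [abs_le]
    constructor <;> linarith
  have hae : (fun z => Real.log ‖f z‖ * Laplacian.laplacian ψ z) =ᵐ[volume] fun z =>
      (∑ x ∈ F, Real.log ‖z - x‖ * Laplacian.laplacian ψ z) +
        Real.log ‖g z‖ * Laplacian.laplacian ψ z := by
    filter_upwards [ae_im_ne_zero] with z hz
    by_cases hzs : z ∈ tsupport ψ
    · rw [hfg z, norm_mul, norm_prod, Real.log_mul _ (norm_ne_zero_iff.2 (hg0 z hzs)),
        Real.log_prod, add_mul, Finset.sum_mul]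
      · intro x _ h
        rw [norm_eq_zero, sub_eq_zero] at h
        exact hz (by rw [h]; simp)
      · refine Finset.prod_ne_zero_iff.2 fun x _ h => ?_
        rw [norm_eq_zero, sub_eq_zero] at h
        exact hz (by rw [h]; simp)
    · have : Laplacian.laplacian ψ z = 0 := by
        by_contra h
        exact hzs (IsTest.support_laplacian h)
      simp [this]
  rw [integral_congr_ae hae, integral_add (integrable_finsetSum _ hint2) hint1, hharm, add_zero,
    integral_finsetSum _ hint2, Finset.mul_sum]
  exact Finset.sum_congr rfl fun x _ => integral_log_norm_sub_mul_laplacian hψ x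

/-! ### Counting measures of zeros -/

open Classical in
/-- The indicator of the real zeros of `f`, as a multiplicity. -/
def zeroMult (f : ℂ → ℂ) (x : ℝ) : ℕ := if f x = 0 then 1 else 0

/-- The counting measure of the real zeros of `f`. -/
def zeroMeasure (f : ℂ → ℂ) : Measure ℝ := countingMeasure (zeroMult f)

lemma zeroMeasure_restrict {f : ℂ → ℂ} {K : Set ℝ} (hK : MeasurableSet K) (F : Finset ℝ)
    (hF : ∀ x : ℝ, x ∈ F ↔ x ∈ K ∧ f x = 0) :
    (zeroMeasure f).restrict K = ∑ x ∈ F, Measure.dirac x := by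
  classical
  ext s hs
  rw [zeroMeasure, countingMeasure, Measure.restrict_sum _ hK, Measure.sum_apply _ hs,
    Measure.finsetSum_apply, tsum_eq_sum (s := F)]
  · refine Finset.sum_congr rfl fun x hx => ?_
    obtain ⟨hxK, hx0⟩ := (hF x).1 hx
    rw [Measure.restrict_smul, restrict_dirac' hK, if_pos hxK]
    simp [zeroMult, hx0]
  · intro x hx
    rw [Measure.restrict_smul, restrict_dirac' hK]
    by_cases hxK : x ∈ K
    · have : f x ≠ 0 := fun h => hx ((hF x).2 ⟨hxK, h⟩)
      simp [zeroMult, this]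
    · simp [hxK]

lemma exists_finset_zeros {f : ℂ → ℂ} (hf : Differentiable ℂ f) (hne : ∃ z, f z ≠ 0) {K : Set ℝ}
    (hK : IsCompact K) : ∃ F : Finset ℝ, ∀ x : ℝ, x ∈ F ↔ x ∈ K ∧ f x = 0 :=
  ⟨(finite_real_zeros hf hne hK).toFinset, fun x => by simp⟩

lemma isFiniteMeasureOnCompacts_zeroMeasure {f : ℂ → ℂ} (hf : Differentiable ℂ f)
    (hne : ∃ z, f z ≠ 0) : IsFiniteMeasureOnCompacts (zeroMeasure f) := by
  refine ⟨fun K hK => ?_⟩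
  obtain ⟨F, hF⟩ := exists_finset_zeros hf hne hK
  have := zeroMeasure_restrict hK.measurableSet F hF
  rw [← Measure.restrict_apply_self, this, Measure.finsetSum_apply]
  exact ENNReal.sum_lt_top.2 fun x _ => measure_lt_top _ _

lemma integral_zeroMeasure {f : ℂ → ℂ} {K : Set ℝ} (hK : MeasurableSet K) (F : Finset ℝ)
    (hF : ∀ x : ℝ, x ∈ F ↔ x ∈ K ∧ f x = 0) {φ : ℝ → ℝ} (hφ : ∀ x ∉ K, φ x = 0) :
    ∫ x, φ x ∂(zeroMeasure f) = ∑ x ∈ F, φ x := by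
  rw [← setIntegral_eq_integral_of_forall_compl_eq_zero hφ, zeroMeasure_restrict hK F hF,
    integral_finsetSum_measure fun x _ => integrable_dirac (by simp)]
  simp

lemma IsTest.compact_ofReal {ψ : ℂ → ℝ} (hψ : HasCompactSupport ψ) :
    HasCompactSupport fun x : ℝ => ψ x :=
  hψ.comp_isClosedEmbedding Complex.isometry_ofReal.isClosedEmbedding

/-! ### Vague limits of the zero counting measures -/

namespace HasLogLimit

variable {f : ℕ → ℂ → ℂ} {G : ℂ → ℝ}

lemma ne_zero (h : HasLogLimit f G) (n : ℕ) : ∃ z, f n z ≠ 0 :=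
  ⟨Complex.I, fun hz => by simpa using h.im_eq_zero n _ hz⟩

lemma isFiniteMeasureOnCompacts (h : HasLogLimit f G) (n : ℕ) :
    IsFiniteMeasureOnCompacts (zeroMeasure (f n)) :=
  isFiniteMeasureOnCompacts_zeroMeasure (h.diff n) (h.ne_zero n)

/-- The zeros are counted by the Laplacian of log|fₙ|, and dominated convergence passes to the limit
on the other side of the integration by parts. -/
lemma tendsto_integral_test (h : HasLogLimit f G) {ψ : ℂ → ℝ} (hψ : IsTest ψ) :
    Tendsto (fun n => ((2 : ℝ) ^ n)⁻¹ * ∫ x, ψ x ∂(zeroMeasure (f n))) atTop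
      (𝓝 ((2 * Real.pi)⁻¹ * ∫ z, G z * Laplacian.laplacian ψ z)) := by
  have h1 := (hψ.tendsto_integral (f := fun n z => ((2 : ℝ) ^ n)⁻¹ * Real.log ‖f n z‖)
    (fun n => ?_) h.bound h.tendsto).const_mul (2 * Real.pi)⁻¹
  · refine h1.congr fun n => ?_
    have hK : IsCompact (tsupport fun x : ℝ => ψ x) := IsTest.compact_ofReal hψ.compact
    obtain ⟨F, hF⟩ := exists_finset_zeros (h.diff n) (h.ne_zero n)
      (Complex.isometry_ofReal.isClosedEmbedding.isCompact_preimage hψ.compact)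
    have h2 := integral_log_norm_mul_laplacian (h.diff n) (h.im_eq_zero n) (h.deriv_ne_zero n) hψ F
      (fun x hx => ((hF x).1 hx).2) fun x hx hxs => (hF x).2 ⟨hxs, hx⟩
    simp only [mul_assoc ((2 : ℝ) ^ n)⁻¹]
    rw [integral_const_mul, h2, integral_zeroMeasure
      ((isClosed_tsupport ψ).preimage Complex.continuous_ofReal).measurableSet F hF
      fun x hx => image_eq_zero_of_notMem_tsupport hx]
    have := Real.pi_pos
    field_simp
  · have := (h.diff n).continuous
    exact Measurable.aestronglyMeasurable (by fun_prop)

/-- The eigenvalue counts per volume of a compact set are bounded. -/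
lemma exists_measure_le (h : HasLogLimit f G) {K : Set ℝ} (hK : IsCompact K) :
    ∃ C : ℝ, 0 ≤ C ∧ ∀ n, ((2 : ℝ) ^ n)⁻¹ * (zeroMeasure (f n)).real K ≤ C := by
  obtain ⟨R, hR⟩ := hK.isBounded.subset_closedBall 0
  -- A bump equal to 1 on a ball around K. Its integral dominates the mass of K, and the normalized
  -- integrals converge, so they are bounded.
  let ρ : ContDiffBump (0 : ℂ) := ⟨max R 1, max R 1 + 1, by positivity, by linarith⟩
  have hρ : IsTest ρ := ⟨ρ.contDiff, ρ.hasCompactSupport⟩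
  obtain ⟨C, hC⟩ := (h.tendsto_integral_test hρ).bddAbove_range
  refine ⟨max C 0, le_max_right _ _, fun n => le_trans ?_ (le_max_left _ _)⟩
  refine le_trans ?_ (hC ⟨n, rfl⟩)
  refine mul_le_mul_of_nonneg_left ?_ (by positivity)
  have := h.isFiniteMeasureOnCompacts n
  rw [← integral_indicator_one hK.measurableSet]
  refine integral_mono ?_ ?_ fun x => ?_
  · exact (continuousOn_const.integrableOn_compact hK).integrable_indicator hK.measurableSet
  · exact (hρ.smooth.continuous.comp Complex.continuous_ofReal).integrable_of_hasCompactSupport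
      (IsTest.compact_ofReal hρ.compact)
  · by_cases hx : x ∈ K
    · have h1 : (x : ℂ) ∈ Metric.closedBall (0 : ℂ) ρ.rIn := by
        have := hR hx
        rw [mem_closedBall_zero_iff] at this ⊢
        rw [Complex.norm_real]
        exact this.trans (le_max_left _ _)
      rw [Set.indicator_of_mem hx, ρ.one_of_mem_closedBall h1]; rfl
    · rw [Set.indicator_of_notMem hx]; exact ρ.nonneg

end HasLogLimit

/-- Approximation of a continuous function on the line by test functions on the plane. -/
lemma exists_test_approx {φ : ℝ → ℝ} (hφ : Continuous φ) (hc : HasCompactSupport φ) {ε : ℝ}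
    (hε : 0 < ε) : ∃ ψ : ℂ → ℝ, IsTest ψ ∧ (∀ x : ℝ, |ψ x - φ x| ≤ ε) ∧
      ∀ x : ℝ, x ∉ tsupport φ → ψ x = 0 := by
  -- φ is spread over the plane by a tent in Im z. The smooth approximation has support inside that
  -- of Φ, so on the line it vanishes where φ does.
  let Φ : ℂ → ℝ := fun z => φ z.re * max 0 (1 - |z.im|)
  have hΦ : Continuous Φ := by
    have := Complex.continuous_re
    have := Complex.continuous_im
    fun_prop
  obtain ⟨ψ, hs, hd, hsup⟩ := hΦ.exists_contDiff_approx ⊤ (ε := fun _ => ε) continuous_const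
    fun _ => hε
  have hΦ0 : ∀ x : ℝ, Φ x = φ x := fun x => by simp [Φ]
  refine ⟨ψ, ⟨hs, ?_⟩, fun x => ?_, fun x hx => ?_⟩
  · obtain ⟨R, hR⟩ := hc.isBounded.subset_closedBall 0
    refine HasCompactSupport.of_support_subset_isCompact (isCompact_closedBall (0 : ℂ) (R + 1)) ?_
    intro z hz
    have hz' := hsup hz
    have h1 : φ z.re ≠ 0 := left_ne_zero_of_mul hz'
    have h2 : max 0 (1 - |z.im|) ≠ 0 := right_ne_zero_of_mul hz'
    have h3 := hR (subset_tsupport _ h1)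
    have h4 : |z.im| ≤ 1 := by
      by_contra! h
      exact h2 (max_eq_left (by linarith))
    rw [mem_closedBall_zero_iff, Real.norm_eq_abs] at h3
    rw [mem_closedBall_zero_iff]
    exact (Complex.norm_le_abs_re_add_abs_im z).trans (add_le_add h3 h4)
  · have := (hd x).le
    rwa [Real.dist_eq, hΦ0] at this
  · by_contra h
    have h1 := hsup h
    rw [Function.mem_support, hΦ0] at h1
    exact hx (subset_tsupport _ h1)

namespace HasLogLimit

variable {f g : ℕ → ℂ → ℂ} {G : ℂ → ℝ}

/-- The error is at most ε times the normalized mass of the support of φ, which is bounded in n. The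
constant does not depend on ε or ψ. -/
lemma exists_approx_le (h : HasLogLimit f G) {φ : ℝ → ℝ} (hφ : Continuous φ)
    (hc : HasCompactSupport φ) : ∃ C : ℝ, 0 ≤ C ∧ ∀ (ε : ℝ) (ψ : ℂ → ℝ), IsTest ψ →
      (∀ x : ℝ, |ψ x - φ x| ≤ ε) → (∀ x : ℝ, x ∉ tsupport φ → ψ x = 0) → ∀ n,
      |((2 : ℝ) ^ n)⁻¹ * (∫ x, ψ x ∂(zeroMeasure (f n))) -
        ((2 : ℝ) ^ n)⁻¹ * ∫ x, φ x ∂(zeroMeasure (f n))| ≤ ε * C := by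
  obtain ⟨C, hC0, hC⟩ := h.exists_measure_le hc
  refine ⟨C, hC0, fun ε ψ hψ hψφ hψ0 n => ?_⟩
  have := h.isFiniteMeasureOnCompacts n
  have hε : 0 ≤ ε := (abs_nonneg _).trans (hψφ 0)
  have i1 : Integrable (fun x : ℝ => ψ x) (zeroMeasure (f n)) :=
    (hψ.smooth.continuous.comp Complex.continuous_ofReal).integrable_of_hasCompactSupport
      (IsTest.compact_ofReal hψ.compact)
  have i2 : Integrable φ (zeroMeasure (f n)) := hφ.integrable_of_hasCompactSupport hc
  rw [← mul_sub, ← integral_sub i1 i2, abs_mul, abs_of_pos (by positivity)]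
  have h1 : |∫ x, (ψ x - φ x) ∂(zeroMeasure (f n))| ≤ ε * (zeroMeasure (f n)).real (tsupport φ) := by
    rw [← setIntegral_eq_integral_of_forall_compl_eq_zero (s := tsupport φ)]
    · exact norm_setIntegral_le_of_norm_le_const hc.measure_lt_top fun x _ =>
        (Real.norm_eq_abs _).trans_le (hψφ x)
    · intro x hx
      rw [hψ0 x hx, image_eq_zero_of_notMem_tsupport hx, sub_zero]
  calc _ ≤ ((2 : ℝ) ^ n)⁻¹ * (ε * (zeroMeasure (f n)).real (tsupport φ)) := by gcongr
    _ = ε * (((2 : ℝ) ^ n)⁻¹ * (zeroMeasure (f n)).real (tsupport φ)) := by ring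
    _ ≤ ε * C := by gcongr; exact hC n

/-- The counting measures of two sequences with the same logarithmic limit have the same limit. -/
lemma exists_limit (hf : HasLogLimit f G) (hg : HasLogLimit g G) {φ : ℝ → ℝ} (hφ : Continuous φ)
    (hc : HasCompactSupport φ) : ∃ l : ℝ,
      Tendsto (fun n => ((2 : ℝ) ^ n)⁻¹ * ∫ x, φ x ∂(zeroMeasure (f n))) atTop (𝓝 l) ∧
      Tendsto (fun n => ((2 : ℝ) ^ n)⁻¹ * ∫ x, φ x ∂(zeroMeasure (g n))) atTop (𝓝 l) := by
  obtain ⟨C, hC0, hC⟩ := hf.exists_approx_le hφ hc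
  obtain ⟨D, hD0, hD⟩ := hg.exists_approx_le hφ hc
  have key : ∀ ε > 0, ∃ l : ℝ, ∀ᶠ n in atTop,
      |((2 : ℝ) ^ n)⁻¹ * (∫ x, φ x ∂(zeroMeasure (f n))) - l| < ε ∧
      |((2 : ℝ) ^ n)⁻¹ * (∫ x, φ x ∂(zeroMeasure (g n))) - l| < ε := by
    intro ε hε
    obtain ⟨η, hη, hη1, hη2⟩ : ∃ η > 0, η * C < ε / 2 ∧ η * D < ε / 2 := by
      refine ⟨ε / (2 * (C + D + 1)), by positivity, ?_, ?_⟩ <;>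
      · rw [div_mul_eq_mul_div, div_lt_div_iff₀ (by positivity) (by positivity)]
        nlinarith
    obtain ⟨ψ, hψ, h1, h2⟩ := exists_test_approx hφ hc hη
    -- The approximate limit depends only on G and ψ, so it serves both sequences.
    refine ⟨(2 * Real.pi)⁻¹ * ∫ z, G z * Laplacian.laplacian ψ z, ?_⟩
    filter_upwards [Metric.tendsto_nhds.1 (hf.tendsto_integral_test hψ) (ε / 2) (by positivity),
      Metric.tendsto_nhds.1 (hg.tendsto_integral_test hψ) (ε / 2) (by positivity)] with n e1 e2
    have e3 := hC η ψ hψ h1 h2 n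
    have e4 := hD η ψ hψ h1 h2 n
    rw [Real.dist_eq] at e1 e2
    rw [abs_lt] at e1 e2 ⊢
    rw [abs_lt]
    rw [abs_le] at e3 e4
    refine ⟨⟨?_, ?_⟩, ?_, ?_⟩ <;> linarith [e3.1, e3.2, e4.1, e4.2, e1.1, e1.2, e2.1, e2.2]
  have hcau : CauchySeq fun n => ((2 : ℝ) ^ n)⁻¹ * ∫ x, φ x ∂(zeroMeasure (f n)) := by
    rw [Metric.cauchySeq_iff]
    intro ε hε
    obtain ⟨l, hl⟩ := key (ε / 2) (by positivity)
    obtain ⟨N, hN⟩ := eventually_atTop.1 hl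
    refine ⟨N, fun m hm n hn => ?_⟩
    have e1 := abs_lt.1 (hN m hm).1
    have e2 := abs_lt.1 (hN n hn).1
    rw [Real.dist_eq, abs_lt]
    constructor <;> linarith [e1.1, e1.2, e2.1, e2.2]
  obtain ⟨L, hL⟩ := cauchySeq_tendsto_of_complete hcau
  refine ⟨L, hL, ?_⟩
  rw [Metric.tendsto_nhds]
  intro ε hε
  obtain ⟨l, hl⟩ := key (ε / 4) (by positivity)
  filter_upwards [hl, Metric.tendsto_nhds.1 hL (ε / 4) (by positivity)] with n e1 e2
  rw [Real.dist_eq, abs_lt] at e2 ⊢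
  have e3 := abs_lt.1 e1.1
  have e4 := abs_lt.1 e1.2
  constructor <;> linarith [e3.1, e3.2, e4.1, e4.2, e2.1, e2.2]

open CompactlySupported in
/-- The common vague limit of the counting measures, and its potential. -/
theorem exists_measure (hf : HasLogLimit f G) (hg : HasLogLimit g G) : ∃ μ : Measure ℝ,
    VaguelyTendsto (fun n => ((2 : ℝ) ^ n)⁻¹) (fun n => zeroMeasure (f n)) μ ∧
    VaguelyTendsto (fun n => ((2 : ℝ) ^ n)⁻¹) (fun n => zeroMeasure (g n)) μ ∧
    ∀ ψ : ℂ → ℝ, IsTest ψ → ∫ z, ψ z ∂(μ.map fun x : ℝ => (x : ℂ)) =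
      (2 * Real.pi)⁻¹ * ∫ z, G z * Laplacian.laplacian ψ z := by
  have hex : ∀ φ : C_c(ℝ, ℝ), ∃ l : ℝ,
      Tendsto (fun n => ((2 : ℝ) ^ n)⁻¹ * ∫ x, φ x ∂(zeroMeasure (f n))) atTop (𝓝 l) ∧
      Tendsto (fun n => ((2 : ℝ) ^ n)⁻¹ * ∫ x, φ x ∂(zeroMeasure (g n))) atTop (𝓝 l) :=
    fun φ => hf.exists_limit hg φ.continuous φ.hasCompactSupport
  choose Λ hΛf hΛg using hex
  have hint : ∀ n (φ : C_c(ℝ, ℝ)), Integrable φ (zeroMeasure (f n)) := fun n φ =>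
    have := hf.isFiniteMeasureOnCompacts n
    φ.continuous.integrable_of_hasCompactSupport φ.hasCompactSupport
  let Λ' : C_c(ℝ, ℝ) →ₗ[ℝ] ℝ :=
    { toFun := Λ
      map_add' := fun φ χ => by
        refine tendsto_nhds_unique (hΛf (φ + χ)) (((hΛf φ).add (hΛf χ)).congr fun n => ?_)
        rw [← mul_add, ← integral_add (hint n φ) (hint n χ)]
        rfl
      map_smul' := fun c φ => by
        refine tendsto_nhds_unique (hΛf (c • φ)) (((hΛf φ).const_mul c).congr fun n => ?_)
        rw [mul_left_comm, ← integral_const_mul]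
        rfl }
  -- The limit functional inherits linearity and positivity, and Riesz-Markov represents it by a
  -- measure.
  let Λp : C_c(ℝ, ℝ) →ₚ[ℝ] ℝ := PositiveLinearMap.mk₀ Λ' fun φ hφ =>
    ge_of_tendsto' (hΛf φ) fun n => mul_nonneg (by positivity) (integral_nonneg fun x => hφ x)
  have hμ : ∀ φ : C_c(ℝ, ℝ), ∫ x, φ x ∂(RealRMK.rieszMeasure Λp) = Λ φ :=
    fun φ => RealRMK.integral_rieszMeasure Λp φ
  have hvag : ∀ {k : ℕ → ℂ → ℂ}, HasLogLimit k G → (∀ φ : C_c(ℝ, ℝ),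
      Tendsto (fun n => ((2 : ℝ) ^ n)⁻¹ * ∫ x, φ x ∂(zeroMeasure (k n))) atTop (𝓝 (Λ φ))) →
      VaguelyTendsto (fun n => ((2 : ℝ) ^ n)⁻¹) (fun n => zeroMeasure (k n))
        (RealRMK.rieszMeasure Λp) := by
    intro k hk hlim
    refine ⟨fun n => hk.isFiniteMeasureOnCompacts n, inferInstance, fun φ hφ hc => ?_⟩
    have := hlim ⟨⟨φ, hφ⟩, hc⟩
    rw [← hμ] at this
    exact this
  refine ⟨RealRMK.rieszMeasure Λp, hvag hf hΛf, hvag hg hΛg, fun ψ hψ => ?_⟩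
  rw [integral_map Complex.continuous_ofReal.aemeasurable
    hψ.smooth.continuous.aestronglyMeasurable]
  refine tendsto_nhds_unique ((hvag hf hΛf).2.2 (fun x : ℝ => ψ x)
    (hψ.smooth.continuous.comp Complex.continuous_ofReal) (IsTest.compact_ofReal hψ.compact)) ?_
  exact hf.tendsto_integral_test hψ

end HasLogLimit

/-! ### The density of states of a transfer family -/

namespace IsTransferFamily

open Transfer

variable {M : ℂ → Transfer} {Q : ℂ → ℂ → ℂ → ℝ}

lemma continuous_toVec (h : IsTransferFamily M Q) : Continuous fun x => (M x).toVec := by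
  have := h.diff_a.continuous
  have := h.diff_d.continuous
  refine continuous_pi fun i => ?_
  fin_cases i <;> simp [toVec] <;> fun_prop

lemma measurable_green (h : IsTransferFamily M Q) {α : ℝ} (h0 : 0 < α) (h1 : α < 1) :
    Measurable fun x => (Ghat α (M x).toVec).toReal := by
  refine measurable_of_tendsto_metrizable (f := fun n x => greenSeq α n (M x).toVec)
    (fun n => ?_) (tendsto_pi_nhds.2 fun x =>
      (tendsto_greenSeq h0 h1 (z := (M x).toVec) (by simp [toVec])).2.2)
  have : Continuous fun x => (Rhat α)^[n] (M x).toVec :=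
    ((continuous_Rhat α).iterate n).comp h.continuous_toVec
  exact (this.norm.measurable.log).const_mul _

/-- Here q = -1, so the lower bound is a constant and the upper one is continuous in x. In
particular the potential is bounded on compact sets, the real line included. -/
lemma exists_green_bound (h : IsTransferFamily M Q) {α : ℝ} (h0 : 0 < α) (h1 : α < 1) (R : ℝ) :
    ∃ C, ∀ x, ‖x‖ ≤ R → |(Ghat α (M x).toVec).toReal| ≤ C := by
  obtain ⟨K, hK0, hK⟩ := Ghat_toReal_bounds h0 h1
  have hcont : Continuous fun x => Real.log ‖(M x).toVec‖ :=
    h.continuous_toVec.norm.log fun x => (one_pos.trans_le (one_le_norm_toVec _)).ne'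
  obtain ⟨D, hD⟩ := (isCompact_closedBall (0 : ℂ) R).exists_bound_of_continuousOn hcont.continuousOn
  refine ⟨D + K, fun x hx => ?_⟩
  have e1 := hK (M x).toVec (by simp [toVec])
  have e2 := hD x (by simpa using hx)
  have e3 := (le_abs_self _).trans e2
  have e4 := (norm_nonneg _).trans e2
  have e5 : Real.log ‖(M x).toVec 2‖ = 0 := by simp [toVec]
  rw [e5] at e1
  rw [abs_le]
  constructor <;> linarith [e1.1, e1.2]

lemma locallyIntegrable_green (h : IsTransferFamily M Q) {α : ℝ} (h0 : 0 < α) (h1 : α < 1) :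
    LocallyIntegrable fun x => (Ghat α (M x).toVec).toReal := by
  rw [locallyIntegrable_iff]
  intro K hK
  obtain ⟨R, hR⟩ := hK.isBounded.subset_closedBall 0
  obtain ⟨C, hC⟩ := h.exists_green_bound h0 h1 R
  refine IntegrableOn.mono_set ?_ hR
  refine Measure.integrableOn_of_bounded (M := C) (isCompact_closedBall _ _).measure_lt_top.ne
    (h.measurable_green h0 h1).aestronglyMeasurable ?_
  filter_upwards [ae_restrict_mem Metric.isClosed_closedBall.measurableSet] with x hx
  exact hC x (by simpa using hx)

/-- The density of states of a transfer family. -/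
theorem exists_densityOfStates (h : IsTransferFamily M Q) {α : ℝ} (h0 : 0 < α) (h1 : α < 1) :
    ∃ μ : Measure ℝ,
      IsDensityOfStates (fun n => zeroMeasure fun x => ((Transfer.double α)^[n] (M x)).c)
        (fun n => zeroMeasure fun x => ((Transfer.double α)^[n] (M x)).b) μ ∧
      ∀ ψ : ℂ → ℝ, IsTest ψ → ∫ z, ψ z ∂(μ.map fun x : ℝ => (x : ℂ)) =
        (2 * Real.pi)⁻¹ * ∫ z, (Ghat α (M z).toVec).toReal * Laplacian.laplacian ψ z := by
  obtain ⟨μ, hc, hb, hμ⟩ := (h.hasLogLimit_c h0 h1).exists_measure (h.hasLogLimit_b h0 h1)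
  refine ⟨μ, ⟨hc, hb⟩, fun ψ hψ => ?_⟩
  rw [hμ ψ hψ]
  congr 1
  -- The offset log δ in the logarithmic limit is constant, hence harmonic, and does not contribute.
  have e1 : ∫ z, Real.log (ratio α) * Laplacian.laplacian ψ z = 0 :=
    hψ.integral_harmonic_mul_laplacian (h := fun _ => Real.log (ratio α)) fun z _ =>
      InnerProductSpace.harmonicAt_const _
  simp only [sub_mul]
  rw [integral_sub, e1, sub_zero]
  · refine hψ.integrable_mul (h.measurable_green h0 h1).aestronglyMeasurable fun R => ?_
    obtain ⟨C, hC⟩ := h.exists_green_bound h0 h1 R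
    exact ⟨C, fun x hx _ => (hC x hx).trans (by linarith [abs_nonneg (Real.log (|x.im|))])⟩
  · refine hψ.integrable_mul aestronglyMeasurable_const fun R => ⟨|Real.log (ratio α)|, fun x _ _ => ?_⟩
    linarith [abs_nonneg (Real.log (|x.im|))]

end IsTransferFamily

open Transfer

/-! ### The lattice case -/

/-- The transfer matrix of the basic cell. -/
def latticeTransfer (b : Fin 2 → ℝ) (x : ℂ) : Transfer :=
  ⟨1 + x * b 0, 1, (1 + x * b 0) * (1 + x * b 1) - 1, 1 + x * b 1⟩

/-- Flux changes only at the two masses, by Im x times mass times the squared modulus there. If u =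
0 the value at the right end is p, which gives positivity. -/
lemma isTransferFamily_lattice {b : Fin 2 → ℝ} (hb : ∀ i, 0 < b i) :
    IsTransferFamily (latticeTransfer b)
      fun x u p => b 0 * ‖u‖ ^ 2 + b 1 * ‖(latticeTransfer b x).fst u p‖ ^ 2 := by
  refine ⟨?_, ?_, ?_, ?_, ?_, ?_, ?_, ?_, ?_⟩
  · simp only [latticeTransfer]; fun_prop
  · simp only [latticeTransfer]; fun_prop
  · simp only [latticeTransfer]; fun_prop
  · simp only [latticeTransfer]; fun_prop
  · intro x; simp only [latticeTransfer, det]; ring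
  · intro x u p
    rw [← Complex.normSq_eq_norm_sq, ← Complex.normSq_eq_norm_sq]
    simp only [flux, latticeTransfer, fst, snd, Complex.normSq_apply, Complex.mul_im,
      Complex.mul_re, Complex.add_re, Complex.add_im, Complex.conj_re, Complex.conj_im,
      Complex.sub_re, Complex.sub_im, Complex.one_re, Complex.one_im, Complex.ofReal_re,
      Complex.ofReal_im]
    ring
  · simp only [latticeTransfer, fst]; fun_prop
  · intro x c u p
    have : (latticeTransfer b x).fst (c * u) (c * p) = c * (latticeTransfer b x).fst u p := by
      simp only [fst]; ring
    rw [this, norm_mul, norm_mul]; ring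
  · intro x u p h
    have h0 := hb 0
    have h1 := hb 1
    by_cases hu : u = 0
    · have hp : p ≠ 0 := h.resolve_left (not_not.2 hu)
      have : 0 < ‖p‖ := norm_pos_iff.2 hp
      simp only [latticeTransfer, fst, hu, mul_zero, zero_add, one_mul, norm_zero]
      positivity
    · have : 0 < ‖u‖ := norm_pos_iff.2 hu
      positivity

/-! ### Chains of scaled cells and their doubling -/

namespace Transfer

/-- The trivial transfer matrix. -/
def one : Transfer := ⟨1, 0, 0, 1⟩

/-- All the entries are real. -/
def IsReal (M : Transfer) : Prop := ∃ a b c d : ℝ, M = ⟨a, b, c, d⟩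

lemma IsReal.scale {M : Transfer} (h : M.IsReal) (s : ℝ) : (M.scale s).IsReal := by
  obtain ⟨a, b, c, d, rfl⟩ := h
  exact ⟨a, s * b, c / s, d, by simp [Transfer.scale]⟩

lemma IsReal.comp {M N : Transfer} (h : M.IsReal) (h' : N.IsReal) : (M.comp N).IsReal := by
  obtain ⟨a, b, c, d, rfl⟩ := h
  obtain ⟨a', b', c', d', rfl⟩ := h'
  exact ⟨a * a' + b * c', a * b' + b * d', c * a' + d * c', c * b' + d * d', by
    simp [Transfer.comp]⟩

/-- The transfer matrix of the first `k` cells of a chain with lengths `w`. -/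
def chain (M : Transfer) (w : ℕ → ℝ) : ℕ → Transfer
  | 0 => one
  | k + 1 => (M.scale (w k)).comp (chain M w k)

lemma IsReal.chain {M : Transfer} (h : M.IsReal) (w : ℕ → ℝ) (k : ℕ) : (M.chain w k).IsReal := by
  induction k with
  | zero => exact ⟨1, 0, 0, 1, by simp [Transfer.chain, one]⟩
  | succ k ih => exact (h.scale _).comp ih

lemma scale_scale (M : Transfer) (s t : ℝ) : (M.scale s).scale t = M.scale (t * s) := by
  ext <;> simp [scale]
  · ring
  · rw [div_div, mul_comm]

lemma scale_comp {s : ℝ} (hs : s ≠ 0) (M N : Transfer) :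
    (M.comp N).scale s = (M.scale s).comp (N.scale s) := by
  have : (s : ℂ) ≠ 0 := by exact_mod_cast hs
  ext <;> simp only [scale, comp] <;> field_simp

lemma comp_assoc (L M N : Transfer) : (L.comp M).comp N = L.comp (M.comp N) := by
  ext <;> simp only [comp] <;> ring

lemma one_comp (M : Transfer) : one.comp M = M := by
  ext <;> simp [comp, one]

lemma chain_add (M : Transfer) (w : ℕ → ℝ) (k l : ℕ) :
    M.chain w (k + l) = (M.chain (fun p => w (k + p)) l).comp (M.chain w k) := by
  induction l with
  | zero => simp [chain, one_comp]
  | succ l ih => rw [← add_assoc, chain, chain, ih, comp_assoc]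

lemma chain_scale {s : ℝ} (hs : s ≠ 0) (M : Transfer) (w : ℕ → ℝ) (k : ℕ) :
    M.chain (fun p => s * w p) k = (M.chain w k).scale s := by
  induction k with
  | zero => ext <;> simp [chain, one, scale]
  | succ k ih => rw [chain, chain, ih, scale_comp hs, scale_scale]

lemma chain_congr (M : Transfer) {w w' : ℕ → ℝ} {k : ℕ} (h : ∀ p < k, w p = w' p) :
    M.chain w k = M.chain w' k := by
  induction k with
  | zero => rfl
  | succ k ih => rw [chain, chain, ih fun p hp => h p (by omega), h k (by omega)]

end Transfer

/-- The lengths of the cells of the `n`-th lattice. -/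
def cellLength (α : ℝ) : ℕ → ℕ → ℝ
  | 0, _ => 1
  | n + 1, p => if p < 2 ^ n then α * cellLength α n p else (1 - α) * cellLength α n (p - 2 ^ n)

lemma cellLength_pos {α : ℝ} (h0 : 0 < α) (h1 : α < 1) (n p : ℕ) : 0 < cellLength α n p := by
  induction n generalizing p with
  | zero => exact one_pos
  | succ n ih =>
    rw [cellLength]
    split_ifs
    · exact mul_pos h0 (ih p)
    · exact mul_pos (by linarith) (ih _)

/-- The cells left and right of the middle vertex form two copies of the chain of level n, with
lengths scaled by α and 1 - α. -/
lemma chain_cellLength {α : ℝ} (h0 : 0 < α) (h1 : α < 1) (M : Transfer) (n : ℕ) :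
    M.chain (cellLength α n) (2 ^ n) = (double α)^[n] M := by
  induction n with
  | zero =>
    change (M.scale 1).comp one = M
    ext <;> simp [comp, one, scale]
  | succ n ih =>
    rw [pow_succ, mul_two, chain_add, Function.iterate_succ_apply', double, ← ih,
      ← chain_scale h0.ne', ← chain_scale (by linarith : (1 - α) ≠ 0)]
    congr 1
    · refine chain_congr _ fun p hp => ?_
      simp [cellLength]
    · refine chain_congr _ fun p hp => ?_
      simp [cellLength, hp]

/-- `finFunctionFinEquiv` makes the last letter the leading binary digit, and that digit decides the
first branch of `cellLength`. Reversing the reading order does not affect the product. -/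
lemma prod_energyWeight (α : ℝ) (n : ℕ) (j : Fin n → Fin 2) :
    ∏ k, energyWeight α (j k) = cellLength α n (finFunctionFinEquiv j) := by
  induction n with
  | zero => simp [cellLength]
  | succ n ih =>
    have h1 : ((finFunctionFinEquiv j : Fin (2 ^ (n + 1))) : ℕ) =
        (finFunctionFinEquiv (fun i : Fin n => j i.castSucc) : Fin (2 ^ n)) +
          (j (Fin.last n) : ℕ) * 2 ^ n := by
      rw [finFunctionFinEquiv_apply, finFunctionFinEquiv_apply, Fin.sum_univ_castSucc]
      simp
    rw [Fin.prod_univ_castSucc, ih fun i => j i.castSucc, cellLength, h1]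
    have h2 := (finFunctionFinEquiv (fun i : Fin n => j i.castSucc)).isLt
    generalize (finFunctionFinEquiv (fun i : Fin n => j i.castSucc) : Fin (2 ^ n)).val = q at *
    generalize j (Fin.last n) = i
    fin_cases i
    · simp [h2, energyWeight, mul_comm]
    · simp [energyWeight, mul_comm]

/-- The equation of the chain at the vertex `k`. -/
def chainResidual (b : Fin 2 → ℝ) (w : ℕ → ℝ) (N : ℕ) (x : ℝ) (F : ℕ → ℝ) (k : ℕ) : ℝ :=
  (if k < N then ((1 + x * b 0) * F k - F (k + 1)) / w k else 0) +
    if 0 < k then ((1 + x * b 1) * F k - F (k - 1)) / w (k - 1) else 0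

/-- The values of `f` on the vertices of the chain, extended by `0`. -/
def extend {N : ℕ} (f : Fin (N + 1) → ℝ) (k : ℕ) : ℝ := if h : k < N + 1 then f ⟨k, h⟩ else 0

lemma extend_val {N : ℕ} (f : Fin (N + 1) → ℝ) (u : Fin (N + 1)) : extend f u = f u := by
  simp [extend, Nat.lt_succ_iff.1 u.isLt]

section

variable (α : ℝ) (b : Fin 2 → ℝ) (ω : ℕ → Fin 2) (n : ℕ)

lemma sum_cells (g : ℕ → ℝ) :
    ∑ j : Fin n → Fin 2, g (finFunctionFinEquiv j) = ∑ p ∈ Finset.range (2 ^ n), g p := by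
  rw [Equiv.sum_comp finFunctionFinEquiv fun p : Fin (2 ^ n) => g p, Finset.sum_range]

lemma sum_latticeEnergy (f : Fin (2 ^ n + 1) → ℝ) (u : Fin (2 ^ n + 1)) :
    ∑ v, latticeEnergy α ω n u v * f v = ∑ p ∈ Finset.range (2 ^ n),
      (∏ k ∈ Finset.range n, energyWeight α (ω k)) * (cellLength α n p)⁻¹ *
        ((if p = u then extend f p - extend f (p + 1) else 0) +
          if p + 1 = u then extend f (p + 1) - extend f p else 0) := by
  rw [← sum_cells n fun p => (∏ k ∈ Finset.range n, energyWeight α (ω k)) * (cellLength α n p)⁻¹ *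
        ((if p = u then extend f p - extend f (p + 1) else 0) +
          if p + 1 = u then extend f (p + 1) - extend f p else 0)]
  simp only [latticeEnergy, Finset.sum_mul]
  rw [Finset.sum_comm]
  refine Finset.sum_congr rfl fun j _ => ?_
  simp only [mul_assoc, ← Finset.mul_sum]
  rw [prod_energyWeight]
  congr 2
  have e0 : extend f (finFunctionFinEquiv j) = f (finFunctionFinEquiv j).castSucc :=
    extend_val f (finFunctionFinEquiv j).castSucc
  have e1 : extend f (finFunctionFinEquiv j + 1) = f (finFunctionFinEquiv j).succ :=
    extend_val f (finFunctionFinEquiv j).succ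
  have c0 : (finFunctionFinEquiv j).castSucc = u ↔ ((finFunctionFinEquiv j : Fin (2 ^ n)) : ℕ) = u :=
    Fin.ext_iff
  have c1 : (finFunctionFinEquiv j).succ = u ↔ ((finFunctionFinEquiv j : Fin (2 ^ n)) : ℕ) + 1 = u := by
    rw [Fin.ext_iff, Fin.val_succ]
  simp only [Fin.sum_univ_two, vertex, if_true, one_ne_zero, if_false, cellLaplacian,
    Matrix.of_apply, Matrix.cons_val_zero, Matrix.cons_val_one, Matrix.cons_val', ite_and,
    Matrix.cons_val_fin_one, c0, c1, e0, e1, add_mul, Finset.sum_add_distrib, ite_mul, zero_mul]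
  split_ifs <;> simp <;> ring

end

lemma energyWeight_pos {α : ℝ} (h0 : 0 < α) (h1 : α < 1) (i : Fin 2) : 0 < energyWeight α i := by
  fin_cases i
  · simpa [energyWeight]
  · simpa [energyWeight]

/-- The mass weights are inverse to the energy weights up to a constant. This is why ω cancels:
energy and mass of a cell get the same coefficient. -/
lemma measureWeight_eq {α : ℝ} (h0 : 0 < α) (h1 : α < 1) (i : Fin 2) : measureWeight α i = α * (1 - α) * (energyWeight α i)⁻¹ := by
  have : 1 - α ≠ 0 := by linarith
  fin_cases i
  · simp [measureWeight, energyWeight]; field_simp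
  · simp [measureWeight, energyWeight]; field_simp

lemma prod_measureWeight_inv {α : ℝ} (h0 : 0 < α) (h1 : α < 1) (ω : ℕ → Fin 2) (n : ℕ) :
    (∏ k ∈ Finset.range n, measureWeight α (ω k))⁻¹ =
      (∏ k ∈ Finset.range n, energyWeight α (ω k)) * ((α * (1 - α)) ^ n)⁻¹ := by
  simp only [measureWeight_eq h0 h1, Finset.prod_mul_distrib, Finset.prod_const, Finset.card_range,
    Finset.prod_inv_distrib, mul_inv, inv_inv, mul_pow]
  rw [mul_comm]

lemma mul_latticeMass {α : ℝ} (h0 : 0 < α) (h1 : α < 1) (b : Fin 2 → ℝ) (ω : ℕ → Fin 2) (n : ℕ)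
    (y : ℝ) (u : Fin (2 ^ n + 1)) :
    latticeMass α b ω n u * y = ∑ p ∈ Finset.range (2 ^ n),
      (∏ k ∈ Finset.range n, energyWeight α (ω k)) * (cellLength α n p)⁻¹ *
        ((if p = u then b 0 * y else 0) + if p + 1 = u then b 1 * y else 0) := by
  rw [← sum_cells n fun p => (∏ k ∈ Finset.range n, energyWeight α (ω k)) * (cellLength α n p)⁻¹ *
        ((if p = u then b 0 * y else 0) + if p + 1 = u then b 1 * y else 0)]
  simp only [latticeMass, Finset.sum_mul]
  refine Finset.sum_congr rfl fun j _ => ?_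
  have e1 : (∏ k ∈ Finset.range n, measureWeight α (ω k))⁻¹ * ∏ k, measureWeight α (j k) =
      (∏ k ∈ Finset.range n, energyWeight α (ω k)) * (cellLength α n (finFunctionFinEquiv j))⁻¹ := by
    have : α * (1 - α) ≠ 0 := (mul_pos h0 (by linarith)).ne'
    rw [prod_measureWeight_inv h0 h1 ω n, ← prod_energyWeight]
    simp only [measureWeight_eq h0 h1, Finset.prod_mul_distrib, Finset.prod_const, Finset.card_univ,
      Fintype.card_fin, Finset.prod_inv_distrib]
    rw [mul_assoc, ← mul_pow, inv_mul_cancel_left₀ (pow_ne_zero _ this)]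
  rw [e1, mul_assoc]
  congr 1
  have c0 : (finFunctionFinEquiv j).castSucc = u ↔ ((finFunctionFinEquiv j : Fin (2 ^ n)) : ℕ) = u :=
    Fin.ext_iff
  have c1 : (finFunctionFinEquiv j).succ = u ↔ ((finFunctionFinEquiv j : Fin (2 ^ n)) : ℕ) + 1 = u := by
    rw [Fin.ext_iff, Fin.val_succ]
  simp only [Fin.sum_univ_two, vertex, if_true, one_ne_zero, if_false, c0, c1, add_mul, ite_mul,
    zero_mul]

lemma latticeMass_pos {α : ℝ} (h0 : 0 < α) (h1 : α < 1) (ω : ℕ → Fin 2) (n : ℕ)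
    {b : Fin 2 → ℝ} (hb : ∀ i, 0 < b i) (u : Fin (2 ^ n + 1)) :
    0 < latticeMass α b ω n u := by
  have h2 := mul_latticeMass h0 h1 b ω n 1 u
  simp only [mul_one] at h2
  have hK : 0 < ∏ k ∈ Finset.range n, energyWeight α (ω k) :=
    Finset.prod_pos fun k _ => energyWeight_pos h0 h1 _
  have hnn : ∀ p, 0 ≤ (if p = (u : ℕ) then b 0 else 0) + if p + 1 = u then b 1 else 0 := fun p => by
    have := (hb 0).le
    have := (hb 1).le
    split_ifs <;> linarith
  rw [h2]
  refine Finset.sum_pos' (fun p _ => ?_) ?_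
  · have := cellLength_pos h0 h1 n p
    exact mul_nonneg (by positivity) (hnn p)
  · obtain ⟨p, hp, hpu⟩ : ∃ p < 2 ^ n, p = (u : ℕ) ∨ p + 1 = u := by
      have hu := u.isLt
      rcases Nat.eq_zero_or_pos (u : ℕ) with h | h
      · exact ⟨0, by positivity, Or.inl h.symm⟩
      · exact ⟨u - 1, by omega, Or.inr (by omega)⟩
    refine ⟨p, Finset.mem_range.2 hp, ?_⟩
    have := cellLength_pos h0 h1 n p
    refine mul_pos (by positivity) ?_
    have h3 := hb 0
    have h4 := hb 1
    rcases hpu with h | h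
    · rw [if_pos h]; split_ifs <;> linarith
    · rw [if_pos h]; split_ifs <;> linarith

lemma sum_range_ite_cells (N : ℕ) (w X Y : ℕ → ℝ) {u : ℕ} (hu : u ≤ N) :
    ∑ p ∈ Finset.range N, (w p)⁻¹ * ((if p = u then X p else 0) + if p + 1 = u then Y p else 0) =
      (if u < N then X u / w u else 0) + if 0 < u then Y (u - 1) / w (u - 1) else 0 := by
  simp only [mul_add, mul_ite, mul_zero, Finset.sum_add_distrib]
  congr 1
  · rw [Finset.sum_ite_eq']
    simp only [Finset.mem_range]
    split_ifs
    · ring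
    · rfl
  · rcases u with _ | u
    · simp
    · simp only [add_left_inj, Finset.sum_ite_eq', Finset.mem_range, Nat.succ_pos, if_true,
        Nat.add_sub_cancel]
      rw [if_pos (by omega)]
      ring

/-- After multiplication by the vertex mass, the energy and mass terms share the factor ∏ α_ω /
length of the cell. The ω-part is divided out and leaves the local equation of the chain. -/
lemma latticeNeumann_eq_iff {α : ℝ} (h0 : 0 < α) (h1 : α < 1) (ω : ℕ → Fin 2)
    (n : ℕ) {b : Fin 2 → ℝ} (hb : ∀ i, 0 < b i) (x : ℝ) (f : Fin (2 ^ n + 1) → ℝ)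
    (u : Fin (2 ^ n + 1)) :
    ∑ v, latticeNeumann α b ω n u v * f v = x * f u ↔
      chainResidual b (cellLength α n) (2 ^ n) x (extend f) u = 0 := by
  have hm := latticeMass_pos h0 h1 ω n hb u
  have hK : 0 < ∏ k ∈ Finset.range n, energyWeight α (ω k) :=
    Finset.prod_pos fun k _ => energyWeight_pos h0 h1 _
  have e1 : ∑ v, latticeNeumann α b ω n u v * f v =
      -(latticeMass α b ω n u)⁻¹ * ∑ v, latticeEnergy α ω n u v * f v := by
    simp only [latticeNeumann, Finset.mul_sum, mul_assoc]
  have e2 : (∑ v, latticeEnergy α ω n u v * f v) + latticeMass α b ω n u * (x * f u) =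
      (∏ k ∈ Finset.range n, energyWeight α (ω k)) *
        chainResidual b (cellLength α n) (2 ^ n) x (extend f) u := by
    rw [sum_latticeEnergy, mul_latticeMass h0 h1, ← Finset.sum_add_distrib, chainResidual,
      ← extend_val f u]
    have h3 := sum_range_ite_cells (2 ^ n) (cellLength α n)
      (fun p => (1 + x * b 0) * extend f p - extend f (p + 1))
      (fun p => (1 + x * b 1) * extend f (p + 1) - extend f p) (u := u) (by omega)
    have h4 : (if 0 < (u : ℕ) then ((1 + x * b 1) * extend f (u - 1 + 1) - extend f (u - 1)) /
        cellLength α n (u - 1) else 0) = if 0 < (u : ℕ) then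
          ((1 + x * b 1) * extend f u - extend f (u - 1)) / cellLength α n (u - 1) else 0 := by
      split_ifs with h
      · rw [Nat.sub_add_cancel h]
      · rfl
    rw [h4] at h3
    rw [← h3, Finset.mul_sum]
    refine Finset.sum_congr rfl fun p _ => ?_
    rw [← mul_add, mul_assoc]
    congr 2
    by_cases hp : p = u
    · by_cases hp' : p + 1 = u
      · omega
      · simp only [hp, if_true]; simp; ring
    · by_cases hp' : p + 1 = u
      · simp only [hp, hp', if_true, if_false]; ring
      · simp [hp, hp']
  rw [e1]
  constructor
  · intro h
    have h5 : ∑ v, latticeEnergy α ω n u v * f v = -(latticeMass α b ω n u * (x * f u)) := by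
      rw [← h]; field_simp
    rw [h5, neg_add_cancel] at e2
    exact (mul_eq_zero.1 e2.symm).resolve_left hK.ne'
  · intro h
    rw [h, mul_zero] at e2
    have h5 : ∑ v, latticeEnergy α ω n u v * f v = -(latticeMass α b ω n u * (x * f u)) := by
      linarith
    rw [h5]; field_simp

/-! ### Solutions along the chain -/

section

variable {b : Fin 2 → ℝ} {w : ℕ → ℝ} {x : ℝ}

/-- The value at the vertex `k` of the solution with given Cauchy data. -/
def chainSol (b : Fin 2 → ℝ) (w : ℕ → ℝ) (x : ℝ) (u p : ℝ) (k : ℕ) : ℝ :=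
  (((latticeTransfer b x).chain w k).fst u p).re

lemma latticeTransfer_isReal (b : Fin 2 → ℝ) (x : ℝ) : (latticeTransfer b x).IsReal :=
  ⟨1 + x * b 0, 1, (1 + x * b 0) * (1 + x * b 1) - 1, 1 + x * b 1, by simp [latticeTransfer]⟩

lemma chainSol_ofReal (u p : ℝ) (k : ℕ) :
    (chainSol b w x u p k : ℂ) = ((latticeTransfer b x).chain w k).fst u p := by
  obtain ⟨a, c, d, e, h⟩ := (latticeTransfer_isReal b x).chain w k
  rw [chainSol, h]
  simp [fst]

lemma chain_succ_fst (u p : ℂ) (k : ℕ) :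
    ((latticeTransfer b x).chain w (k + 1)).fst u p =
      (1 + x * b 0) * ((latticeTransfer b x).chain w k).fst u p +
        w k * ((latticeTransfer b x).chain w k).snd u p := by
  rw [chain, comp_fst, scale_fst]
  simp [fst, latticeTransfer]

lemma chain_succ_snd (hw : ∀ k, 0 < w k) (u p : ℂ) (k : ℕ) :
    ((latticeTransfer b x).chain w (k + 1)).snd u p =
      ((1 + x * b 1) * ((latticeTransfer b x).chain w (k + 1)).fst u p -
        ((latticeTransfer b x).chain w k).fst u p) / w k := by
  have : (w k : ℂ) ≠ 0 := by exact_mod_cast (hw k).ne'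
  rw [chain_succ_fst, chain, comp_snd, scale_snd (hw k)]
  congr 1
  simp only [snd, latticeTransfer]
  ring

lemma chainResidual_chainSol (hw : ∀ k, 0 < w k) (N : ℕ) (u p : ℝ) {k : ℕ} (hk : 0 < k)
    (hkN : k < N) : chainResidual b w N x (chainSol b w x u p) k = 0 := by
  obtain ⟨k, rfl⟩ := Nat.exists_eq_succ_of_ne_zero hk.ne'
  have h1 := chain_succ_fst (b := b) (x := x) (w := w) u p (k + 1)
  have h2 := chain_succ_snd (b := b) (x := x) hw u p k
  have e1 : (w (k + 1) : ℂ) ≠ 0 := by exact_mod_cast (hw _).ne'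
  rw [← chainSol_ofReal, ← chainSol_ofReal] at h1 h2
  rw [chainResidual, if_pos hkN, if_pos hk]
  simp only [Nat.succ_eq_add_one, Nat.add_sub_cancel]
  rw [← Complex.ofReal_inj]
  push_cast
  rw [← h2, h1]
  field_simp
  ring

/-- At the left end the equation is the Neumann condition p = 0. -/
lemma chainResidual_zero {N : ℕ} (hN : 0 < N) (hw : ∀ k, 0 < w k) (u p : ℝ) :
    chainResidual b w N x (chainSol b w x u p) 0 = -p := by
  have h1 := chain_succ_fst (b := b) (x := x) (w := w) u p 0
  have e1 : (w 0 : ℂ) ≠ 0 := by exact_mod_cast (hw _).ne'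
  rw [← chainSol_ofReal, ← chainSol_ofReal] at h1
  rw [chainResidual, if_pos hN, if_neg (lt_irrefl _), ← Complex.ofReal_inj]
  push_cast
  rw [h1]
  simp only [chain, snd, one]
  field_simp
  ring

/-- At the right end the equation is the vanishing of the outgoing derivative, which for data (1,0)
is the entry c. -/
lemma chainResidual_last {N : ℕ} (hN : 0 < N) (hw : ∀ k, 0 < w k) (u p : ℝ) :
    (chainResidual b w N x (chainSol b w x u p) N : ℂ) =
      ((latticeTransfer b x).chain w N).snd u p := by
  obtain ⟨k, rfl⟩ := Nat.exists_eq_succ_of_ne_zero hN.ne'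
  rw [Nat.succ_eq_add_one, chain_succ_snd hw, chainResidual, if_neg (lt_irrefl _), if_pos hN,
    ← chainSol_ofReal, ← chainSol_ofReal]
  simp

/-- A function that satisfies the equation at the inner vertices is determined by its Cauchy
data. -/
lemma eq_chainSol (hw : ∀ k, 0 < w k) {N : ℕ} {F : ℕ → ℝ}
    (hF : ∀ k, 0 < k → k < N → chainResidual b w N x F k = 0) {k : ℕ} (hk : k ≤ N) :
    F k = chainSol b w x (F 0) ((F 1 - (1 + x * b 0) * F 0) / w 0) k := by
  set p := (F 1 - (1 + x * b 0) * F 0) / w 0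
  set S := chainSol b w x (F 0) p
  have hS0 : S 0 = F 0 := by simp [S, chainSol, chain, one, fst]
  induction k using Nat.strong_induction_on with
  | _ k ih =>
    rcases k with _ | _ | k
    · exact hS0.symm
    · have h1 := chain_succ_fst (b := b) (x := x) (w := w) (F 0) p 0
      rw [← chainSol_ofReal, ← chainSol_ofReal] at h1
      simp only [chain, snd, one, zero_mul, one_mul, zero_add] at h1
      change ((S 1 : ℝ) : ℂ) = (1 + x * b 0) * (S 0 : ℝ) + w 0 * p at h1
      have h2 : S 1 = (1 + x * b 0) * S 0 + w 0 * p := by exact_mod_cast h1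
      rw [h2, hS0, mul_div_cancel₀ _ (hw 0).ne']
      ring
    · have h1 := hF (k + 1) (by omega) (by omega)
      have h2 : chainResidual b w N x S (k + 1) = 0 :=
        chainResidual_chainSol hw N _ _ (by omega) (by omega)
      rw [chainResidual, if_pos (by omega), if_pos (by omega), Nat.add_sub_cancel] at h1 h2
      rw [ih k (by omega) (by omega), ih (k + 1) (by omega) (by omega)] at h1
      have h3 : ((1 + x * b 0) * S (k + 1) - F (k + 1 + 1)) / w (k + 1) =
        ((1 + x * b 0) * S (k + 1) - S (k + 1 + 1)) / w (k + 1) := by linarith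
      rw [div_left_inj' (hw _).ne'] at h3
      linarith

end

/-- A boundary condition at the left end leaves one free Cauchy datum, so multiplicities are 0 or 1.
P is the condition at the right end, that is, the vanishing of a matrix entry. -/
lemma finrank_eq_ite {V : Type*} [AddCommGroup V] [Module ℝ V] {S : Submodule ℝ V} {P : Prop}
    [Decidable P] {v : V} (h1 : P → v ∈ S ∧ v ≠ 0) (h2 : ∀ s ∈ S, ∃ c : ℝ, s = c • v)
    (h3 : ¬P → ∀ s ∈ S, s = 0) : Module.finrank ℝ S = if P then 1 else 0 := by
  split_ifs with h
  · have : S = Submodule.span ℝ {v} := by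
      refine le_antisymm (fun s hs => ?_) ?_
      · obtain ⟨c, rfl⟩ := h2 s hs
        exact Submodule.smul_mem _ _ (Submodule.mem_span_singleton_self v)
      · rw [Submodule.span_singleton_le_iff_mem]
        exact (h1 h).1
    rw [this, finrank_span_singleton (h1 h).2]
  · have : S = ⊥ := (Submodule.eq_bot_iff S).2 (h3 h)
    rw [this, finrank_bot]

/-- The left equation forces data proportional to (1,0), the inner equations propagate them, and the
right equation then reads cₙ = 0. -/
lemma latticeNuNeumann_eq {α : ℝ} (h0 : 0 < α) (h1 : α < 1) {b : Fin 2 → ℝ} (hb : ∀ i, 0 < b i)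
    (ω : ℕ → Fin 2) (n : ℕ) :
    latticeNuNeumann α b ω n = zeroMeasure fun x => ((double α)^[n] (latticeTransfer b x)).c := by
  classical
  rw [latticeNuNeumann, zeroMeasure]
  congr 1
  ext x
  have hw := cellLength_pos h0 h1 n
  have hN : 0 < 2 ^ n := by positivity
  let S : ℕ → ℝ := chainSol b (cellLength α n) x 1 0
  have hmem : ∀ f : Fin (2 ^ n + 1) → ℝ,
      f ∈ Module.End.eigenspace (Matrix.toLin' (latticeNeumann α b ω n)) x ↔
        ∀ k ≤ 2 ^ n, chainResidual b (cellLength α n) (2 ^ n) x (extend f) k = 0 := by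
    intro f
    rw [Module.End.mem_eigenspace_iff, Matrix.toLin'_apply, funext_iff]
    constructor
    · intro h k hk
      exact (latticeNeumann_eq_iff h0 h1 ω n hb x f ⟨k, by omega⟩).1 (h ⟨k, by omega⟩)
    · intro h u
      exact (latticeNeumann_eq_iff h0 h1 ω n hb x f u).2 (h u (by omega))
  have hsol : ∀ f : Fin (2 ^ n + 1) → ℝ, (∀ k ≤ 2 ^ n,
      chainResidual b (cellLength α n) (2 ^ n) x (extend f) k = 0) →
      ∀ k ≤ 2 ^ n, extend f k = extend f 0 * S k := by
    intro f hf k hk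
    have e0 := hf 0 (by omega)
    rw [chainResidual, if_pos hN, if_neg (lt_irrefl _), add_zero, div_eq_zero_iff] at e0
    have e1 := e0.resolve_right (hw 0).ne'
    have e2 := eq_chainSol (b := b) (x := x) hw (fun k _ hk' => hf k hk'.le) hk
    rw [zero_add] at e1
    have e3 : extend f 1 - (1 + x * b 0) * extend f 0 = 0 := by linarith
    rw [e3, zero_div] at e2
    rw [e2, ← Complex.ofReal_inj]
    push_cast
    rw [chainSol_ofReal, chainSol_ofReal]
    simp [fst, mul_comm]
  have hc : ((double α)^[n] (latticeTransfer b x)).c = 0 ↔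
      chainResidual b (cellLength α n) (2 ^ n) x S (2 ^ n) = 0 := by
    rw [← Complex.ofReal_inj, chainResidual_last hN hw, chain_cellLength h0 h1]
    simp [snd]
  have hext : ∀ k ≤ 2 ^ n, extend (fun u : Fin (2 ^ n + 1) => S u) k = S k := by
    intro k hk
    simp [extend, show k < 2 ^ n + 1 by omega]
  have hres : ∀ {F G : ℕ → ℝ}, (∀ k ≤ 2 ^ n, F k = G k) → ∀ k ≤ 2 ^ n,
      chainResidual b (cellLength α n) (2 ^ n) x F k =
        chainResidual b (cellLength α n) (2 ^ n) x G k := by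
    intro F G h k hk
    rw [chainResidual, chainResidual, h k hk, h (k - 1) (by omega)]
    congr 1
    split_ifs with h'
    · rw [h (k + 1) (by omega)]
    · rfl
  have hS0 : S 0 = 1 := by simp [S, chainSol, chain, one, fst]
  refine finrank_eq_ite (v := fun u : Fin (2 ^ n + 1) => S u) (fun hP => ⟨?_, ?_⟩) (fun f hf => ?_)
    fun hP f hf => ?_
  · rw [hmem]
    intro k hk
    rw [hres hext k hk]
    rcases Nat.eq_zero_or_pos k with rfl | hk0
    · rw [chainResidual_zero hN hw, neg_zero]
    · rcases hk.eq_or_lt with rfl | hk'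
      · exact hc.1 hP
      · exact chainResidual_chainSol hw _ _ _ hk0 hk'
  · intro h
    have := congrFun h 0
    simp [hS0] at this
  · refine ⟨extend f 0, funext fun u => ?_⟩
    rw [← extend_val f u, hsol f ((hmem f).1 hf) u (by omega)]
    rfl
  · have hf' := (hmem f).1 hf
    have e1 := hsol f hf'
    have e2 := hf' _ le_rfl
    rw [hres e1 _ le_rfl] at e2
    have e3 : chainResidual b (cellLength α n) (2 ^ n) x (fun k => extend f 0 * S k) (2 ^ n) =
        extend f 0 * chainResidual b (cellLength α n) (2 ^ n) x S (2 ^ n) := by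
      simp only [chainResidual, lt_irrefl, if_false, hN, if_true]
      ring
    rw [e3] at e2
    have e4 := (mul_eq_zero.1 e2).resolve_right fun h => hP (hc.2 h)
    ext u
    rw [← extend_val f u, e1 u (by omega), e4, zero_mul]
    rfl

/-- The extension by `0` of a function on the inner vertices. -/
def innerExtend {N : ℕ} (f : {u : Fin (N + 1) // u ≠ 0 ∧ u ≠ Fin.last N} → ℝ) (u : Fin (N + 1)) : ℝ :=
  if h : u ≠ 0 ∧ u ≠ Fin.last N then f ⟨u, h⟩ else 0

lemma innerExtend_val {N : ℕ} (f : {u : Fin (N + 1) // u ≠ 0 ∧ u ≠ Fin.last N} → ℝ)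
    (u : {u : Fin (N + 1) // u ≠ 0 ∧ u ≠ Fin.last N}) : innerExtend f u.1 = f u := by
  simp only [innerExtend, dif_pos u.2]

lemma extend_innerExtend_ends {N : ℕ} (f : {u : Fin (N + 1) // u ≠ 0 ∧ u ≠ Fin.last N} → ℝ) :
    extend (innerExtend f) 0 = 0 ∧ extend (innerExtend f) N = 0 := by
  constructor
  · have := extend_val (innerExtend f) 0
    simpa [innerExtend] using this
  · have := extend_val (innerExtend f) (Fin.last N)
    simpa [innerExtend] using this

lemma sum_inner {N : ℕ} (f : {u : Fin (N + 1) // u ≠ 0 ∧ u ≠ Fin.last N} → ℝ)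
    (g : Fin (N + 1) → ℝ) : ∑ v : {u : Fin (N + 1) // u ≠ 0 ∧ u ≠ Fin.last N}, g v.1 * f v =
      ∑ v, g v * innerExtend f v := by
  rw [← Finset.sum_subset (Finset.filter_subset (fun u => u ≠ 0 ∧ u ≠ Fin.last N) Finset.univ)]
  · rw [Finset.sum_subtype (p := fun u => u ≠ 0 ∧ u ≠ Fin.last N) _ (by simp)]
    exact Finset.sum_congr rfl fun v _ => by rw [innerExtend_val]
  · intro v _ hv
    have : ¬(v ≠ 0 ∧ v ≠ Fin.last N) := by simpa using hv
    simp only [innerExtend, dif_neg this, mul_zero]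

lemma inner_ne {N k : ℕ} (hk : 0 < k) (hk' : k < N) :
    (⟨k, by omega⟩ : Fin (N + 1)) ≠ 0 ∧ (⟨k, by omega⟩ : Fin (N + 1)) ≠ Fin.last N := by
  rw [Ne, Ne, Fin.ext_iff, Fin.ext_iff]
  simp only [Fin.val_zero, Fin.val_last]
  omega

lemma inner_val {N : ℕ} (u : {u : Fin (N + 1) // u ≠ 0 ∧ u ≠ Fin.last N}) :
    0 < (u.1 : ℕ) ∧ (u.1 : ℕ) < N := by
  have h1 := u.2.1
  have h2 := u.2.2
  rw [Ne, Fin.ext_iff, Fin.val_zero] at h1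
  rw [Ne, Fin.ext_iff, Fin.val_last] at h2
  omega

/-- An eigenvector, extended by 0 to the ends, has data proportional to (0,1); vanishing at the
right end is bₙ = 0. -/
lemma latticeNuDirichlet_eq {α : ℝ} (h0 : 0 < α) (h1 : α < 1) {b : Fin 2 → ℝ} (hb : ∀ i, 0 < b i)
    (ω : ℕ → Fin 2) (n : ℕ) :
    latticeNuDirichlet α b ω n = zeroMeasure fun x => ((double α)^[n] (latticeTransfer b x)).b := by
  classical
  rw [latticeNuDirichlet, zeroMeasure]
  congr 1
  ext x
  have hw := cellLength_pos h0 h1 n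
  have hN : 0 < 2 ^ n := by positivity
  let S : ℕ → ℝ := chainSol b (cellLength α n) x 0 1
  have hsub : ∀ f u, (latticeDirichlet α b ω n).mulVec f u =
      ∑ v, latticeNeumann α b ω n u.1 v * innerExtend f v := fun f u =>
    sum_inner f (latticeNeumann α b ω n u.1)
  have hmem : ∀ f, f ∈ Module.End.eigenspace (Matrix.toLin' (latticeDirichlet α b ω n)) x ↔
        ∀ k, 0 < k → k < 2 ^ n → chainResidual b (cellLength α n) (2 ^ n) x (extend (innerExtend f)) k = 0 := by
    intro f
    rw [Module.End.mem_eigenspace_iff, Matrix.toLin'_apply, funext_iff]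
    constructor
    · intro h k hk hk'
      refine (latticeNeumann_eq_iff h0 h1 ω n hb x (innerExtend f) ⟨k, by omega⟩).1 ?_
      have := h ⟨⟨k, by omega⟩, inner_ne hk hk'⟩
      rw [hsub] at this
      rw [this, Pi.smul_apply, ← innerExtend_val f, smul_eq_mul]
    · intro h u
      rw [hsub, Pi.smul_apply, ← innerExtend_val f, smul_eq_mul]
      obtain ⟨hu0, hu1⟩ := inner_val u
      exact (latticeNeumann_eq_iff h0 h1 ω n hb x (innerExtend f) u).2 (h u hu0 hu1)
  have hsol : ∀ f : {u : Fin (2 ^ n + 1) // u ≠ 0 ∧ u ≠ Fin.last (2 ^ n)} → ℝ, (∀ k, 0 < k → k < 2 ^ n →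
      chainResidual b (cellLength α n) (2 ^ n) x (extend (innerExtend f)) k = 0) →
      ∀ k ≤ 2 ^ n, extend (innerExtend f) k = extend (innerExtend f) 1 / cellLength α n 0 * S k := by
    intro f hf k hk
    have e2 := eq_chainSol (b := b) (x := x) hw hf hk
    rw [(extend_innerExtend_ends f).1, mul_zero, sub_zero] at e2
    rw [e2, ← Complex.ofReal_inj, Complex.ofReal_mul, chainSol_ofReal, chainSol_ofReal]
    simp [fst, mul_comm]
  have hB : ((double α)^[n] (latticeTransfer b x)).b = 0 ↔ S (2 ^ n) = 0 := by
    rw [← Complex.ofReal_inj, chainSol_ofReal, chain_cellLength h0 h1]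
    simp [fst]
  have hS0 : S 0 = 0 := by simp [S, chainSol, chain, one, fst]
  have hS1 : S 1 = cellLength α n 0 := by
    rw [← Complex.ofReal_inj, chainSol_ofReal, chain_succ_fst]
    simp [chain, one, fst, snd]
  refine finrank_eq_ite (v := fun u => S (u.1 : ℕ)) (fun hP => ⟨?_, ?_⟩) (fun f hf => ?_)
    fun hP f hf => ?_
  · have hext : ∀ k ≤ 2 ^ n, extend (N := 2 ^ n) (innerExtend fun u => S (u.1 : ℕ)) k = S k := by
      intro k hk
      rcases Nat.eq_zero_or_pos k with rfl | hk0
      · rw [(extend_innerExtend_ends _).1, hS0]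
      · rcases hk.eq_or_lt with rfl | hk'
        · rw [(extend_innerExtend_ends _).2, hB.1 hP]
        · have := innerExtend_val (N := 2 ^ n) (fun u => S (u.1 : ℕ)) ⟨⟨k, by omega⟩, inner_ne hk0 hk'⟩
          simp only [extend, dif_pos (show k < 2 ^ n + 1 by omega), this]
    rw [hmem]
    intro k hk hk'
    have := chainResidual_chainSol (b := b) (x := x) hw (2 ^ n) 0 1 hk hk'
    rw [chainResidual] at this ⊢
    rw [hext k hk'.le, hext (k + 1) hk', hext (k - 1) (by omega)]
    exact this
  -- At level 0 there is no inner vertex, but then b is the length of the single cell and does not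
  -- vanish.
  · have h1n : 1 < 2 ^ n := by
      by_contra h
      have : 2 ^ n = 1 := by omega
      have h2 := hB.1 hP
      rw [this, hS1] at h2
      exact (hw 0).ne' h2
    intro h
    have h2 : S 1 = 0 := congrFun h ⟨⟨1, by omega⟩, inner_ne one_pos h1n⟩
    rw [hS1] at h2
    exact (hw 0).ne' h2
  · refine ⟨extend (innerExtend f) 1 / cellLength α n 0, funext fun u => ?_⟩
    rw [← innerExtend_val f u, ← extend_val (innerExtend f) u, hsol f ((hmem f).1 hf) u (by omega)]
    rfl
  · have e1 := hsol f ((hmem f).1 hf)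
    have e2 := e1 _ le_rfl
    rw [(extend_innerExtend_ends f).2] at e2
    have e3 := (mul_eq_zero.1 e2.symm).resolve_right fun h => hP (hB.2 h)
    ext u
    rw [← innerExtend_val f u, ← extend_val (innerExtend f) u, e1 u (by omega), e3, zero_mul]
    rfl

/-- The lattice case. -/
theorem lattice_densityOfStates {α : ℝ} (h0 : 0 < α) (h1 : α < 1) {b : Fin 2 → ℝ}
    (hb : ∀ i, 0 < b i) : ∃ μ : Measure ℝ,
      (∀ ω : ℕ → Fin 2, IsDensityOfStates (latticeNuNeumann α b ω) (latticeNuDirichlet α b ω) μ) ∧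
      IsLaplacianMeasureOn Set.univ (fun x => Ghat α (latticePhi b x))
        (μ.map (fun x : ℝ => (x : ℂ))) := by
  have h := isTransferFamily_lattice hb
  obtain ⟨μ, hμ, hL⟩ := h.exists_densityOfStates h0 h1
  -- `latticePhi b z` is definitionally the vector (a,d,-1) of the cell, whose entry b is 1.
  refine ⟨μ, fun ω => ?_, ?_, ?_, fun ψ hs hc _ => hL ψ ⟨hs, hc⟩⟩
  · have e1 := funext (latticeNuNeumann_eq h0 h1 hb ω)
    have e2 := funext (latticeNuDirichlet_eq h0 h1 hb ω)
    rwa [e1, e2]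
  · refine Eventually.of_forall fun z => ?_
    have := tendsto_greenSeq h0 h1 (z := latticePhi b z) (by simp [latticePhi])
    exact ⟨this.1, this.2.1⟩
  · exact (h.locallyIntegrable_green h0 h1).locallyIntegrableOn _

/-! ### Existence of the self-similar measure -/

/-- One step of the iteration for the quantile function of the self-similar measure. -/
def quantileStep (α : ℝ) (g : ℝ → ℝ) (t : ℝ) : ℝ :=
  if t < 1 - α then α * g (t / (1 - α)) else α + (1 - α) * g ((t - (1 - α)) / α)

/-- Approximations of the quantile function of the self-similar measure. -/
def quantileApprox (α : ℝ) (n : ℕ) : ℝ → ℝ := (quantileStep α)^[n] 0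

lemma quantileApprox_succ (α : ℝ) (n : ℕ) :
    quantileApprox α (n + 1) = quantileStep α (quantileApprox α n) :=
  Function.iterate_succ_apply' _ _ _

lemma measurable_quantileApprox (α : ℝ) (n : ℕ) : Measurable (quantileApprox α n) := by
  induction n with
  | zero => exact measurable_zero
  | succ n ih =>
    rw [quantileApprox_succ]
    refine Measurable.ite (measurableSet_lt measurable_id measurable_const) ?_ ?_
    · exact (ih.comp (measurable_id.div_const _)).const_mul _
    · exact ((ih.comp ((measurable_id.sub_const _).div_const _)).const_mul _).const_add _

lemma quantileApprox_mem {α : ℝ} (h0 : 0 < α) (h1 : α < 1) (n : ℕ) (t : ℝ) :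
    quantileApprox α n t ∈ Set.Icc (0 : ℝ) 1 := by
  induction n generalizing t with
  | zero => simp [quantileApprox]
  | succ n ih =>
    rw [quantileApprox_succ, quantileStep]
    split_ifs
    · have := ih (t / (1 - α))
      exact ⟨by have := this.1; positivity, by nlinarith [this.2, this.1]⟩
    · have := ih ((t - (1 - α)) / α)
      exact ⟨by nlinarith [this.1], by nlinarith [this.2]⟩

lemma abs_quantileApprox_sub_le {α : ℝ} (h0 : 0 < α) (h1 : α < 1) (n : ℕ) (t : ℝ) :
    |quantileApprox α (n + 1) t - quantileApprox α n t| ≤ max α (1 - α) ^ n := by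
  induction n generalizing t with
  | zero =>
    have := quantileApprox_mem h0 h1 1 t
    rw [pow_zero, abs_le]
    exact ⟨by simpa [quantileApprox] using neg_one_lt_zero.le.trans this.1,
      by simpa [quantileApprox] using this.2⟩
  | succ n ih =>
    rw [quantileApprox_succ _ (n + 1), congrFun (quantileApprox_succ α n) t, pow_succ']
    simp only [quantileStep]
    split_ifs
    · rw [← mul_sub, abs_mul, abs_of_pos h0]
      exact mul_le_mul (le_max_left _ _) (ih _) (abs_nonneg _) (le_max_of_le_left h0.le)
    · rw [add_sub_add_left_eq_sub, ← mul_sub, abs_mul, abs_of_pos (sub_pos.2 h1)]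
      exact mul_le_mul (le_max_right _ _) (ih _) (abs_nonneg _) (le_max_of_le_left h0.le)

/-- `quantileStep` contracts with ratio max α (1 - α), so its iterates converge. The break is at 1 -
α because the left cell has length α but mass 1 - α. -/
lemma exists_quantile {α : ℝ} (h0 : 0 < α) (h1 : α < 1) :
    ∃ g : ℝ → ℝ, Measurable g ∧ (∀ t, g t ∈ Set.Icc (0 : ℝ) 1) ∧ ∀ t, g t = quantileStep α g t := by
  have hlim : ∀ t, ∃ y, Tendsto (fun n => quantileApprox α n t) atTop (𝓝 y) := fun t => by
    refine cauchySeq_tendsto_of_complete (cauchySeq_of_le_geometric (max α (1 - α)) 1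
      (max_lt h1 (by linarith)) fun n => ?_)
    rw [dist_comm, Real.dist_eq, one_mul]
    exact abs_quantileApprox_sub_le h0 h1 n t
  choose g hg using hlim
  refine ⟨g, measurable_of_tendsto_metrizable (measurable_quantileApprox α) (tendsto_pi_nhds.2 hg),
    fun t => isClosed_Icc.mem_of_tendsto (hg t)
      (Eventually.of_forall fun n => quantileApprox_mem h0 h1 n t), fun t => ?_⟩
  refine tendsto_nhds_unique ((hg t).comp (tendsto_add_atTop_nat 1)) ?_
  simp only [Function.comp_def, quantileApprox_succ, quantileStep]
  split_ifs
  · exact (hg _).const_mul _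
  · exact ((hg _).const_mul _).const_add _

lemma volume_restrict_Ico_eq_map {c : ℝ} (hc : 0 < c) :
    volume.restrict (Set.Ico 0 c) =
      ENNReal.ofReal c • (volume.restrict (Set.Icc (0 : ℝ) 1)).map fun t => c * t := by
  conv_lhs => rw [← Real.smul_map_volume_mul_left hc.ne', abs_of_pos hc]
  rw [Measure.restrict_smul, Measure.restrict_map (measurable_const_mul c) measurableSet_Ico,
    ← Measure.restrict_congr_set Ico_ae_eq_Icc]
  congr 3
  ext t
  simp [hc, div_self hc.ne']

lemma volume_restrict_Icc_eq_map {c d : ℝ} (hc : 0 < c) :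
    volume.restrict (Set.Icc d (d + c)) =
      ENNReal.ofReal c • (volume.restrict (Set.Icc (0 : ℝ) 1)).map fun t => d + c * t := by
  have h : (volume.restrict (Set.Icc (0 : ℝ) 1)).map (fun t => d + c * t) =
      ((volume.restrict (Set.Icc (0 : ℝ) 1)).map fun t => c * t).map fun t => d + t := by
    rw [Measure.map_map (measurable_const_add d) (measurable_const_mul c)]; rfl
  rw [h, ← Measure.map_smul, ← volume_restrict_Ico_eq_map hc, Measure.restrict_congr_set Ico_ae_eq_Icc]
  conv_lhs => rw [← (measurePreserving_add_left volume d).map_eq]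
  rw [Measure.restrict_map (measurable_const_add d) measurableSet_Icc]
  congr 2
  ext t
  simp

/-- The self-similar measure exists. -/
theorem exists_isSelfSimilarMeasure {α : ℝ} (h0 : 0 < α) (h1 : α < 1) :
    ∃ m : Measure ℝ, IsSelfSimilarMeasure α m := by
  obtain ⟨g, hgm, hg01, hg⟩ := exists_quantile h0 h1
  have h1' : 0 < 1 - α := sub_pos.2 h1
  set ν : Measure ℝ := volume.restrict (Set.Icc (0 : ℝ) 1) with hν
  -- Lebesgue measure is cut at 1 - α into two affine images of itself; pushing each through g gives
  -- one summand of the self-similarity relation.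
  have hsplit : ν = volume.restrict (Set.Ico 0 (1 - α)) + volume.restrict (Set.Icc (1 - α) (1 - α + α)) := by
    rw [← Measure.restrict_union _ measurableSet_Icc]
    · rw [sub_add_cancel, Set.Ico_union_Icc_eq_Icc h1'.le (by linarith)]
    · exact Set.disjoint_left.2 fun t ht ht' => ht.2.not_ge ht'.1
  refine ⟨ν.map g, ?_, ?_, ?_⟩
  · have : IsProbabilityMeasure ν := ⟨by simp [hν]⟩
    exact Measure.isProbabilityMeasure_map hgm.aemeasurable
  · rw [Measure.map_apply hgm measurableSet_Icc.compl]
    have : g ⁻¹' (Set.Icc 0 1)ᶜ = ∅ := by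
      ext t; simpa using hg01 t
    rw [this, measure_empty]
  · conv_lhs => rw [hsplit]
    rw [Measure.map_add _ _ hgm, volume_restrict_Ico_eq_map h1', volume_restrict_Icc_eq_map h0,
      Measure.map_smul, Measure.map_smul, Measure.map_map hgm (by fun_prop),
      Measure.map_map hgm (by fun_prop), Measure.map_map (by fun_prop) hgm,
      Measure.map_map (by fun_prop) hgm]
    simp only [measureWeight, Matrix.cons_val_zero, Matrix.cons_val_one]
    congr 2
    -- The end point t = 1 is mapped to the break 1 - α, where `quantileStep` takes the other
    -- branch.
    · have : ∀ᵐ t ∂ν, t < 1 := by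
        rw [hν, ← Measure.restrict_congr_set (Ico_ae_eq_Icc (a := (0 : ℝ)) (b := 1))]
        filter_upwards [ae_restrict_mem measurableSet_Ico] with t ht using ht.2
      refine Measure.map_congr ?_
      filter_upwards [this] with t ht
      rw [Function.comp_apply, hg, quantileStep, if_pos (by nlinarith), mul_div_cancel_left₀ _ h1'.ne']
      rfl
    · refine Measure.map_congr ?_
      filter_upwards [ae_restrict_mem measurableSet_Icc] with t ht
      rw [Function.comp_apply, hg, quantileStep, if_neg (by nlinarith [ht.1]), add_sub_cancel_left,
        mul_div_cancel_left₀ _ h0.ne']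
      simp only [Function.comp_apply]
      ring

/-! ### Volterra series for the string equation -/

/-- The projection of `ℝ` to `[0, 1]`. -/
def clip (x : ℝ) : ℝ := max 0 (min x 1)

lemma clip_mem (x : ℝ) : clip x ∈ Set.Icc (0 : ℝ) 1 :=
  ⟨le_max_left _ _, max_le zero_le_one (min_le_right _ _)⟩

lemma clip_of_mem {x : ℝ} (hx : x ∈ Set.Icc (0 : ℝ) 1) : clip x = x := by
  rw [clip, min_eq_left hx.2, max_eq_right hx.1]

lemma continuous_clip : Continuous clip := by unfold clip; fun_prop

lemma ae_mem_Icc {m : Measure ℝ} (hm : m (Set.Icc 0 1)ᶜ = 0) : ∀ᵐ s ∂m, s ∈ Set.Icc (0 : ℝ) 1 := hm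

lemma Continuous.integrable_of_Icc {E : Type*} [NormedAddCommGroup E] {m : Measure ℝ}
    [IsFiniteMeasure m] (hm : m (Set.Icc 0 1)ᶜ = 0) {f : ℝ → E} (hf : Continuous f) :
    Integrable f m := by
  rw [← Measure.restrict_eq_self_of_ae_mem (ae_mem_Icc hm)]
  exact hf.continuousOn.integrableOn_compact isCompact_Icc

/-- This elementary inequality supplies the factor 1/(k+1) in each Volterra step. -/
lemma sub_mul_pow_le {s x : ℝ} (hs : 0 ≤ s) (hsx : s ≤ x) (k : ℕ) :
    (k + 1) * ((x - s) * s ^ k) ≤ x ^ (k + 1) - s ^ (k + 1) := by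
  induction k with
  | zero => simp
  | succ k ih =>
    have h1 : (k + 1) * ((x - s) * s ^ k) * s ≤ (k + 1) * ((x - s) * s ^ k) * x :=
      mul_le_mul_of_nonneg_left hsx (by have := sub_nonneg.2 hsx; positivity)
    have h2 := mul_le_mul_of_nonneg_right ih (hs.trans hsx)
    push_cast
    calc ((k : ℝ) + 1 + 1) * ((x - s) * s ^ (k + 1))
        = (k + 1) * ((x - s) * s ^ k) * s + (x - s) * s ^ (k + 1) := by ring
      _ ≤ (x ^ (k + 1) - s ^ (k + 1)) * x + (x - s) * s ^ (k + 1) := by linarith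
      _ = _ := by ring

/-- The bound holds pointwise under the integral, so m enters only through its total mass 1. No
density or absence of atoms is needed. -/
lemma norm_integral_kernel_le {E : Type*} [NormedAddCommGroup E] [NormedSpace ℝ E] {m : Measure ℝ}
    [IsProbabilityMeasure m] (hm : m (Set.Icc 0 1)ᶜ = 0) {v : ℝ → E} {C : ℝ} {k : ℕ} (hC : 0 ≤ C)
    (hv : ∀ s ∈ Set.Icc (0 : ℝ) 1, ‖v s‖ ≤ C * (s ^ k / k.factorial)) {x : ℝ} (hx : 0 ≤ x) :
    ‖∫ s, max (x - s) 0 • v s ∂m‖ ≤ C * (x ^ (k + 1) / (k + 1).factorial) := by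
  have h : ∀ᵐ s ∂m, ‖max (x - s) 0 • v s‖ ≤ C * (x ^ (k + 1) / (k + 1).factorial) := by
    filter_upwards [ae_mem_Icc hm] with s hs
    have hk : (0 : ℝ) < k.factorial := by positivity
    rw [norm_smul, Real.norm_of_nonneg (le_max_right _ _)]
    rcases le_total s x with hsx | hsx
    · rw [max_eq_left (sub_nonneg.2 hsx)]
      refine (mul_le_mul_of_nonneg_left (hv s hs) (sub_nonneg.2 hsx)).trans ?_
      rw [show (x - s) * (C * (s ^ k / k.factorial)) = C * ((x - s) * s ^ k / k.factorial) by ring]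
      refine mul_le_mul_of_nonneg_left ?_ hC
      rw [Nat.factorial_succ, Nat.cast_mul, Nat.cast_succ, div_le_div_iff₀ hk (by positivity)]
      have := sub_mul_pow_le hs.1 hsx k
      have h3 : 0 ≤ s ^ (k + 1) := pow_nonneg hs.1 _
      nlinarith
    · rw [max_eq_right (sub_nonpos.2 hsx), zero_mul]
      positivity
  simpa using norm_integral_le_of_norm_le_const h

/-- The Volterra operator of the string with mass distribution `m`. -/
def volterra (m : Measure ℝ) (f : ℝ → ℂ) (x : ℝ) : ℂ := ∫ s, max (clip x - s) 0 • f s ∂m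

lemma continuous_kernel_smul {E : Type*} [NormedAddCommGroup E] [NormedSpace ℝ E] {f : ℝ → E}
    (hf : Continuous f) (x : ℝ) : Continuous fun s => max (x - s) 0 • f s := by fun_prop

lemma continuous_volterra {m : Measure ℝ} [IsProbabilityMeasure m] (hm : m (Set.Icc 0 1)ᶜ = 0)
    {f : ℝ → ℂ} (hf : Continuous f) : Continuous (volterra m f) := by
  refine continuous_of_dominated (F := fun x s => max (clip x - s) 0 • f s) (bound := fun s => ‖f s‖)
    (fun x => (continuous_kernel_smul hf _).aestronglyMeasurable) (fun x => ?_)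
    (Continuous.integrable_of_Icc hm hf).norm ?_
  · filter_upwards [ae_mem_Icc hm] with s hs
    rw [norm_smul, Real.norm_of_nonneg (le_max_right _ _)]
    exact mul_le_of_le_one_left (norm_nonneg _)
      (max_le (by linarith [(clip_mem x).2, hs.1]) zero_le_one)
  · have := continuous_clip
    exact Eventually.of_forall fun s => by fun_prop

lemma continuous_volterra_iterate {m : Measure ℝ} [IsProbabilityMeasure m]
    (hm : m (Set.Icc 0 1)ᶜ = 0) {f : ℝ → ℂ} (hf : Continuous f) (k : ℕ) :
    Continuous ((volterra m)^[k] f) := by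
  induction k with
  | zero => exact hf
  | succ k ih =>
    rw [Function.iterate_succ_apply']
    exact continuous_volterra hm ih

lemma norm_volterra_iterate_le {m : Measure ℝ} [IsProbabilityMeasure m]
    (hm : m (Set.Icc 0 1)ᶜ = 0) {f : ℝ → ℂ} (hf1 : ∀ x, ‖f x‖ ≤ 1) (k : ℕ) (x : ℝ) :
    ‖(volterra m)^[k] f x‖ ≤ clip x ^ k / k.factorial := by
  induction k generalizing x with
  | zero => simpa using hf1 x
  | succ k ih =>
    rw [Function.iterate_succ_apply']
    have := norm_integral_kernel_le hm (v := (volterra m)^[k] f) (k := k) zero_le_one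
      (fun s hs => by simpa [clip_of_mem hs] using ih s) (clip_mem x).1
    simpa [volterra] using this

lemma norm_volterra_iterate_le' {m : Measure ℝ} [IsProbabilityMeasure m]
    (hm : m (Set.Icc 0 1)ᶜ = 0) {f : ℝ → ℂ} (hf1 : ∀ x, ‖f x‖ ≤ 1) (k : ℕ) (x : ℝ) :
    ‖(volterra m)^[k] f x‖ ≤ 1 / k.factorial :=
  (norm_volterra_iterate_le hm hf1 k x).trans (by
    gcongr; exact pow_le_one₀ (clip_mem x).1 (clip_mem x).2)

lemma norm_pow_mul_le {l c : ℂ} {R : ℝ} {k : ℕ} (hl : ‖l‖ ≤ R) (hc : ‖c‖ ≤ 1 / k.factorial) :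
    ‖l ^ k * c‖ ≤ R ^ k / k.factorial := by
  have := (norm_nonneg l).trans hl
  rw [norm_mul, norm_pow, div_eq_mul_one_div]
  gcongr

/-- Factorial decay of the coefficients gives uniform convergence on discs. -/
lemma differentiable_tsum_pow {c : ℕ → ℂ} (hc : ∀ k, ‖c k‖ ≤ 1 / k.factorial) :
    Differentiable ℂ fun l => ∑' k, l ^ k * c k := fun l => by
  have h := Complex.differentiableOn_tsum_of_summable_norm (u := fun k => (‖l‖ + 1) ^ k / k.factorial)
    (Real.summable_pow_div_factorial (‖l‖ + 1)) (F := fun k l => l ^ k * c k)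
    (U := Metric.ball 0 (‖l‖ + 1)) (fun k => by fun_prop) Metric.isOpen_ball
    fun k w hw => norm_pow_mul_le (mem_ball_zero_iff.1 hw).le (hc k)
  exact (h l (by simp)).differentiableAt (Metric.isOpen_ball.mem_nhds (by simp))

/-- The Neumann series `∑ lᵏ Vᵏ f` of the Volterra operator `V`. -/
def volterraSeries (m : Measure ℝ) (f : ℝ → ℂ) (l : ℂ) (x : ℝ) : ℂ :=
  ∑' k, l ^ k * (volterra m)^[k] f x

section Series

variable {m : Measure ℝ} [IsProbabilityMeasure m] {f : ℝ → ℂ}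

lemma summable_volterraSeries (hm : m (Set.Icc 0 1)ᶜ = 0) (hf1 : ∀ x, ‖f x‖ ≤ 1) (l : ℂ) (x : ℝ) :
    Summable fun k => l ^ k * (volterra m)^[k] f x :=
  .of_norm_bounded (Real.summable_pow_div_factorial ‖l‖)
    fun k => norm_pow_mul_le le_rfl (norm_volterra_iterate_le' hm hf1 k x)

lemma differentiable_volterraSeries (hm : m (Set.Icc 0 1)ᶜ = 0) (hf1 : ∀ x, ‖f x‖ ≤ 1) (x : ℝ) :
    Differentiable ℂ fun l => volterraSeries m f l x :=
  differentiable_tsum_pow fun k => norm_volterra_iterate_le' hm hf1 k x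

lemma continuous_volterraSeries (hm : m (Set.Icc 0 1)ᶜ = 0) (hf : Continuous f)
    (hf1 : ∀ x, ‖f x‖ ≤ 1) : Continuous fun y : ℂ × ℝ => volterraSeries m f y.1 y.2 := by
  refine continuous_iff_continuousAt.2 fun y => ?_
  have h := continuousOn_tsum (u := fun k => (‖y.1‖ + 1) ^ k / k.factorial)
    (f := fun k (z : ℂ × ℝ) => z.1 ^ k * (volterra m)^[k] f z.2)
    (s := {z | ‖z.1‖ < ‖y.1‖ + 1}) (fun k => ?_)
    (Real.summable_pow_div_factorial (‖y.1‖ + 1))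
    fun k z hz => norm_pow_mul_le (le_of_lt hz) (norm_volterra_iterate_le' hm hf1 k z.2)
  · exact h.continuousAt ((isOpen_lt (by fun_prop) continuous_const).mem_nhds (by simp))
  · have := continuous_volterra_iterate hm hf k
    fun_prop

lemma hasSum_integral_mul_volterraSeries (hm : m (Set.Icc 0 1)ᶜ = 0) (hf : Continuous f)
    (hf1 : ∀ x, ‖f x‖ ≤ 1) (l : ℂ) {κ : ℝ → ℝ} (hκ : Continuous κ)
    (hκ1 : ∀ s ∈ Set.Icc (0 : ℝ) 1, |κ s| ≤ 1) :
    HasSum (fun k => l ^ k * ∫ s, κ s • (volterra m)^[k] f s ∂m)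
      (∫ s, κ s • volterraSeries m f l s ∂m) := by
  have hc : ∀ k, Continuous fun s => κ s • (l ^ k * (volterra m)^[k] f s) := fun k => by
    have := continuous_volterra_iterate hm hf k
    fun_prop
  have h := hasSum_integral_of_summable_integral_norm (μ := m)
    (F := fun k s => κ s • (l ^ k * (volterra m)^[k] f s))
    (fun k => Continuous.integrable_of_Icc hm (hc k)) ?_
  · have e1 : ∀ k, ∫ s, κ s • (l ^ k * (volterra m)^[k] f s) ∂m =
        l ^ k * ∫ s, κ s • (volterra m)^[k] f s ∂m := fun k => by
      rw [← integral_const_mul]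
      simp only [mul_smul_comm]
    have e2 : ∀ s, ∑' k, κ s • (l ^ k * (volterra m)^[k] f s) = κ s • volterraSeries m f l s :=
      fun s => ((summable_volterraSeries hm hf1 l s).hasSum.const_smul (κ s)).tsum_eq
    simpa only [e1, e2] using h
  · refine .of_nonneg_of_le (fun k => integral_nonneg fun _ => norm_nonneg _) (fun k => ?_)
      (Real.summable_pow_div_factorial ‖l‖)
    have h1 : ∀ᵐ s ∂m, ‖κ s • (l ^ k * (volterra m)^[k] f s)‖ ≤ ‖l‖ ^ k / k.factorial := by
      filter_upwards [ae_mem_Icc hm] with s hs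
      rw [norm_smul, Real.norm_eq_abs]
      exact (mul_le_of_le_one_left (norm_nonneg _) (hκ1 s hs)).trans
        (norm_pow_mul_le le_rfl (norm_volterra_iterate_le' hm hf1 k s))
    simpa using integral_mono_ae (Continuous.integrable_of_Icc hm (hc k)).norm
      (integrable_const _) h1

/-- Splitting off the first term of the Neumann series gives g = f + lVg; termwise integration is
justified by the factorial bounds. -/
lemma volterraSeries_eq (hm : m (Set.Icc 0 1)ᶜ = 0) (hf : Continuous f)
    (hf1 : ∀ x, ‖f x‖ ≤ 1) (l : ℂ) {x : ℝ} (hx : x ∈ Set.Icc (0 : ℝ) 1) :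
    volterraSeries m f l x = f x + l * ∫ s, max (x - s) 0 • volterraSeries m f l s ∂m := by
  have h := hasSum_integral_mul_volterraSeries hm hf hf1 l (κ := fun s => max (x - s) 0)
    (by fun_prop) fun s hs => by
      rw [abs_of_nonneg (le_max_right _ _)]
      exact max_le (by linarith [hx.2, hs.1]) zero_le_one
  rw [volterraSeries, (summable_volterraSeries hm hf1 l x).tsum_eq_zero_add, ← h.tsum_eq,
    ← tsum_mul_left]
  simp only [pow_zero, Function.iterate_zero, id_eq, one_mul, Function.iterate_succ_apply',
    volterra, clip_of_mem hx]
  congr 2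
  funext k
  rw [pow_succ']
  ring

lemma differentiable_integral_volterraSeries (hm : m (Set.Icc 0 1)ᶜ = 0) (hf : Continuous f)
    (hf1 : ∀ x, ‖f x‖ ≤ 1) : Differentiable ℂ fun l => ∫ s, volterraSeries m f l s ∂m := by
  have h : (fun l => ∫ s, volterraSeries m f l s ∂m) =
      fun l => ∑' k, l ^ k * ∫ s, (volterra m)^[k] f s ∂m := by
    funext l
    simpa using (hasSum_integral_mul_volterraSeries hm hf hf1 l (κ := fun _ => 1)
      continuous_const (by simp)).tsum_eq.symm
  rw [h]
  refine differentiable_tsum_pow fun k => ?_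
  simpa using norm_integral_le_of_norm_le_const (μ := m)
    (Eventually.of_forall (norm_volterra_iterate_le' hm hf1 k))

end Series

/-! ### Solutions of the string equation -/

/-- `f` solves the string equation `d f' = l f dm` on `[0, 1]` with `f(0) = u`, `f'(0-) = p`. -/
structure IsStringSol {𝕜 : Type*} [RCLike 𝕜] (m : Measure ℝ) (l u p : 𝕜) (f : ℝ → 𝕜) : Prop where
  cont : Continuous f
  eq : ∀ x ∈ Set.Icc (0 : ℝ) 1, f x = u + x • p + l * ∫ s, max (x - s) 0 • f s ∂m

/-- Feeding the equation into itself k times bounds v by C (‖l‖x)ᵏ/k!, which tends to 0. This is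
uniqueness for the string equation. -/
lemma eqOn_zero_of_kernel {𝕜 : Type*} [RCLike 𝕜] {m : Measure ℝ} [IsProbabilityMeasure m]
    (hm : m (Set.Icc 0 1)ᶜ = 0) {l : 𝕜} {v : ℝ → 𝕜} (hv : ContinuousOn v (Set.Icc 0 1))
    (h : ∀ x ∈ Set.Icc (0 : ℝ) 1, v x = l * ∫ s, max (x - s) 0 • v s ∂m) :
    ∀ x ∈ Set.Icc (0 : ℝ) 1, v x = 0 := by
  obtain ⟨C, hC⟩ := isCompact_Icc.exists_bound_of_continuousOn hv
  have hC0 : 0 ≤ C := (norm_nonneg _).trans (hC 0 (by simp))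
  have hk : ∀ k : ℕ, ∀ x ∈ Set.Icc (0 : ℝ) 1, ‖v x‖ ≤ C * ‖l‖ ^ k * (x ^ k / k.factorial) := by
    intro k
    induction k with
    | zero => simpa using hC
    | succ k ih =>
      intro x hx
      rw [h x hx, norm_mul, pow_succ']
      have := norm_integral_kernel_le hm (by positivity) ih hx.1
      calc ‖l‖ * _ ≤ ‖l‖ * _ := mul_le_mul_of_nonneg_left this (norm_nonneg _)
        _ = _ := by ring
  intro x hx
  have ht : Tendsto (fun k : ℕ => C * ((‖l‖ * x) ^ k / k.factorial)) atTop (𝓝 (C * 0)) :=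
    (FloorSemiring.tendsto_pow_div_factorial_atTop _).const_mul C
  rw [mul_zero] at ht
  refine norm_le_zero_iff.1 (ge_of_tendsto' ht fun k => (hk k x hx).trans_eq ?_)
  rw [mul_pow]; ring

lemma IsStringSol.const_mul {𝕜 : Type*} [RCLike 𝕜] {m : Measure ℝ} {l u p : 𝕜} {f : ℝ → 𝕜}
    (hf : IsStringSol m l u p f) (c : 𝕜) :
    IsStringSol m l (c * u) (c * p) fun x => c * f x := by
  refine ⟨hf.cont.const_mul _, fun x hx => ?_⟩
  simp only [← mul_smul_comm]
  rw [integral_const_mul, hf.eq x hx]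
  ring

namespace IsStringSol

variable {𝕜 : Type*} [RCLike 𝕜] {m : Measure ℝ} [IsProbabilityMeasure m] {l u p u' p' : 𝕜}
  {f g : ℝ → 𝕜}

lemma eqOn (hm : m (Set.Icc 0 1)ᶜ = 0) (hf : IsStringSol m l u p f) {g : ℝ → 𝕜}
    (hgc : ContinuousOn g (Set.Icc 0 1))
    (hg : ∀ x ∈ Set.Icc (0 : ℝ) 1, g x = u + x • p + l * ∫ s, max (x - s) 0 • g s ∂m) :
    ∀ x ∈ Set.Icc (0 : ℝ) 1, g x = f x := by
  have hm' := Measure.restrict_eq_self_of_ae_mem (ae_mem_Icc hm)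
  intro x hx
  refine sub_eq_zero.1 (eqOn_zero_of_kernel hm (l := l) (hgc.sub hf.cont.continuousOn)
    (fun x hx => ?_) x hx)
  have i1 : Integrable (fun s => max (x - s) 0 • g s) m := by
    rw [← hm']
    refine ContinuousOn.integrableOn_compact isCompact_Icc ?_
    exact ContinuousOn.smul (by fun_prop) hgc
  have i2 := Continuous.integrable_of_Icc hm (continuous_kernel_smul hf.cont x)
  simp only [Pi.sub_apply, smul_sub]
  rw [integral_sub i1 i2, hg x hx, hf.eq x hx]
  ring

lemma eqOn' (hm : m (Set.Icc 0 1)ᶜ = 0) (hf : IsStringSol m l u p f) (hg : IsStringSol m l u p g) :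
    ∀ x ∈ Set.Icc (0 : ℝ) 1, g x = f x := hf.eqOn hm hg.cont.continuousOn hg.eq

lemma add (hm : m (Set.Icc 0 1)ᶜ = 0) (hf : IsStringSol m l u p f) (hg : IsStringSol m l u' p' g) :
    IsStringSol m l (u + u') (p + p') fun x => f x + g x := by
  refine ⟨hf.cont.add hg.cont, fun x hx => ?_⟩
  simp only [smul_add]
  rw [integral_add (Continuous.integrable_of_Icc hm (continuous_kernel_smul hf.cont x))
    (Continuous.integrable_of_Icc hm (continuous_kernel_smul hg.cont x)), hf.eq x hx, hg.eq x hx]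
  ring

end IsStringSol

/-! ### The derivative of a solution and the weak form of the equation -/

section Fubini

variable {𝕜 : Type*} [RCLike 𝕜] {m : Measure ℝ}

lemma integrable_indicator_le_mul [SFinite m] {f k : ℝ → 𝕜} (hf : Integrable f m) {b : ℝ}
    (hk : IntegrableOn k (Set.Icc 0 b)) :
    Integrable ({q : ℝ × ℝ | q.2 ≤ q.1}.indicator fun q => k q.1 * f q.2)
      ((volume.restrict (Set.Icc 0 b)).prod m) :=
  (hk.mul_prod hf).indicator (measurableSet_le measurable_snd measurable_fst)

lemma integral_indicator_le_mul (f k : ℝ → 𝕜) (t : ℝ) :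
    ∫ s, {q : ℝ × ℝ | q.2 ≤ q.1}.indicator (fun q => k q.1 * f q.2) (t, s) ∂m =
      (∫ s in Set.Iic t, f s ∂m) * k t := by
  rw [mul_comm, ← integral_const_mul, ← integral_indicator measurableSet_Iic]
  rfl

lemma integrableOn_integral_Iic [SFinite m] {f : ℝ → 𝕜} (hf : Integrable f m) (b : ℝ) :
    IntegrableOn (fun t => ∫ s in Set.Iic t, f s ∂m) (Set.Icc 0 b) := by
  have := (integrable_indicator_le_mul (k := fun _ => 1) hf
    (b := b) (integrable_const _)).integral_prod_left
  refine this.congr (Eventually.of_forall fun t => ?_)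
  simp only
  rw [integral_indicator_le_mul f (fun _ => 1), mul_one]

/-- Fubini on the region s ≤ t ≤ b. It plays the role of integration by parts against m, with
possible atoms on the closed side. -/
lemma integral_Iic_mul [SFinite m] (hm : m (Set.Icc 0 1)ᶜ = 0) {f k : ℝ → 𝕜} (hf : Integrable f m) {b : ℝ}
    (hb : 0 ≤ b) (hk : IntegrableOn k (Set.Icc 0 b)) :
    ∫ t in (0 : ℝ)..b, (∫ s in Set.Iic t, f s ∂m) * k t =
      ∫ s, f s * (if s ≤ b then ∫ t in s..b, k t else 0) ∂m := by
  rw [intervalIntegral.integral_of_le hb, ← integral_Icc_eq_integral_Ioc]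
  simp only [← integral_indicator_le_mul]
  rw [integral_integral_swap (f := fun t s => {q : ℝ × ℝ | q.2 ≤ q.1}.indicator
    (fun q => k q.1 * f q.2) (t, s)) (integrable_indicator_le_mul hf hk)]
  refine integral_congr_ae ?_
  filter_upwards [ae_mem_Icc hm] with s hs
  have h1 : (fun t => {q : ℝ × ℝ | q.2 ≤ q.1}.indicator (fun q => k q.1 * f q.2) (t, s)) =
      (Set.Ici s).indicator fun t => f s * k t := by
    funext t
    simp only [Set.indicator, Set.mem_ofPred_eq, Set.mem_Ici, mul_comm (f s)]
  rw [h1, setIntegral_indicator measurableSet_Ici, integral_const_mul]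
  congr 1
  split_ifs with h
  · rw [intervalIntegral.integral_of_le h, ← integral_Icc_eq_integral_Ioc]
    congr 2
    ext t
    simp only [Set.mem_inter_iff, Set.mem_Icc, Set.mem_Ici]
    exact ⟨fun ht => ⟨ht.2, ht.1.2⟩, fun ht => ⟨⟨hs.1.trans ht.1, ht.2⟩, ht.1⟩⟩
  · rw [show Set.Icc 0 b ∩ Set.Ici s = ∅ from ?_, Measure.restrict_empty, integral_zero_measure]
    ext t
    simp only [Set.mem_inter_iff, Set.mem_Icc, Set.mem_Ici, Set.mem_empty_iff_false, iff_false]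
    exact fun ht => h (ht.2.trans ht.1.2)

end Fubini

/-- The derivative at `t` of the solution `f` of the string equation with `f'(0-) = p`. -/
def slope {𝕜 : Type*} [RCLike 𝕜] (m : Measure ℝ) (l p : 𝕜) (f : ℝ → 𝕜) (t : ℝ) : 𝕜 :=
  p + l * ∫ s in Set.Iic t, f s ∂m

lemma slope_one {𝕜 : Type*} [RCLike 𝕜] {m : Measure ℝ} (hm : m (Set.Icc 0 1)ᶜ = 0) (l p : 𝕜)
    (f : ℝ → 𝕜) : slope m l p f 1 = p + l * ∫ s, f s ∂m := by
  rw [slope, setIntegral_eq_integral_of_ae_compl_eq_zero]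
  filter_upwards [ae_mem_Icc hm] with s hs hs'
  exact absurd hs.2 hs'

lemma IsStringSol.zero_eq {𝕜 : Type*} [RCLike 𝕜] {m : Measure ℝ} {l u p : 𝕜} {f : ℝ → 𝕜}
    (hm : m (Set.Icc 0 1)ᶜ = 0) (hf : IsStringSol m l u p f) : f 0 = u := by
  rw [hf.eq 0 (by simp), integral_eq_zero_of_ae]
  · simp
  · filter_upwards [ae_mem_Icc hm] with s hs
    rw [max_eq_right (by linarith [hs.1]), zero_smul]; rfl

namespace IsStringSol

variable {𝕜 : Type*} [RCLike 𝕜] {m : Measure ℝ} [IsProbabilityMeasure m] {l u p l' u' p' : 𝕜}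
  {f g : ℝ → 𝕜}

lemma integrable (hm : m (Set.Icc 0 1)ᶜ = 0) (hf : IsStringSol m l u p f) : Integrable f m :=
  Continuous.integrable_of_Icc hm hf.cont

lemma integrableOn_slope (hm : m (Set.Icc 0 1)ᶜ = 0) (hf : IsStringSol m l u p f) :
    IntegrableOn (slope m l p f) (Set.Icc 0 1) :=
  (integrable_const p).add ((integrableOn_integral_Iic (hf.integrable hm) 1).const_mul l)

lemma memLp_slope (hm : m (Set.Icc 0 1)ᶜ = 0) (hf : IsStringSol m l u p f) :
    MemLp (slope m l p f) 2 (volume.restrict (Set.Icc 0 1)) := by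
  refine MemLp.of_bound (hf.integrableOn_slope hm).aestronglyMeasurable
    (‖p‖ + ‖l‖ * ∫ s, ‖f s‖ ∂m) (Eventually.of_forall fun t => ?_)
  refine (norm_add_le _ _).trans ?_
  rw [norm_mul]
  gcongr
  exact (norm_integral_le_integral_norm _).trans
    (setIntegral_le_integral (hf.integrable hm).norm (Eventually.of_forall fun _ => norm_nonneg _))

/-- `f` is the primitive of its derivative. -/
lemma eq_integral_slope (hm : m (Set.Icc 0 1)ᶜ = 0) (hf : IsStringSol m l u p f) {x : ℝ}
    (hx : x ∈ Set.Icc (0 : ℝ) 1) : f x = u + ∫ t in (0 : ℝ)..x, slope m l p f t := by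
  have h := integral_Iic_mul hm (k := fun _ => 1) (hf.integrable hm) hx.1 (integrable_const _)
  have hi : IntervalIntegrable (fun t => l * ∫ s in Set.Iic t, f s ∂m) volume 0 x := by
    rw [intervalIntegrable_iff_integrableOn_Icc_of_le hx.1]
    exact (integrableOn_integral_Iic (hf.integrable hm) x).const_mul l
  simp only [slope]
  rw [intervalIntegral.integral_add intervalIntegrable_const hi, intervalIntegral.integral_const,
    intervalIntegral.integral_const_mul, sub_zero, ← add_assoc, hf.eq x hx]
  simp only [mul_one] at h
  rw [h]
  congr 2
  refine integral_congr_ae (Eventually.of_forall fun s => ?_)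
  simp only
  split_ifs with hs
  · rw [max_eq_left (by linarith), intervalIntegral.integral_const, RCLike.real_smul_eq_coe_mul,
      RCLike.real_smul_eq_coe_mul, mul_one, mul_comm]
  · rw [max_eq_right (by linarith), zero_smul, mul_zero]

/-- The weak form of the string equation. -/
lemma integral_slope_mul (hm : m (Set.Icc 0 1)ᶜ = 0) (hf : IsStringSol m l u p f) {h k : ℝ → 𝕜}
    (hk : IntegrableOn k (Set.Icc 0 1))
    (hh : ∀ x ∈ Set.Icc (0 : ℝ) 1, h x = h 0 + ∫ t in (0 : ℝ)..x, k t) :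
    ∫ t in (0 : ℝ)..1, slope m l p f t * k t =
      slope m l p f 1 * h 1 - p * h 0 - l * ∫ s, f s * h s ∂m := by
  have hki : ∀ a ∈ Set.Icc (0 : ℝ) 1, ∀ b ∈ Set.Icc (0 : ℝ) 1, IntervalIntegrable k volume a b :=
    fun a ha b hb => (hk.mono_set (Set.uIcc_subset_Icc ha hb)).intervalIntegrable
  have hfm : ∃ C, ∀ t, ‖slope m l p f t‖ ≤ C := by
    refine ⟨‖p‖ + ‖l‖ * ∫ s, ‖f s‖ ∂m, fun t => (norm_add_le _ _).trans ?_⟩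
    rw [norm_mul]
    gcongr
    exact (norm_integral_le_integral_norm _).trans (setIntegral_le_integral
      (hf.integrable hm).norm (Eventually.of_forall fun _ => norm_nonneg _))
  obtain ⟨C, hC⟩ := hfm
  have hI : IntegrableOn (fun t => slope m l p f t * k t) (Set.Icc 0 1) :=
    hk.bdd_mul (hf.integrableOn_slope hm).aestronglyMeasurable (Eventually.of_forall hC)
  have hI' : IntervalIntegrable (fun t => l * ((∫ s in Set.Iic t, f s ∂m) * k t)) volume 0 1 := by
    rw [intervalIntegrable_iff_integrableOn_Icc_of_le zero_le_one]
    refine (hI.sub (hk.const_mul p)).congr (Eventually.of_forall fun t => ?_)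
    simp only [Pi.sub_apply, slope]
    ring
  have h0 : (0 : ℝ) ∈ Set.Icc (0 : ℝ) 1 := by simp
  have h1 : (1 : ℝ) ∈ Set.Icc (0 : ℝ) 1 := by simp
  have e1 : ∀ t, slope m l p f t * k t = p * k t + l * ((∫ s in Set.Iic t, f s ∂m) * k t) :=
    fun t => by rw [slope]; ring
  have hhc : ContinuousOn h (Set.Icc 0 1) := by
    have := intervalIntegral.continuousOn_primitive_interval (μ := volume) (f := k) (a := 0) (b := 1)
      (by rwa [Set.uIcc_of_le zero_le_one])
    rw [Set.uIcc_of_le zero_le_one] at this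
    exact (continuousOn_const.add this).congr hh
  have hfh : Integrable (fun s => f s * h s) m := by
    rw [← Measure.restrict_eq_self_of_ae_mem (ae_mem_Icc hm)]
    exact (hf.cont.continuousOn.mul hhc).integrableOn_compact isCompact_Icc
  simp only [e1]
  rw [intervalIntegral.integral_add ((hki 0 h0 1 h1).const_mul p) hI',
    intervalIntegral.integral_const_mul, intervalIntegral.integral_const_mul,
    integral_Iic_mul hm (hf.integrable hm) zero_le_one hk]
  have e2 : ∫ s, f s * (if s ≤ 1 then ∫ t in s..1, k t else 0) ∂m =
      (∫ s, f s ∂m) * h 1 - ∫ s, f s * h s ∂m := by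
    rw [← integral_mul_const, ← integral_sub ((hf.integrable hm).mul_const _) hfh]
    refine integral_congr_ae ?_
    filter_upwards [ae_mem_Icc hm] with s hs
    rw [if_pos hs.2, ← intervalIntegral.integral_interval_sub_left (hki 0 h0 1 h1) (hki 0 h0 s hs),
      hh 1 h1, hh s hs]
    ring
  rw [e2, slope_one hm, hh 1 h1]
  ring

lemma integral_slope_mul_slope (hm : m (Set.Icc 0 1)ᶜ = 0) (hf : IsStringSol m l u p f)
    (hg : IsStringSol m l' u' p' g) :
    ∫ t in (0 : ℝ)..1, slope m l p f t * slope m l' p' g t =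
      slope m l p f 1 * g 1 - p * u' - l * ∫ s, f s * g s ∂m := by
  have := hf.integral_slope_mul hm (hg.integrableOn_slope hm) (h := g)
    fun x hx => by rw [hg.zero_eq hm, hg.eq_integral_slope hm hx]
  rwa [hg.zero_eq hm] at this

/-- Lagrange's identity: the integral of the product of the two derivatives is evaluated by the weak
form of either equation. -/
lemma slope_one_mul_sub (hm : m (Set.Icc 0 1)ᶜ = 0) (hf : IsStringSol m l u p f)
    (hg : IsStringSol m l' u' p' g) :
    slope m l p f 1 * g 1 - f 1 * slope m l' p' g 1 - (p * u' - u * p') =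
      (l - l') * ∫ s, f s * g s ∂m := by
  have h1 := hf.integral_slope_mul_slope hm hg
  have h2 := hg.integral_slope_mul_slope hm hf
  simp only [mul_comm (slope m l' p' g _), mul_comm (g _)] at h2
  linear_combination h2 - h1

end IsStringSol

lemma IsStringSol.conj {m : Measure ℝ} {l u p : ℂ} {f : ℝ → ℂ} (hf : IsStringSol m l u p f) :
    IsStringSol m (starRingEnd ℂ l) (starRingEnd ℂ u) (starRingEnd ℂ p)
      fun x => starRingEnd ℂ (f x) := by
  refine ⟨Complex.continuous_conj.comp hf.cont, fun x hx => ?_⟩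
  rw [hf.eq x hx]
  simp only [map_add, map_mul, ← integral_conj, Complex.real_smul, Complex.conj_ofReal]

lemma IsStringSol.re {m : Measure ℝ} [IsProbabilityMeasure m] (hm : m (Set.Icc 0 1)ᶜ = 0)
    {l u p : ℝ} {f : ℝ → ℂ} (hf : IsStringSol m (l : ℂ) (u : ℂ) (p : ℂ) f) :
    IsStringSol m l u p fun x => (f x).re := by
  refine ⟨Complex.continuous_re.comp hf.cont, fun x hx => ?_⟩
  have h := integral_re (𝕜 := ℂ) (Continuous.integrable_of_Icc hm (continuous_kernel_smul hf.cont x))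
  simp only [RCLike.re_to_complex, Complex.smul_re] at h
  rw [hf.eq x hx, h]
  simp

open Transfer

/-! ### The transfer matrices of the string -/

/-- The solution of the string equation with initial data `u`, `p`. -/
def stringSol (m : Measure ℝ) (l u p : ℂ) (x : ℝ) : ℂ :=
  u * volterraSeries m (fun _ => 1) l x + p * volterraSeries m (fun x => (clip x : ℂ)) l x

lemma norm_clip_le (x : ℝ) : ‖((clip x : ℝ) : ℂ)‖ ≤ 1 := by
  rw [Complex.norm_real, Real.norm_of_nonneg (clip_mem x).1]
  exact (clip_mem x).2

lemma continuous_ofReal_clip : Continuous fun x => ((clip x : ℝ) : ℂ) :=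
  Complex.continuous_ofReal.comp continuous_clip

/-- The transfer matrix of the string. -/
def stringTransfer (m : Measure ℝ) (l : ℂ) : Transfer where
  a := stringSol m l 1 0 1
  b := stringSol m l 0 1 1
  c := l * ∫ s, stringSol m l 1 0 s ∂m
  d := 1 + l * ∫ s, stringSol m l 0 1 s ∂m

section

variable {m : Measure ℝ} [IsProbabilityMeasure m]

lemma isStringSol_stringSol (hm : m (Set.Icc 0 1)ᶜ = 0) (l u p : ℂ) :
    IsStringSol m l u p (stringSol m l u p) := by
  have h1 : IsStringSol m l 1 0 (volterraSeries m (fun _ => 1) l) :=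
    ⟨(continuous_volterraSeries hm continuous_const (by simp)).comp (by fun_prop :
      Continuous fun x : ℝ => (l, x)), fun x hx => by
        simpa using volterraSeries_eq hm (f := fun _ => 1) continuous_const (by simp) l hx⟩
  have h2 : IsStringSol m l 0 1 (volterraSeries m (fun x => (clip x : ℂ)) l) :=
    ⟨(continuous_volterraSeries hm continuous_ofReal_clip norm_clip_le).comp (by fun_prop :
      Continuous fun x : ℝ => (l, x)), fun x hx => by
        simpa [clip_of_mem hx] using volterraSeries_eq hm continuous_ofReal_clip norm_clip_le l hx⟩
  have h := (h1.const_mul u).add hm (h2.const_mul p)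
  simp only [mul_one, mul_zero, add_zero, zero_add] at h
  exact h

lemma continuous_stringSol (hm : m (Set.Icc 0 1)ᶜ = 0) :
    Continuous fun y : (ℂ × ℂ × ℂ) × ℝ => stringSol m y.1.1 y.1.2.1 y.1.2.2 y.2 := by
  have h1 : Continuous fun y : (ℂ × ℂ × ℂ) × ℝ => volterraSeries m (fun _ => 1) y.1.1 y.2 :=
    (continuous_volterraSeries hm continuous_const (by simp)).comp (by fun_prop :
      Continuous fun y : (ℂ × ℂ × ℂ) × ℝ => (y.1.1, y.2))
  have h2 : Continuous fun y : (ℂ × ℂ × ℂ) × ℝ =>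
      volterraSeries m (fun x => (clip x : ℂ)) y.1.1 y.2 :=
    (continuous_volterraSeries hm continuous_ofReal_clip norm_clip_le).comp (by fun_prop :
      Continuous fun y : (ℂ × ℂ × ℂ) × ℝ => (y.1.1, y.2))
  unfold stringSol
  fun_prop

lemma stringSol_eq (m : Measure ℝ) (l u p : ℂ) (x : ℝ) :
    stringSol m l u p x = u * stringSol m l 1 0 x + p * stringSol m l 0 1 x := by
  simp [stringSol]

lemma IsStringSol.eq_fst (hm : m (Set.Icc 0 1)ᶜ = 0) {l u p : ℂ} {f : ℝ → ℂ}
    (hf : IsStringSol m l u p f) : f 1 = (stringTransfer m l).fst u p := by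
  rw [(isStringSol_stringSol hm l u p).eqOn' hm hf 1 (by simp), stringSol_eq]
  simp only [fst, stringTransfer]
  ring

lemma IsStringSol.eq_snd (hm : m (Set.Icc 0 1)ᶜ = 0) {l u p : ℂ} {f : ℝ → ℂ}
    (hf : IsStringSol m l u p f) : p + l * ∫ s, f s ∂m = (stringTransfer m l).snd u p := by
  have h : ∫ s, f s ∂m = u * ∫ s, stringSol m l 1 0 s ∂m + p * ∫ s, stringSol m l 0 1 s ∂m := by
    rw [← integral_const_mul, ← integral_const_mul, ← integral_add]
    · refine integral_congr_ae ?_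
      filter_upwards [ae_mem_Icc hm] with s hs
      rw [(isStringSol_stringSol hm l u p).eqOn' hm hf s hs, stringSol_eq]
    · exact ((isStringSol_stringSol hm l 1 0).integrable hm).const_mul u
    · exact ((isStringSol_stringSol hm l 0 1).integrable hm).const_mul p
  rw [h]
  simp only [snd, stringTransfer]
  ring

lemma IsStringSol.slope_one_eq (hm : m (Set.Icc 0 1)ᶜ = 0) {l u p : ℂ} {f : ℝ → ℂ}
    (hf : IsStringSol m l u p f) : slope m l p f 1 = (stringTransfer m l).snd u p := by
  rw [slope_one hm, hf.eq_snd hm]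

/-- Lagrange's identity with equal parameters: the Wronskian of the two basic solutions is the same
at both ends. -/
lemma det_stringTransfer (hm : m (Set.Icc 0 1)ᶜ = 0) (l : ℂ) : (stringTransfer m l).det = 1 := by
  have h1 := isStringSol_stringSol hm l 1 0
  have h2 := isStringSol_stringSol hm l 0 1
  have h := h1.slope_one_mul_sub hm h2
  rw [h1.slope_one_eq hm, h2.slope_one_eq hm, h1.eq_fst hm, h2.eq_fst hm] at h
  simp only [fst, snd, sub_self, zero_mul, mul_one, mul_zero, add_zero, zero_add] at h
  rw [det]
  linear_combination -h

/-- Lagrange's identity for f and its conjugate, whose parameters differ by 2i Im l. -/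
lemma flux_stringTransfer_sub (hm : m (Set.Icc 0 1)ᶜ = 0) (l u p : ℂ) :
    flux ((stringTransfer m l).fst u p) ((stringTransfer m l).snd u p) - flux u p =
      l.im * ∫ s, ‖stringSol m l u p s‖ ^ 2 ∂m := by
  have hf := isStringSol_stringSol hm l u p
  have h := hf.slope_one_mul_sub hm hf.conj
  have hc : slope m (starRingEnd ℂ l) (starRingEnd ℂ p) (fun x => starRingEnd ℂ (stringSol m l u p x)) 1 =
      starRingEnd ℂ (slope m l p (stringSol m l u p) 1) := by
    rw [slope_one hm, slope_one hm, integral_conj, map_add, map_mul]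
  have hn : ∫ s, stringSol m l u p s * (starRingEnd ℂ) (stringSol m l u p s) ∂m =
      ((∫ s, ‖stringSol m l u p s‖ ^ 2 ∂m : ℝ) : ℂ) := by
    rw [← integral_complex_ofReal]
    simp only [Complex.mul_conj, Complex.normSq_eq_norm_sq]
  rw [hc, hf.slope_one_eq hm, hf.eq_fst hm, hn] at h
  have h' := congrArg Complex.im h
  simp only [Complex.sub_im, Complex.mul_im, Complex.conj_re, Complex.conj_im, Complex.sub_re,
    Complex.ofReal_re, Complex.ofReal_im] at h'
  simp only [flux, Complex.mul_im, Complex.conj_re, Complex.conj_im]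
  linarith

end

/-! ### Self-similarity of the string -/

section

variable {α : ℝ} {m : Measure ℝ}

/-- A point mass at s would make s a fixed point of both contractions, but these fix 0 and 1
respectively. -/
lemma IsSelfSimilarMeasure.measure_compl_singleton_ne_zero (h : IsSelfSimilarMeasure α m)
    (h0 : 0 < α) (h1 : α < 1) (s : ℝ) : m {s}ᶜ ≠ 0 := by
  obtain ⟨hp, -, hs⟩ := h
  intro h
  have hms : MeasurableSet ({s}ᶜ : Set ℝ) := (measurableSet_singleton s).compl
  have h' := h
  rw [hs, Measure.add_apply, Measure.smul_apply, Measure.smul_apply,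
    Measure.map_apply (by fun_prop) hms, Measure.map_apply (by fun_prop) hms, add_eq_zero,
    smul_eq_mul, smul_eq_mul, mul_eq_zero, mul_eq_zero] at h'
  have e1 := h'.1.resolve_left (by simp [measureWeight, h1])
  have e2 := h'.2.resolve_left (by simp [measureWeight, h0])
  have a0 : ∀ᵐ t ∂m, t = s := h
  have a1 : ∀ᵐ t ∂m, α * t = s := e1
  have a2 : ∀ᵐ t ∂m, 1 + (t - 1) * (1 - α) = s := e2
  obtain ⟨t, ht0, ht1, ht2⟩ := (a0.and (a1.and a2)).exists
  nlinarith

lemma IsSelfSimilarMeasure.integral_eq (h : IsSelfSimilarMeasure α m) (h0 : 0 < α) (h1 : α < 1)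
    {f : ℝ → ℂ} (hf : Continuous f) :
    ∫ s, f s ∂m = (1 - α) * ∫ s, f (α * s) ∂m + α * ∫ s, f (1 + (s - 1) * (1 - α)) ∂m := by
  obtain ⟨hp, hm, hs⟩ := h
  have e1 : AEMeasurable (fun x => α * x) m := by fun_prop
  have e2 : AEMeasurable (fun x => 1 + (x - 1) * (1 - α)) m := by fun_prop
  have i1 : Integrable f (m.map fun x => α * x) :=
    (integrable_map_measure hf.aestronglyMeasurable e1).2
      (Continuous.integrable_of_Icc hm (by fun_prop))
  have i2 : Integrable f (m.map fun x => 1 + (x - 1) * (1 - α)) :=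
    (integrable_map_measure hf.aestronglyMeasurable e2).2
      (Continuous.integrable_of_Icc hm (by fun_prop))
  conv_lhs => rw [hs]
  rw [integral_add_measure (i1.smul_measure ENNReal.ofReal_ne_top)
    (i2.smul_measure ENNReal.ofReal_ne_top), integral_smul_measure, integral_smul_measure,
    integral_map e1 hf.aestronglyMeasurable, integral_map e2 hf.aestronglyMeasurable]
  simp only [measureWeight, Matrix.cons_val_zero, Matrix.cons_val_one]
  rw [ENNReal.toReal_ofReal (by linarith), ENNReal.toReal_ofReal h0.le]
  simp only [Complex.real_smul]
  push_cast
  ring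

/-- The string is the concatenation of two scaled copies of itself. -/
lemma IsSelfSimilarMeasure.stringTransfer_eq_double (h : IsSelfSimilarMeasure α m) (h0 : 0 < α)
    (h1 : α < 1) (l : ℂ) :
    stringTransfer m l = (stringTransfer m (((α * (1 - α) : ℝ) : ℂ) * l)).double α := by
  obtain ⟨hp, hm, -⟩ := id h
  set l' : ℂ := ((α * (1 - α) : ℝ) : ℂ) * l with hl'
  have hα : (α : ℂ) ≠ 0 := by exact_mod_cast h0.ne'
  have hα1 : 0 < 1 - α := sub_pos.2 h1
  have hα' : ((1 - α : ℝ) : ℂ) ≠ 0 := by exact_mod_cast hα1.ne'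
  have key : ∀ u p, (stringTransfer m l).fst u p = ((stringTransfer m l').double α).fst u p ∧
      (stringTransfer m l).snd u p = ((stringTransfer m l').double α).snd u p := by
    intro u p
    set f := stringSol m l u p with hfdef
    have hf : IsStringSol m l u p f := isStringSol_stringSol hm l u p
    have hfc := hf.cont
    -- The left piece has length α and mass 1 - α, hence the parameter l' = α(1-α) l; the mass of
    -- the right piece lies beyond the kernel.
    have hL : IsStringSol m l' u (α * p) fun x => f (α * x) := by
      refine ⟨by fun_prop, fun x hx => ?_⟩
      have hαx : α * x ∈ Set.Icc (0 : ℝ) 1 :=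
        ⟨mul_nonneg h0.le hx.1, mul_le_one₀ h1.le hx.1 hx.2⟩
      rw [hf.eq _ hαx, h.integral_eq h0 h1 (continuous_kernel_smul hfc _)]
      have z : ∫ s, max (α * x - (1 + (s - 1) * (1 - α))) 0 • f (1 + (s - 1) * (1 - α)) ∂m = 0 := by
        refine integral_eq_zero_of_ae ?_
        filter_upwards [ae_mem_Icc hm] with s hs
        rw [max_eq_right (by nlinarith [hs.1, hx.2]), zero_smul]; rfl
      have e : ∀ s, max (α * x - α * s) 0 • f (α * s) = (α : ℂ) * (max (x - s) 0 • f (α * s)) := by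
        intro s
        rw [← mul_sub, ← mul_zero α, ← mul_max_of_nonneg _ _ h0.le, mul_zero, mul_smul,
          Complex.real_smul]
      rw [z]
      simp only [e]
      rw [integral_const_mul, hl']
      simp only [Complex.real_smul]
      push_cast
      ring
    -- The derivative after all the mass of the left piece has been passed: the initial derivative
    -- of the right piece, before rescaling.
    set pL : ℂ := p + l * ((1 - α : ℝ) * ∫ s, f (α * s) ∂m) with hpL
    -- Length 1 - α and mass α give the same parameter l'. The left piece contributes a linear term,
    -- absorbed in pL.
    have hR : IsStringSol m l' (f α) ((1 - α : ℝ) * pL) fun x => f (1 + (x - 1) * (1 - α)) := by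
      refine ⟨by fun_prop, fun x hx => ?_⟩
      have hx' : 1 + (x - 1) * (1 - α) ∈ Set.Icc (0 : ℝ) 1 :=
        ⟨by nlinarith [hx.1], by nlinarith [hx.2]⟩
      rw [hf.eq _ hx', hf.eq α ⟨h0.le, h1.le⟩, h.integral_eq h0 h1 (continuous_kernel_smul hfc _),
        h.integral_eq h0 h1 (continuous_kernel_smul hfc _)]
      have z : ∫ s, max (α - (1 + (s - 1) * (1 - α))) 0 • f (1 + (s - 1) * (1 - α)) ∂m = 0 := by
        refine integral_eq_zero_of_ae ?_
        filter_upwards [ae_mem_Icc hm] with s hs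
        rw [max_eq_right (by nlinarith [hs.1]), zero_smul]; rfl
      have e : ∀ s, max (1 + (x - 1) * (1 - α) - (1 + (s - 1) * (1 - α))) 0 •
          f (1 + (s - 1) * (1 - α)) =
          ((1 - α : ℝ) : ℂ) * (max (x - s) 0 • f (1 + (s - 1) * (1 - α))) := by
        intro s
        rw [show 1 + (x - 1) * (1 - α) - (1 + (s - 1) * (1 - α)) = (1 - α) * (x - s) by ring,
          ← mul_zero (1 - α), ← mul_max_of_nonneg _ _ hα1.le, mul_zero, mul_smul,
          Complex.real_smul]
      have e' : ∫ s, max (1 + (x - 1) * (1 - α) - α * s) 0 • f (α * s) ∂m =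
          ∫ s, max (α - α * s) 0 • f (α * s) ∂m + ((1 - α) * x : ℝ) * ∫ s, f (α * s) ∂m := by
        rw [← integral_const_mul, ← integral_add]
        · refine integral_congr_ae ?_
          filter_upwards [ae_mem_Icc hm] with s hs
          rw [max_eq_left (by nlinarith [hs.2, hx.1, mul_nonneg hα1.le hx.1]),
            max_eq_left (by nlinarith [hs.2]), Complex.real_smul, Complex.real_smul]
          push_cast
          ring
        · exact Continuous.integrable_of_Icc hm (by fun_prop)
        · exact Continuous.integrable_of_Icc hm (by fun_prop)
      rw [z, e']
      simp only [e]
      rw [integral_const_mul, hl', hpL]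
      simp only [Complex.real_smul]
      push_cast
      ring
    have e1 := hL.eq_fst hm
    have e2 := hL.eq_snd hm
    have e3 := hR.eq_fst hm
    have e4 := hR.eq_snd hm
    have e5 := hf.eq_fst hm
    have e6 := hf.eq_snd hm
    simp only [mul_one] at e1
    simp only [sub_self, zero_mul, add_zero] at e3
    have hpL' : ((stringTransfer m l').scale α).snd u p = pL := by
      rw [scale_snd h0, ← e2, hpL, hl']
      field_simp
      push_cast
      ring
    rw [double, comp_fst, comp_snd, hpL', scale_fst, scale_fst, scale_snd hα1, ← e1, ← e3, ← e4,
      ← e5, ← e6, h.integral_eq h0 h1 hfc]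
    refine ⟨rfl, ?_⟩
    rw [hpL, hl', eq_div_iff hα']
    push_cast
    ring
  have k1 := key 1 0
  have k2 := key 0 1
  simp only [fst, snd, mul_one, mul_zero, add_zero, zero_add] at k1 k2
  exact Transfer.ext k1.1 k2.1 k1.2 k2.2

/-- For the string, doubling merely rescales the spectral parameter, so the spectra of all levels
are zero sets of the same two entire functions. -/
lemma IsSelfSimilarMeasure.double_iterate_stringTransfer (h : IsSelfSimilarMeasure α m)
    (h0 : 0 < α) (h1 : α < 1) (n : ℕ) (l : ℂ) :
    (double α)^[n] (stringTransfer m l) =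
      stringTransfer m ((((α * (1 - α)) ^ n)⁻¹ : ℝ) * l) := by
  have hγ : 0 < α * (1 - α) := mul_pos h0 (sub_pos.2 h1)
  induction n with
  | zero => simp
  | succ n ih =>
    rw [Function.iterate_succ_apply', ih, h.stringTransfer_eq_double h0 h1
      ((((α * (1 - α)) ^ (n + 1))⁻¹ : ℝ) * l), ← mul_assoc, ← Complex.ofReal_mul]
    congr 4
    have := (sub_pos.2 h1).ne'
    rw [pow_succ']
    field_simp

/-- A solution that vanishes m-almost everywhere equals u + sp there, by its own equation. This
vanishes a.e. only if u = p = 0, since m is not a point mass. -/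
lemma IsSelfSimilarMeasure.integral_norm_sq_stringSol_pos (h : IsSelfSimilarMeasure α m)
    (h0 : 0 < α) (h1 : α < 1) {l u p : ℂ} (hup : u ≠ 0 ∨ p ≠ 0) :
    0 < ∫ s, ‖stringSol m l u p s‖ ^ 2 ∂m := by
  obtain ⟨hp, hm, -⟩ := id h
  have hf := isStringSol_stringSol hm l u p
  have hfc := hf.cont
  refine lt_of_le_of_ne (integral_nonneg fun _ => by positivity) fun h2 => ?_
  have h3 := (integral_eq_zero_iff_of_nonneg (fun s => by positivity)
    (Continuous.integrable_of_Icc hm (by fun_prop))).1 h2.symm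
  have h4 : ∀ᵐ s ∂m, stringSol m l u p s = 0 := by
    filter_upwards [h3] with s hs
    simpa using hs
  have h5 : ∀ᵐ s : ℝ ∂m, u + s * p = 0 := by
    filter_upwards [h4, ae_mem_Icc hm] with s hs hs1
    have h6 : ∫ t, max (s - t) 0 • stringSol m l u p t ∂m = 0 := by
      refine integral_eq_zero_of_ae ?_
      filter_upwards [h4] with t ht
      rw [ht, smul_zero]; rfl
    rw [hf.eq s hs1, h6] at hs
    simpa using hs
  obtain ⟨s, hs⟩ := h5.exists
  have hp0 : p ≠ 0 := by
    rintro rfl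
    simp_all
  refine h.measure_compl_singleton_ne_zero h0 h1 s ?_
  have : ∀ᵐ t ∂m, t = s := by
    filter_upwards [h5] with t ht
    have : ((t : ℂ) - s) * p = 0 := by linear_combination ht - hs
    exact_mod_cast sub_eq_zero.1 ((mul_eq_zero.1 this).resolve_right hp0)
  exact this

lemma IsSelfSimilarMeasure.isTransferFamily (h : IsSelfSimilarMeasure α m) (h0 : 0 < α)
    (h1 : α < 1) :
    IsTransferFamily (stringTransfer m) fun l u p => ∫ s, ‖stringSol m l u p s‖ ^ 2 ∂m := by
  obtain ⟨hp, hm, -⟩ := id h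
  have d1 := differentiable_volterraSeries hm (f := fun _ => 1) (by simp) 1
  have d2 := differentiable_volterraSeries hm norm_clip_le 1
  have d3 := differentiable_integral_volterraSeries hm (f := fun _ => 1) continuous_const (by simp)
  have d4 := differentiable_integral_volterraSeries hm continuous_ofReal_clip norm_clip_le
  refine ⟨?_, ?_, ?_, ?_, det_stringTransfer hm, flux_stringTransfer_sub hm, ?_, ?_,
    fun l u p hup => h.integral_norm_sq_stringSol_pos h0 h1 hup⟩
  · simpa [stringTransfer, stringSol] using d1
  · simpa [stringTransfer, stringSol] using d2
  · simpa [stringTransfer, stringSol] using (differentiable_fun_id (𝕜 := ℂ)).fun_mul d3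
  · simpa [stringTransfer, stringSol] using ((differentiable_fun_id (𝕜 := ℂ)).fun_mul d4).const_add 1
  · have hc : Continuous fun y : (ℂ × ℂ × ℂ) × ℝ => ‖stringSol m y.1.1 y.1.2.1 y.1.2.2 y.2‖ ^ 2 :=
      (continuous_stringSol hm).norm.pow 2
    have := continuous_parametric_integral_of_continuous (μ := m) (s := Set.Icc (0 : ℝ) 1)
      (f := fun (y : ℂ × ℂ × ℂ) s => ‖stringSol m y.1 y.2.1 y.2.2 s‖ ^ 2) hc isCompact_Icc
    rwa [Measure.restrict_eq_self_of_ae_mem (ae_mem_Icc hm)] at this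
  · intro l c u p
    have : ∀ s, ‖stringSol m l (c * u) (c * p) s‖ ^ 2 = ‖c‖ ^ 2 * ‖stringSol m l u p s‖ ^ 2 := by
      intro s
      rw [← mul_pow, ← norm_mul]
      congr 2
      simp only [stringSol]
      ring
    simp only [this]
    rw [integral_const_mul]

end

open Transfer

/-! ### Eigenfunctions of the string -/

lemma IsStringSol.ofReal {m : Measure ℝ} {l u p : ℝ} {f : ℝ → ℝ} (hf : IsStringSol m l u p f) :
    IsStringSol m (l : ℂ) (u : ℂ) (p : ℂ) fun x => (f x : ℂ) := by
  refine ⟨Complex.continuous_ofReal.comp hf.cont, fun x hx => ?_⟩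
  have : ∀ s, max (x - s) 0 • (f s : ℂ) = ((max (x - s) 0 • f s : ℝ) : ℂ) := fun s => by
    rw [Complex.real_smul, smul_eq_mul, Complex.ofReal_mul]
  simp only [this]
  rw [hf.eq x hx, integral_complex_ofReal]
  simp

/-- The real solution of the string equation with initial data `u`, `p`. -/
def realSol (m : Measure ℝ) (l u p : ℝ) (x : ℝ) : ℝ := (stringSol m l u p x).re

namespace InDomain

variable {f g h k : ℝ → ℝ}

lemma integrableOn (hf : InDomain f g) : IntegrableOn g (Set.Icc 0 1) :=
  hf.2.1.integrable one_le_two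

lemma continuousOn (hf : InDomain f g) : ContinuousOn f (Set.Icc 0 1) := by
  have := intervalIntegral.continuousOn_primitive_interval (μ := volume) (f := g) (a := 0) (b := 1)
    (by rw [Set.uIcc_of_le zero_le_one]; exact hf.integrableOn)
  rw [Set.uIcc_of_le zero_le_one] at this
  exact (continuousOn_const.add this).congr hf.2.2

lemma of_integral {k : ℝ → ℝ} (hk : MemLp k 2 (volume.restrict (Set.Icc 0 1))) (c : ℝ) :
    InDomain ((Set.Icc (0 : ℝ) 1).indicator fun x => c + ∫ t in (0 : ℝ)..x, k t) k := by
  refine ⟨fun x hx => Set.indicator_of_notMem hx _, hk, fun x hx => ?_⟩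
  rw [Set.indicator_of_mem hx, Set.indicator_of_mem (by simp)]
  simp

end InDomain

lemma integral_indicator_mul {m : Measure ℝ} (hm : m (Set.Icc 0 1)ᶜ = 0) (f h : ℝ → ℝ) :
    ∫ s, (Set.Icc (0 : ℝ) 1).indicator f s * h s ∂m = ∫ s, f s * h s ∂m := by
  refine integral_congr_ae ?_
  filter_upwards [ae_mem_Icc hm] with s hs
  rw [Set.indicator_of_mem hs]

lemma realSol_mul (m : Measure ℝ) (l u p c : ℝ) :
    realSol m l (c * u) (c * p) = c • realSol m l u p := by
  funext x
  simp only [realSol, stringSol, Pi.smul_apply, smul_eq_mul]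
  rw [← Complex.re_ofReal_mul]
  push_cast
  ring_nf

/-- The products over ω in energy and mass cancel up to (α(1-α))ⁿ, so level n is level 0 at a
rescaled eigenvalue. -/
lemma energy_eq_level_iff {α : ℝ} (h0 : 0 < α) (h1 : α < 1) (ω : ℕ → Fin 2) (n : ℕ) (m : Measure ℝ)
    (a x : ℝ) (F : ℝ → ℝ) :
    (∏ i ∈ Finset.range n, energyWeight α (ω i)) * a = -x * ∫ t, F t ∂(levelMeasure α m ω n) ↔
      a = -(((α * (1 - α)) ^ n)⁻¹ * x) * ∫ t, F t ∂m := by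
  have hE : 0 < ∏ i ∈ Finset.range n, energyWeight α (ω i) :=
    Finset.prod_pos fun i _ => energyWeight_pos h0 h1 _
  have hγ : 0 < (α * (1 - α)) ^ n := pow_pos (mul_pos h0 (sub_pos.2 h1)) n
  rw [levelMeasure, integral_smul_measure, prod_measureWeight_inv h0 h1,
    ENNReal.toReal_ofReal (by positivity), smul_eq_mul]
  constructor
  · intro h
    refine mul_left_cancel₀ hE.ne' (h.trans ?_)
    ring
  · rintro rfl
    ring

lemma isDirichletEigen_iff {α : ℝ} {m : Measure ℝ} (h0 : 0 < α) (h1 : α < 1) (ω : ℕ → Fin 2) (n : ℕ) (x : ℝ) (f : ℝ → ℝ) :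
    IsDirichletEigen α m ω n x f ↔ ∃ g, InDomain f g ∧ f 0 = 0 ∧ f 1 = 0 ∧
      ∀ h k, InDomain h k → h 0 = 0 → h 1 = 0 → ∫ t in (0 : ℝ)..1, g t * k t =
        -(((α * (1 - α)) ^ n)⁻¹ * x) * ∫ s, f s * h s ∂m := by
  simp only [IsDirichletEigen, energy_eq_level_iff h0 h1]

lemma isNeumannEigen_iff {α : ℝ} {m : Measure ℝ} (h0 : 0 < α) (h1 : α < 1) (ω : ℕ → Fin 2) (n : ℕ) (x : ℝ) (f : ℝ → ℝ) :
    IsNeumannEigen α m ω n x f ↔ ∃ g, InDomain f g ∧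
      ∀ h k, InDomain h k → ∫ t in (0 : ℝ)..1, g t * k t =
        -(((α * (1 - α)) ^ n)⁻¹ * x) * ∫ s, f s * h s ∂m := by
  simp only [IsNeumannEigen, energy_eq_level_iff h0 h1]

lemma finrank_span_eq_ite {V : Type*} [AddCommGroup V] [Module ℝ V] {T : Set V} {P : Prop}
    [Decidable P] {v : V} (hv : v ≠ 0) (h1 : P → v ∈ T) (h2 : ∀ s ∈ T, ∃ c : ℝ, s = c • v ∧ (P ∨ c = 0)) :
    Module.finrank ℝ (Submodule.span ℝ T) = if P then 1 else 0 := by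
  refine finrank_eq_ite (v := v) (fun h => ⟨Submodule.subset_span (h1 h), hv⟩) (fun s hs => ?_)
    fun hP s hs => ?_
  · have : Submodule.span ℝ T ≤ Submodule.span ℝ {v} := Submodule.span_le.2 fun t ht => by
      obtain ⟨c, rfl, -⟩ := h2 t ht
      exact Submodule.smul_mem _ _ (Submodule.mem_span_singleton_self v)
    obtain ⟨c, hc⟩ := Submodule.mem_span_singleton.1 (this hs)
    exact ⟨c, hc.symm⟩
  · have : Submodule.span ℝ T ≤ ⊥ := Submodule.span_le.2 fun t ht => by
      obtain ⟨c, rfl, hc⟩ := h2 t ht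
      simp [hc.resolve_left hP]
    exact (Submodule.mem_bot ℝ).1 (this hs)

section

variable {m : Measure ℝ} [IsProbabilityMeasure m]

lemma isStringSol_realSol (hm : m (Set.Icc 0 1)ᶜ = 0) (l u p : ℝ) :
    IsStringSol m l u p (realSol m l u p) := (isStringSol_stringSol hm l u p).re hm

lemma integrable_of_continuousOn_Icc (hm : m (Set.Icc 0 1)ᶜ = 0) {f : ℝ → ℝ}
    (hf : ContinuousOn f (Set.Icc 0 1)) : Integrable f m := by
  rw [← Measure.restrict_eq_self_of_ae_mem (ae_mem_Icc hm)]
  exact hf.integrableOn_compact isCompact_Icc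

lemma IsStringSol.inDomain (hm : m (Set.Icc 0 1)ᶜ = 0) {l u p : ℝ} {f : ℝ → ℝ}
    (hf : IsStringSol m l u p f) :
    InDomain ((Set.Icc (0 : ℝ) 1).indicator f) (slope m l p f) := by
  refine ⟨fun x hx => Set.indicator_of_notMem hx _, hf.memLp_slope hm, fun x hx => ?_⟩
  rw [Set.indicator_of_mem hx, Set.indicator_of_mem (by simp), hf.zero_eq hm,
    hf.eq_integral_slope hm hx]

/-- A weak solution is a solution. -/
lemma InDomain.exists_eq_realSol (hm : m (Set.Icc 0 1)ᶜ = 0) {f g : ℝ → ℝ} (hf : InDomain f g)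
    {l : ℝ} (hw : ∀ h k, InDomain h k → h 0 = 0 → h 1 = 0 →
      ∫ t in (0 : ℝ)..1, g t * k t = -l * ∫ s, f s * h s ∂m) :
    ∃ p : ℝ, f = (Set.Icc (0 : ℝ) 1).indicator (realSol m l (f 0) p) ∧
      ∀ᵐ t ∂volume.restrict (Set.Icc (0 : ℝ) 1), g t = slope m l p (realSol m l (f 0) p) t := by
  have hfi : Integrable f m := integrable_of_continuousOn_Icc hm hf.continuousOn
  set P : ℝ → ℝ := fun t => l * ∫ s in Set.Iic t, f s ∂m with hP
  have hPi : IntegrableOn P (Set.Icc 0 1) := (integrableOn_integral_Iic hfi 1).const_mul l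
  have hPm : MemLp P 2 (volume.restrict (Set.Icc 0 1)) := by
    refine MemLp.of_bound hPi.aestronglyMeasurable (‖l‖ * ∫ s, ‖f s‖ ∂m)
      (Eventually.of_forall fun t => ?_)
    rw [hP, norm_mul]
    gcongr
    exact (norm_integral_le_integral_norm _).trans
      (setIntegral_le_integral hfi.norm (Eventually.of_forall fun _ => norm_nonneg _))
  set c : ℝ := ∫ t in (0 : ℝ)..1, (g t - P t) with hc
  -- The du Bois-Reymond argument: g minus its expected value P, made mean-free so that its
  -- primitive vanishes at both ends. Testing with this primitive yields ∫ k² = 0.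
  set k : ℝ → ℝ := fun t => g t - P t - c with hk
  have hkm : MemLp k 2 (volume.restrict (Set.Icc 0 1)) := (hf.2.1.sub hPm).sub (memLp_const c)
  have hgP : IntervalIntegrable (fun t => g t - P t) volume 0 1 := by
    rw [intervalIntegrable_iff_integrableOn_Icc_of_le zero_le_one]
    exact hf.integrableOn.sub hPi
  have hk0 : ∫ t in (0 : ℝ)..1, k t = 0 := by
    rw [hk, intervalIntegral.integral_sub hgP intervalIntegrable_const, ← hc]
    simp
  have hki : IntegrableOn k (Set.Icc 0 1) := hkm.integrable one_le_two
  have hkI : ∀ a ∈ Set.Icc (0 : ℝ) 1, ∀ b ∈ Set.Icc (0 : ℝ) 1, IntervalIntegrable k volume a b :=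
    fun a ha b hb => (hki.mono_set (Set.uIcc_subset_Icc ha hb)).intervalIntegrable
  have h0 : (0 : ℝ) ∈ Set.Icc (0 : ℝ) 1 := by simp
  have h1 : (1 : ℝ) ∈ Set.Icc (0 : ℝ) 1 := by simp
  have hd := InDomain.of_integral hkm 0
  have e1 := hw _ _ hd (by simp) (by simp [hk0])
  have e2 := integral_Iic_mul hm hfi zero_le_one hki
  have e3 : ∫ t in (0 : ℝ)..1, P t * k t = ∫ t in (0 : ℝ)..1, g t * k t := by
    simp only [hP, mul_assoc]
    rw [intervalIntegral.integral_const_mul, e2, e1, neg_mul, ← mul_neg, ← integral_neg]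
    congr 1
    refine integral_congr_ae ?_
    filter_upwards [ae_mem_Icc hm] with s hs
    rw [if_pos hs.2, Set.indicator_of_mem hs,
      ← intervalIntegral.integral_interval_sub_left (hkI 0 h0 1 h1) (hkI 0 h0 s hs), hk0]
    ring
  have toI : ∀ {q : ℝ → ℝ}, MemLp q 2 (volume.restrict (Set.Icc 0 1)) →
      IntervalIntegrable (fun t => q t * k t) volume 0 1 := fun hq => by
    rw [intervalIntegrable_iff_integrableOn_Icc_of_le zero_le_one]
    exact hq.integrable_mul hkm
  have e4 : ∫ t in (0 : ℝ)..1, k t * k t = 0 := by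
    have : ∀ t, k t * k t = g t * k t - P t * k t - c * k t := fun t => by simp only [hk]; ring
    simp only [this]
    rw [intervalIntegral.integral_sub ((toI hf.2.1).sub (toI hPm)) ((hkI 0 h0 1 h1).const_mul c),
      intervalIntegral.integral_sub (toI hf.2.1) (toI hPm), intervalIntegral.integral_const_mul, hk0,
      e3]
    ring
  rw [intervalIntegral.integral_of_le zero_le_one, ← integral_Icc_eq_integral_Ioc,
    integral_eq_zero_iff_of_nonneg (fun t => mul_self_nonneg _) (hkm.integrable_mul hkm)] at e4
  have e5 : ∀ᵐ t ∂volume.restrict (Set.Icc (0 : ℝ) 1), g t = c + P t := by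
    filter_upwards [e4] with t ht
    have := mul_self_eq_zero.1 ht
    simp only [hk] at this
    linarith
  have e6 : ∀ x ∈ Set.Icc (0 : ℝ) 1, f x = f 0 + x • c + l * ∫ s, max (x - s) 0 • f s ∂m := by
    intro x hx
    have e7 : ∫ t in (0 : ℝ)..x, g t = ∫ t in (0 : ℝ)..x, (c + P t) := by
      rw [intervalIntegral.integral_of_le hx.1, intervalIntegral.integral_of_le hx.1]
      refine integral_congr_ae ?_
      exact ae_restrict_of_ae_restrict_of_subset
        (Set.Ioc_subset_Icc_self.trans (Set.Icc_subset_Icc_right hx.2)) e5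
    have e8 := integral_Iic_mul hm (k := fun _ => 1) hfi hx.1 (integrable_const _)
    have hPx : IntervalIntegrable P volume 0 x := by
      rw [intervalIntegrable_iff_integrableOn_Icc_of_le hx.1]
      exact hPi.mono_set (Set.Icc_subset_Icc_right hx.2)
    rw [hf.2.2 x hx, e7, intervalIntegral.integral_add intervalIntegrable_const hPx,
      intervalIntegral.integral_const, hP, intervalIntegral.integral_const_mul, sub_zero, ← add_assoc]
    simp only [mul_one] at e8
    rw [e8]
    congr 2
    refine integral_congr_ae (Eventually.of_forall fun s => ?_)
    simp only
    split_ifs with hs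
    · rw [max_eq_left (by linarith), intervalIntegral.integral_const, smul_eq_mul, smul_eq_mul,
        mul_one, mul_comm]
    · rw [max_eq_right (by linarith), zero_smul, mul_zero]
  have e7 := (isStringSol_realSol hm l (f 0) c).eqOn hm hf.continuousOn e6
  refine ⟨c, funext fun x => ?_, ?_⟩
  · by_cases hx : x ∈ Set.Icc (0 : ℝ) 1
    · rw [Set.indicator_of_mem hx, e7 x hx]
    · rw [Set.indicator_of_notMem hx, hf.1 x hx]
  · filter_upwards [e5] with t ht
    have e8 : ∫ s in Set.Iic t, f s ∂m = ∫ s in Set.Iic t, realSol m l (f 0) c s ∂m := by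
      refine integral_congr_ae ?_
      filter_upwards [ae_restrict_of_ae (ae_mem_Icc hm)] with s hs
      exact e7 s hs
    rw [ht, slope, hP, ← e8]

lemma InDomain.integral_slope_mul (hm : m (Set.Icc 0 1)ᶜ = 0) {l u p : ℝ} {f : ℝ → ℝ}
    (hf : IsStringSol m l u p f) {h k : ℝ → ℝ} (hh : InDomain h k) :
    ∫ t in (0 : ℝ)..1, slope m l p f t * k t =
      slope m l p f 1 * h 1 - p * h 0 - l * ∫ s, f s * h s ∂m :=
  hf.integral_slope_mul hm hh.integrableOn hh.2.2

/-! ### Multiplicities of the eigenvalues -/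

lemma realSol_one_eq_zero_iff (hm : m (Set.Icc 0 1)ᶜ = 0) (l p : ℝ) :
    realSol m l 0 p 1 = 0 ↔ (stringTransfer m l).b = 0 ∨ p = 0 := by
  have h := (isStringSol_realSol hm l 0 p).ofReal.eq_fst hm
  simp only [fst, Complex.ofReal_zero, mul_zero, zero_add] at h
  rw [← Complex.ofReal_eq_zero, h, mul_eq_zero, Complex.ofReal_eq_zero]

lemma slope_realSol_one_eq_zero_iff (hm : m (Set.Icc 0 1)ᶜ = 0) (l u : ℝ) :
    slope m l 0 (realSol m l u 0) 1 = 0 ↔ (stringTransfer m l).c = 0 ∨ u = 0 := by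
  have h := (isStringSol_realSol hm l u 0).ofReal.eq_snd hm
  simp only [snd, Complex.ofReal_zero, mul_zero, add_zero] at h
  rw [slope_one hm, ← Complex.ofReal_eq_zero, Complex.ofReal_add, Complex.ofReal_mul,
    ← integral_complex_ofReal, Complex.ofReal_zero, h, mul_eq_zero, Complex.ofReal_eq_zero]

variable {α : ℝ}

lemma IsDirichletEigen.exists_eq (hm : m (Set.Icc 0 1)ᶜ = 0) (h0 : 0 < α) (h1 : α < 1)
    {ω : ℕ → Fin 2} {n : ℕ} {x : ℝ} {f : ℝ → ℝ} (hf : IsDirichletEigen α m ω n x f) {l : ℝ}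
    (hl : l = ((α * (1 - α)) ^ n)⁻¹ * x) :
    ∃ p : ℝ, f = p • (Set.Icc (0 : ℝ) 1).indicator (realSol m l 0 1) ∧
      ((stringTransfer m l).b = 0 ∨ p = 0) := by
  obtain ⟨g, hd, hf0, hf1, hw⟩ := (isDirichletEigen_iff h0 h1 ω n x f).1 hf
  rw [← hl] at hw
  obtain ⟨p, hp, -⟩ := hd.exists_eq_realSol hm hw
  rw [hf0] at hp
  refine ⟨p, ?_, ?_⟩
  · have := realSol_mul m l 0 1 p
    rw [mul_zero, mul_one] at this
    rw [hp, this]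
    exact Set.indicator_const_smul (Set.Icc (0 : ℝ) 1) p (realSol m l 0 1)
  · rw [← realSol_one_eq_zero_iff hm]
    rw [hp, Set.indicator_of_mem (by simp)] at hf1
    exact hf1

lemma isDirichletEigen_of_b_eq_zero (hm : m (Set.Icc 0 1)ᶜ = 0) (h0 : 0 < α) (h1 : α < 1)
    {ω : ℕ → Fin 2} {n : ℕ} {x l : ℝ} (hl : l = ((α * (1 - α)) ^ n)⁻¹ * x)
    (hb : (stringTransfer m l).b = 0) :
    IsDirichletEigen α m ω n x ((Set.Icc (0 : ℝ) 1).indicator (realSol m l 0 1)) := by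
  have hs := isStringSol_realSol hm l 0 1
  rw [isDirichletEigen_iff h0 h1, ← hl]
  refine ⟨_, hs.inDomain hm, ?_, ?_, fun h k hh hh0 hh1 => ?_⟩
  · rw [Set.indicator_of_mem (by simp), hs.zero_eq hm]
  · rw [Set.indicator_of_mem (by simp), (realSol_one_eq_zero_iff hm l 1).2 (Or.inl hb)]
  · rw [hh.integral_slope_mul hm hs, hh0, hh1, integral_indicator_mul hm]
    ring

lemma IsNeumannEigen.exists_eq (hm : m (Set.Icc 0 1)ᶜ = 0) (h0 : 0 < α) (h1 : α < 1)
    {ω : ℕ → Fin 2} {n : ℕ} {x : ℝ} {f : ℝ → ℝ} (hf : IsNeumannEigen α m ω n x f) {l : ℝ}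
    (hl : l = ((α * (1 - α)) ^ n)⁻¹ * x) :
    ∃ u : ℝ, f = u • (Set.Icc (0 : ℝ) 1).indicator (realSol m l 1 0) ∧
      ((stringTransfer m l).c = 0 ∨ u = 0) := by
  obtain ⟨g, hd, hw⟩ := (isNeumannEigen_iff h0 h1 ω n x f).1 hf
  rw [← hl] at hw
  obtain ⟨p, hp, hg⟩ := hd.exists_eq_realSol hm fun h k hh _ _ => hw h k hh
  have hs := isStringSol_realSol hm l (f 0) p
  have hb : ∀ h k, InDomain h k → slope m l p (realSol m l (f 0) p) 1 * h 1 - p * h 0 = 0 := by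
    intro h k hh
    have e1 := hw h k hh
    have e2 := hh.integral_slope_mul hm hs
    have e3 : ∫ t in (0 : ℝ)..1, g t * k t =
        ∫ t in (0 : ℝ)..1, slope m l p (realSol m l (f 0) p) t * k t := by
      rw [intervalIntegral.integral_of_le zero_le_one, intervalIntegral.integral_of_le zero_le_one,
        ← integral_Icc_eq_integral_Ioc, ← integral_Icc_eq_integral_Ioc]
      refine integral_congr_ae ?_
      filter_upwards [hg] with t ht
      rw [ht]
    have e4 : ∫ s, f s * h s ∂m = ∫ s, realSol m l (f 0) p s * h s ∂m := by
      conv_lhs => rw [hp]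
      exact integral_indicator_mul hm _ _
    rw [e3, e2, e4] at e1
    linarith
  -- The test functions 1 and x isolate the two boundary terms, so both end derivatives vanish.
  have b1 := hb _ _ (InDomain.of_integral (memLp_const (0 : ℝ)) 1)
  have b2 := hb _ _ (InDomain.of_integral (memLp_const (1 : ℝ)) 0)
  simp at b1 b2
  have hp0 : p = 0 := by linarith
  subst hp0
  refine ⟨f 0, ?_, (slope_realSol_one_eq_zero_iff hm l (f 0)).1 b2⟩
  have := realSol_mul m l 1 0 (f 0)
  rw [mul_zero, mul_one] at this
  conv_lhs => rw [hp, this]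
  exact Set.indicator_const_smul (Set.Icc (0 : ℝ) 1) (f 0) (realSol m l 1 0)

lemma isNeumannEigen_of_c_eq_zero (hm : m (Set.Icc 0 1)ᶜ = 0) (h0 : 0 < α) (h1 : α < 1)
    {ω : ℕ → Fin 2} {n : ℕ} {x l : ℝ} (hl : l = ((α * (1 - α)) ^ n)⁻¹ * x)
    (hc : (stringTransfer m l).c = 0) :
    IsNeumannEigen α m ω n x ((Set.Icc (0 : ℝ) 1).indicator (realSol m l 1 0)) := by
  have hs := isStringSol_realSol hm l 1 0
  rw [isNeumannEigen_iff h0 h1, ← hl]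
  refine ⟨_, hs.inDomain hm, fun h k hh => ?_⟩
  rw [hh.integral_slope_mul hm hs, (slope_realSol_one_eq_zero_iff hm l 1).2 (Or.inl hc),
    integral_indicator_mul hm]
  ring

lemma indicator_realSol_ne_zero (hm : m (Set.Icc 0 1)ᶜ = 0) {l u p : ℝ} (hup : u ≠ 0 ∨ p ≠ 0) :
    (Set.Icc (0 : ℝ) 1).indicator (realSol m l u p) ≠ 0 := by
  intro h
  have hs := isStringSol_realSol hm l u p
  have hz : ∀ x ∈ Set.Icc (0 : ℝ) 1, realSol m l u p x = 0 := fun x hx => by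
    have := congrFun h x
    rwa [Set.indicator_of_mem hx] at this
  have hi : ∀ x : ℝ, ∫ s, max (x - s) 0 • realSol m l u p s ∂m = 0 := fun x => by
    refine integral_eq_zero_of_ae ?_
    filter_upwards [ae_mem_Icc hm] with s hs
    rw [hz s hs, smul_zero]; rfl
  have e0 := hs.eq 0 (by simp)
  have e1 := hs.eq 1 (by simp)
  rw [hi, hz _ (by simp)] at e0 e1
  simp at e0 e1
  rcases hup with hu | hp
  · exact hu e0.symm
  · exact hp (by linarith)

end

lemma IsSelfSimilarMeasure.contNuDirichlet_eq {α : ℝ} {m : Measure ℝ} (h : IsSelfSimilarMeasure α m)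
    (h0 : 0 < α) (h1 : α < 1) (ω : ℕ → Fin 2) (n : ℕ) :
    contNuDirichlet α m ω n = zeroMeasure fun x => ((double α)^[n] (stringTransfer m x)).b := by
  obtain ⟨hp, hm, -⟩ := id h
  unfold contNuDirichlet zeroMeasure
  congr 1
  funext x
  unfold zeroMult
  simp only [h.double_iterate_stringTransfer h0 h1, ← Complex.ofReal_mul]
  refine finrank_span_eq_ite (indicator_realSol_ne_zero hm (Or.inr one_ne_zero))
    (isDirichletEigen_of_b_eq_zero hm h0 h1 rfl) fun f hf => ?_
  exact IsDirichletEigen.exists_eq hm h0 h1 hf rfl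

lemma IsSelfSimilarMeasure.contNuNeumann_eq {α : ℝ} {m : Measure ℝ} (h : IsSelfSimilarMeasure α m)
    (h0 : 0 < α) (h1 : α < 1) (ω : ℕ → Fin 2) (n : ℕ) :
    contNuNeumann α m ω n = zeroMeasure fun x => ((double α)^[n] (stringTransfer m x)).c := by
  obtain ⟨hp, hm, -⟩ := id h
  unfold contNuNeumann zeroMeasure
  congr 1
  funext x
  unfold zeroMult
  simp only [h.double_iterate_stringTransfer h0 h1, ← Complex.ofReal_mul]
  refine finrank_span_eq_ite (indicator_realSol_ne_zero hm (Or.inl one_ne_zero))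
    (isNeumannEigen_of_c_eq_zero hm h0 h1 rfl) fun f hf => ?_
  exact IsNeumannEigen.exists_eq hm h0 h1 hf rfl

open Transfer

/-! ### Real transfer matrices -/

/-- The real transfer matrix entry `a`. -/
def realA (m : Measure ℝ) (l : ℝ) : ℝ := (stringTransfer m l).a.re

/-- The real transfer matrix entry `b`. -/
def realB (m : Measure ℝ) (l : ℝ) : ℝ := (stringTransfer m l).b.re

/-- The real transfer matrix entry `c`. -/
def realC (m : Measure ℝ) (l : ℝ) : ℝ := (stringTransfer m l).c.re

/-- The real transfer matrix entry `d`. -/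
def realD (m : Measure ℝ) (l : ℝ) : ℝ := (stringTransfer m l).d.re

section

variable {m : Measure ℝ} [IsProbabilityMeasure m]

lemma IsStringSol.slope_ofReal (hm : m (Set.Icc 0 1)ᶜ = 0) {l u p : ℝ} {f : ℝ → ℝ}
    (hf : IsStringSol m l u p f) : ((slope m l p f 1 : ℝ) : ℂ) = (stringTransfer m l).snd u p := by
  rw [← hf.ofReal.eq_snd hm, slope_one hm, integral_complex_ofReal]
  push_cast
  ring

lemma ofReal_realA (hm : m (Set.Icc 0 1)ᶜ = 0) (l : ℝ) : (realA m l : ℂ) = (stringTransfer m l).a := by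
  have := (isStringSol_realSol hm l 1 0).ofReal.eq_fst hm
  simp only [fst, Complex.ofReal_one, Complex.ofReal_zero, mul_one, mul_zero, add_zero] at this
  rw [realA, ← this, Complex.ofReal_re]

lemma ofReal_realB (hm : m (Set.Icc 0 1)ᶜ = 0) (l : ℝ) : (realB m l : ℂ) = (stringTransfer m l).b := by
  have := (isStringSol_realSol hm l 0 1).ofReal.eq_fst hm
  simp only [fst, Complex.ofReal_one, Complex.ofReal_zero, mul_one, mul_zero, zero_add] at this
  rw [realB, ← this, Complex.ofReal_re]

lemma ofReal_realC (hm : m (Set.Icc 0 1)ᶜ = 0) (l : ℝ) : (realC m l : ℂ) = (stringTransfer m l).c := by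
  have := (isStringSol_realSol hm l 1 0).slope_ofReal hm
  simp only [snd, Complex.ofReal_one, Complex.ofReal_zero, mul_one, mul_zero, add_zero] at this
  rw [realC, ← this, Complex.ofReal_re]

lemma ofReal_realD (hm : m (Set.Icc 0 1)ᶜ = 0) (l : ℝ) : (realD m l : ℂ) = (stringTransfer m l).d := by
  have := (isStringSol_realSol hm l 0 1).slope_ofReal hm
  simp only [snd, Complex.ofReal_one, Complex.ofReal_zero, mul_one, mul_zero, zero_add] at this
  rw [realD, ← this, Complex.ofReal_re]

lemma IsStringSol.eq_real_fst (hm : m (Set.Icc 0 1)ᶜ = 0) {l u p : ℝ} {f : ℝ → ℝ}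
    (hf : IsStringSol m l u p f) : f 1 = realA m l * u + realB m l * p := by
  have := hf.ofReal.eq_fst hm
  rw [fst, ← ofReal_realA hm, ← ofReal_realB hm] at this
  exact_mod_cast this

lemma IsStringSol.slope_eq_real_snd (hm : m (Set.Icc 0 1)ᶜ = 0) {l u p : ℝ} {f : ℝ → ℝ}
    (hf : IsStringSol m l u p f) : slope m l p f 1 = realC m l * u + realD m l * p := by
  have := hf.slope_ofReal hm
  rw [snd, ← ofReal_realC hm, ← ofReal_realD hm] at this
  exact_mod_cast this

lemma real_det (hm : m (Set.Icc 0 1)ᶜ = 0) (l : ℝ) :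
    realA m l * realD m l - realB m l * realC m l = 1 := by
  have := det_stringTransfer hm l
  rw [det, ← ofReal_realA hm, ← ofReal_realB hm, ← ofReal_realC hm, ← ofReal_realD hm] at this
  exact_mod_cast this

lemma realSol_eq_stringSol (hm : m (Set.Icc 0 1)ᶜ = 0) (l u p : ℝ) {s : ℝ}
    (hs : s ∈ Set.Icc (0 : ℝ) 1) : (realSol m l u p s : ℂ) = stringSol m l u p s :=
  (isStringSol_stringSol hm l u p).eqOn' hm (isStringSol_realSol hm l u p).ofReal s hs

lemma continuous_realSol (hm : m (Set.Icc 0 1)ᶜ = 0) :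
    Continuous fun y : (ℝ × ℝ × ℝ) × ℝ => realSol m y.1.1 y.1.2.1 y.1.2.2 y.2 :=
  Complex.continuous_re.comp ((continuous_stringSol hm).comp (by fun_prop :
    Continuous fun y : (ℝ × ℝ × ℝ) × ℝ => (((y.1.1 : ℂ), (y.1.2.1 : ℂ), (y.1.2.2 : ℂ)), y.2)))

lemma continuous_integral_realSol_mul (hm : m (Set.Icc 0 1)ᶜ = 0) {f : ℝ → ℝ} (hf : Continuous f) :
    Continuous fun y : ℝ × ℝ × ℝ => ∫ s, realSol m y.1 y.2.1 y.2.2 s * f s ∂m := by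
  have hc : Continuous fun y : (ℝ × ℝ × ℝ) × ℝ => realSol m y.1.1 y.1.2.1 y.1.2.2 y.2 * f y.2 :=
    (continuous_realSol hm).mul (hf.comp continuous_snd)
  have := continuous_parametric_integral_of_continuous (μ := m) (s := Set.Icc (0 : ℝ) 1)
    (f := fun (y : ℝ × ℝ × ℝ) s => realSol m y.1 y.2.1 y.2.2 s * f s) hc isCompact_Icc
  rwa [Measure.restrict_eq_self_of_ae_mem (ae_mem_Icc hm)] at this

lemma continuousAt_integral_realSol_mul (hm : m (Set.Icc 0 1)ᶜ = 0) {p : ℝ → ℝ} {l u : ℝ}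
    (hp : ContinuousAt p l) {f : ℝ → ℝ} (hf : Continuous f) :
    ContinuousAt (fun t => ∫ s, realSol m t u (p t) s * f s ∂m) l := by
  have h2 : ContinuousAt (fun t => (t, u, p t)) l :=
    continuousAt_id.prodMk (continuousAt_const.prodMk hp)
  obtain ⟨g, hg, hgc⟩ : ∃ g : ℝ × ℝ × ℝ → ℝ,
      (∀ y, g y = ∫ s, realSol m y.1 y.2.1 y.2.2 s * f s ∂m) ∧ Continuous g :=
    ⟨_, fun _ => rfl, continuous_integral_realSol_mul hm hf⟩
  have h1 : ContinuousAt (fun t => g (t, u, p t)) l := hgc.continuousAt.comp h2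
  simpa only [hg] using h1

lemma continuous_realA (hm : m (Set.Icc 0 1)ᶜ = 0) : Continuous (realA m) := by
  have h : realA m = fun l => realSol m l 1 0 1 := funext fun l => by
    simp [(isStringSol_realSol hm l 1 0).eq_real_fst hm]
  rw [h]
  exact (continuous_realSol hm).comp (by fun_prop : Continuous fun l : ℝ => ((l, (1 : ℝ), (0 : ℝ)), (1 : ℝ)))

lemma continuous_realB (hm : m (Set.Icc 0 1)ᶜ = 0) : Continuous (realB m) := by
  have h : realB m = fun l => realSol m l 0 1 1 := funext fun l => by
    simp [(isStringSol_realSol hm l 0 1).eq_real_fst hm]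
  rw [h]
  exact (continuous_realSol hm).comp (by fun_prop : Continuous fun l : ℝ => ((l, (0 : ℝ), (1 : ℝ)), (1 : ℝ)))

lemma isStringSol_zero_linear (m : Measure ℝ) (u p : ℝ) :
    IsStringSol m 0 u p fun x => u + x * p :=
  ⟨by fun_prop, fun x _ => by simp⟩

lemma real_entries_zero (hm : m (Set.Icc 0 1)ᶜ = 0) :
    realA m 0 = 1 ∧ realB m 0 = 1 ∧ realD m 0 = 1 := by
  have h1 := (isStringSol_zero_linear m 1 0).eq_real_fst hm
  have h2 := (isStringSol_zero_linear m 0 1).eq_real_fst hm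
  have h3 := (isStringSol_zero_linear m 0 1).slope_eq_real_snd hm
  rw [slope_one hm] at h3
  simp at h1 h2 h3
  exact ⟨h1.symm, h2.symm, h3.symm⟩

/-- Lagrange's identity against 1 - s, the solution for l = 0 that vanishes at the right end. -/
lemma realB_sub_one (hm : m (Set.Icc 0 1)ᶜ = 0) (l : ℝ) :
    realB m l - 1 = l * ∫ s, realSol m l 0 1 s * (1 - s) ∂m := by
  have h1 := isStringSol_realSol hm l 0 1
  have h2 := isStringSol_zero_linear m 1 (-1)
  have h := h1.slope_one_mul_sub hm h2
  rw [h1.eq_real_fst hm, slope_one hm _ _ (fun x => _)] at h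
  have e : ∀ s : ℝ, 1 + s * -1 = 1 - s := fun s => by ring
  simp only [e, slope] at h
  simp at h
  linarith

/-! ### Neumann energy of the solution with boundary values `1` -/

/-- The solution with boundary values `1`. -/
def flatSol (m : Measure ℝ) (l : ℝ) : ℝ → ℝ := realSol m l 1 ((1 - realA m l) / realB m l)

/-- The total flux of the solution with boundary values `1`. -/
def flatFlux (m : Measure ℝ) (l : ℝ) : ℝ := (realA m l + realD m l - 2) / realB m l

/-- Both solutions equal 1 at both ends, so the boundary terms of Lagrange's identity reduce to the
difference of total fluxes. -/
lemma flatFlux_sub (hm : m (Set.Icc 0 1)ᶜ = 0) {l l' : ℝ} (hl : realB m l ≠ 0)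
    (hl' : realB m l' ≠ 0) :
    flatFlux m l - flatFlux m l' = (l - l') * ∫ s, flatSol m l s * flatSol m l' s ∂m := by
  have h1 := isStringSol_realSol hm l 1 ((1 - realA m l) / realB m l)
  have h2 := isStringSol_realSol hm l' 1 ((1 - realA m l') / realB m l')
  have h := h1.slope_one_mul_sub hm h2
  rw [h1.eq_real_fst hm, h2.eq_real_fst hm, h1.slope_eq_real_snd hm, h2.slope_eq_real_snd hm] at h
  have e1 : ∀ t, realB m t ≠ 0 → realC m t * 1 + realD m t * ((1 - realA m t) / realB m t) =
      (realD m t - 1) / realB m t := fun t ht => by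
    field_simp
    linear_combination -real_det hm t
  rw [e1 l hl, e1 l' hl', mul_div_cancel₀ _ hl, mul_div_cancel₀ _ hl'] at h
  rw [flatSol, flatSol, ← h, flatFlux, flatFlux]
  field_simp
  ring

/-- Divide `flatFlux_sub` by l - l' and use continuity; the derivative is an integral of a square.
-/
lemma hasDerivAt_flatFlux (hm : m (Set.Icc 0 1)ᶜ = 0) {l : ℝ} (hl : realB m l ≠ 0) :
    HasDerivAt (flatFlux m) (∫ s, flatSol m l s * flatSol m l s ∂m) l := by
  have hB := continuous_realB hm
  have hA := continuous_realA hm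
  rw [hasDerivAt_iff_tendsto_slope]
  have hc : ContinuousAt (fun t => ∫ s, flatSol m t s * flatSol m l s ∂m) l :=
    continuousAt_integral_realSol_mul hm
      ((continuousAt_const.sub hA.continuousAt).div hB.continuousAt hl)
      (isStringSol_realSol hm l 1 ((1 - realA m l) / realB m l)).cont
  refine (hc.tendsto.mono_left nhdsWithin_le_nhds).congr' ?_
  filter_upwards [nhdsWithin_le_nhds (hB.continuousAt.eventually_ne hl), self_mem_nhdsWithin]
    with t ht hne
  rw [slope_def_field, flatFlux_sub hm ht hl, mul_div_cancel_left₀ _ (sub_ne_zero.2 hne)]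

end

/-! ### The Dirichlet spectrum -/

namespace IsSelfSimilarMeasure

variable {α : ℝ} {m : Measure ℝ}

lemma integral_realSol_mul_self_pos (h : IsSelfSimilarMeasure α m) (h0 : 0 < α) (h1 : α < 1)
    {l u p : ℝ} (hup : u ≠ 0 ∨ p ≠ 0) :
    0 < ∫ s, realSol m l u p s * realSol m l u p s ∂m := by
  obtain ⟨hp, hm, -⟩ := id h
  have hpos := h.integral_norm_sq_stringSol_pos h0 h1 (l := l) (u := u) (p := p) (by simpa using hup)
  refine hpos.trans_eq (integral_congr_ae ?_)
  filter_upwards [ae_mem_Icc hm] with s hs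
  rw [← realSol_eq_stringSol hm l u p hs, Complex.norm_real, Real.norm_eq_abs, sq_abs, sq]

lemma realB_div (h : IsSelfSimilarMeasure α m) (h0 : 0 < α) (h1 : α < 1) (l : ℝ) :
    realB m l = realB m (α * (1 - α) * l) *
      (α * realA m (α * (1 - α) * l) + (1 - α) * realD m (α * (1 - α) * l)) := by
  obtain ⟨hp, hm, -⟩ := id h
  have := congrArg Transfer.b (h.stringTransfer_eq_double h0 h1 l)
  rw [← Complex.ofReal_mul, double_b, ← ofReal_realA hm, ← ofReal_realB hm, ← ofReal_realB hm,
    ← ofReal_realD hm] at this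
  exact_mod_cast this

/-- The quantity αa + (1-α)d is the factor by which b grows under doubling. With bc = ad - 1 it
obeys this trace-type recursion. -/
lemma mean_div (h : IsSelfSimilarMeasure α m) (h0 : 0 < α) (h1 : α < 1) (l : ℝ) :
    α * realA m l + (1 - α) * realD m l =
      (α * realA m (α * (1 - α) * l) + (1 - α) * realD m (α * (1 - α) * l)) *
        (realA m (α * (1 - α) * l) + realD m (α * (1 - α) * l)) - 1 := by
  obtain ⟨hp, hm, -⟩ := id h
  have h1' : (1 : ℝ) - α ≠ 0 := (sub_pos.2 h1).ne'
  have hα : (α : ℂ) ≠ 0 := by exact_mod_cast h0.ne'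
  have hα' : (1 - α : ℂ) ≠ 0 := by exact_mod_cast h1'
  have ea := congrArg Transfer.a (h.stringTransfer_eq_double h0 h1 l)
  have ed := congrArg Transfer.d (h.stringTransfer_eq_double h0 h1 l)
  have hdet := real_det hm (α * (1 - α) * l)
  rw [← Complex.ofReal_mul] at ea ed
  simp only [double, comp, scale] at ea ed
  rw [← ofReal_realA hm, ← ofReal_realA hm, ← ofReal_realB hm, ← ofReal_realC hm] at ea
  rw [← ofReal_realD hm, ← ofReal_realD hm, ← ofReal_realB hm, ← ofReal_realC hm] at ed
  have ea' : realA m l = realA m (α * (1 - α) * l) * realA m (α * (1 - α) * l) +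
      (1 - α) * realB m (α * (1 - α) * l) * (realC m (α * (1 - α) * l) / α) := by exact_mod_cast ea
  have ed' : realD m l = realC m (α * (1 - α) * l) / (1 - α) * (α * realB m (α * (1 - α) * l)) +
      realD m (α * (1 - α) * l) * realD m (α * (1 - α) * l) := by exact_mod_cast ed
  rw [ea', ed']
  field_simp
  linear_combination -hdet

/-- Otherwise m would live on {0,1}, but one of the contractions sends 0, the other sends 1, to the
inner point α. -/
lemma integral_mul_one_sub_pos (h : IsSelfSimilarMeasure α m) (h0 : 0 < α) (h1 : α < 1) :
    0 < ∫ s, s * (1 - s) ∂m := by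
  obtain ⟨hp, hm, hs⟩ := id h
  have hnn : 0 ≤ᵐ[m] fun s => s * (1 - s) := by
    filter_upwards [ae_mem_Icc hm] with s hs
    exact mul_nonneg hs.1 (sub_nonneg.2 hs.2)
  refine lt_of_le_of_ne (integral_nonneg_of_ae hnn) fun h2 => ?_
  have h3 := (integral_eq_zero_iff_of_nonneg_ae hnn
    (Continuous.integrable_of_Icc hm (by fun_prop))).1 h2.symm
  have h4 : ∀ᵐ s ∂m, s * (1 - s) = 0 := h3
  have h5 := h4
  rw [hs, ae_add_measure_iff, Measure.ae_ennreal_smul_measure_iff (by simp [measureWeight, h1]),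
    Measure.ae_ennreal_smul_measure_iff (by simp [measureWeight, h0])] at h5
  have a1 := ae_of_ae_map (by fun_prop) h5.1
  have a2 := ae_of_ae_map (by fun_prop) h5.2
  obtain ⟨s, hs0, hs1, hs2⟩ := (h4.and (a1.and a2)).exists
  rcases mul_eq_zero.1 hs0 with rfl | hs0
  · simp at hs2
    rcases hs2 with hs2 | hs2 <;> linarith
  · obtain rfl : s = 1 := by linarith
    simp at hs1
    rcases hs1 with hs2 | hs2 <;> linarith

lemma exists_realB_lt_one (h : IsSelfSimilarMeasure α m) (h0 : 0 < α) (h1 : α < 1) :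
    ∃ l < 0, realB m l < 1 := by
  obtain ⟨hp, hm, -⟩ := id h
  have hc : Continuous fun l => ∫ s, realSol m l 0 1 s * (1 - s) ∂m :=
    (continuous_integral_realSol_mul hm (f := fun s => 1 - s) (by fun_prop)).comp
      (by fun_prop : Continuous fun l : ℝ => (l, (0 : ℝ), (1 : ℝ)))
  have hz : 0 < ∫ s, realSol m 0 0 1 s * (1 - s) ∂m := by
    refine (h.integral_mul_one_sub_pos h0 h1).trans_eq (integral_congr_ae ?_)
    filter_upwards [ae_mem_Icc hm] with s hs
    rw [(isStringSol_zero_linear m 0 1).eqOn' hm (isStringSol_realSol hm 0 0 1) s hs]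
    ring
  have := (hc.continuousAt (x := 0)).eventually_const_lt hz
  obtain ⟨l, hl, hl0⟩ := ((this.filter_mono nhdsWithin_le_nhds).and
    (self_mem_nhdsWithin (s := Set.Iio (0 : ℝ)) (a := 0))).exists
  refine ⟨l, hl0, ?_⟩
  have := realB_sub_one hm l
  have hl0' : l < 0 := hl0
  nlinarith [mul_neg_of_neg_of_pos hl0' hl]

/-- There is a Dirichlet eigenvalue. -/
lemma exists_realB_eq_zero (h : IsSelfSimilarMeasure α m) (h0 : 0 < α) (h1 : α < 1) :
    ∃ l ≤ 0, realB m l = 0 := by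
  obtain ⟨hp, hm, -⟩ := id h
  have hcB := continuous_realB hm
  obtain ⟨A0, B0, D0⟩ := real_entries_zero hm
  by_contra! hne
  have hpos : ∀ l ≤ 0, 0 < realB m l := by
    intro l hl
    by_contra! hl0
    obtain ⟨x, hx, hx0⟩ := intermediate_value_Icc hl hcB.continuousOn
      (show (0 : ℝ) ∈ Set.Icc (realB m l) (realB m 0) from ⟨hl0, by rw [B0]; exact zero_le_one⟩)
    exact hne x hx.2 hx0
  -- Without zeros of b on the negative axis, (a + d - 2)/b increases up to its value 0 at l = 0.
  -- This bounds the trace strictly below 2.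
  have hT : ∀ l < 0, realA m l + realD m l < 2 := by
    have hmono : StrictMonoOn (flatFlux m) (Set.Iic 0) := by
      refine strictMonoOn_of_deriv_pos (convex_Iic 0) (fun l hl => ?_) fun l hl => ?_
      · exact (hasDerivAt_flatFlux hm (hpos l hl).ne').continuousAt.continuousWithinAt
      · rw [interior_Iic] at hl
        rw [(hasDerivAt_flatFlux hm (hpos l (le_of_lt hl)).ne').deriv]
        exact h.integral_realSol_mul_self_pos h0 h1 (Or.inl one_ne_zero)
    intro l hl
    have h2 := hmono hl.le (Set.self_mem_Iic) hl
    have h3 : flatFlux m 0 = 0 := by rw [flatFlux, A0, D0]; norm_num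
    rw [h3, flatFlux, div_neg_iff] at h2
    rcases h2 with h2 | h2
    · exact absurd h2.2 (hpos l hl.le).not_gt
    · linarith [h2.1]
  have hγ : 0 < α * (1 - α) := mul_pos h0 (sub_pos.2 h1)
  have hγ1 : α * (1 - α) < 1 := by nlinarith
  set γ := α * (1 - α) with hγd
  set t : ℝ → ℝ := fun l => α * realA m l + (1 - α) * realD m l with ht
  have hdiv : ∀ l, realB m l = realB m (γ * l) * t (γ * l) := h.realB_div h0 h1
  have hdiv' : ∀ l, t l = t (γ * l) * (realA m (γ * l) + realD m (γ * l)) - 1 := h.mean_div h0 h1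
  have htpos : ∀ l < 0, 0 < t l := by
    intro l hl
    have h2 := hdiv (γ⁻¹ * l)
    rw [mul_inv_cancel_left₀ hγ.ne'] at h2
    have h3 := hpos (γ⁻¹ * l) (mul_nonpos_of_nonneg_of_nonpos (by positivity) hl.le)
    rw [h2] at h3
    exact pos_of_mul_pos_right h3 (hpos l hl.le).le
  -- With trace < 2 and t > 0 the recursion at least doubles the defect 1 - t whenever l is divided
  -- by γ. A positive defect thus contradicts t > 0.
  have hstep : ∀ l < 0, t (γ⁻¹ * l) < 2 * t l - 1 := by
    intro l hl
    have h2 := hdiv' (γ⁻¹ * l)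
    rw [mul_inv_cancel_left₀ hγ.ne'] at h2
    rw [h2]
    nlinarith [hT l hl, htpos l hl]
  -- If t ≥ 1 throughout, b(γⁿl) stays below b(l) < 1 for a suitable l, although it tends to b(0) =
  -- 1.
  have hex : ∃ l < 0, t l < 1 := by
    by_contra! hge
    obtain ⟨l, hl0, hl⟩ := h.exists_realB_lt_one h0 h1
    have hle : ∀ n : ℕ, realB m (γ ^ n * l) ≤ realB m l := by
      intro n
      induction n with
      | zero => simp
      | succ n ih =>
        refine le_trans ?_ ih
        have h3 : γ ^ (n + 1) * l < 0 := mul_neg_of_pos_of_neg (by positivity) hl0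
        rw [hdiv (γ ^ n * l), ← mul_assoc, ← pow_succ']
        exact le_mul_of_one_le_right (hpos _ h3.le).le (hge _ h3)
    have hlim : Tendsto (fun n : ℕ => realB m (γ ^ n * l)) atTop (𝓝 (realB m (0 * l))) :=
      (hcB.tendsto _).comp ((tendsto_pow_atTop_nhds_zero_of_lt_one hγ.le hγ1).mul_const l)
    rw [zero_mul, B0] at hlim
    linarith [le_of_tendsto' hlim hle]
  obtain ⟨l, hl0, hl⟩ := hex
  have hk : ∀ n : ℕ, 2 ^ n * (1 - t l) ≤ 1 - t ((γ⁻¹) ^ n * l) := by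
    intro n
    induction n with
    | zero => simp
    | succ n ih =>
      have h3 : γ⁻¹ ^ n * l < 0 := mul_neg_of_pos_of_neg (by positivity) hl0
      have := hstep _ h3
      rw [pow_succ', pow_succ' (γ⁻¹), mul_assoc (γ⁻¹)]
      linarith
  obtain ⟨n, hn⟩ := pow_unbounded_of_one_lt (1 / (1 - t l)) (one_lt_two (α := ℝ))
  rw [div_lt_iff₀ (by linarith)] at hn
  have h3 : γ⁻¹ ^ n * l < 0 := mul_neg_of_pos_of_neg (by positivity) hl0
  linarith [hk n, htpos _ h3]

lemma mem_dirichletSpectrum_iff (h : IsSelfSimilarMeasure α m) (h0 : 0 < α) (h1 : α < 1) (x : ℝ) :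
    x ∈ dirichletSpectrum α m ↔ realB m x = 0 := by
  obtain ⟨hp, hm, -⟩ := id h
  have hx : x = ((α * (1 - α)) ^ 0)⁻¹ * x := by simp
  rw [← Complex.ofReal_eq_zero, ofReal_realB hm]
  constructor
  · rintro ⟨f, hf0, hf⟩
    obtain ⟨p, rfl, hb⟩ := IsDirichletEigen.exists_eq hm h0 h1 hf hx
    refine hb.resolve_right ?_
    rintro rfl
    exact hf0 (zero_smul _ _)
  · exact fun hb => ⟨_, indicator_realSol_ne_zero hm (Or.inr one_ne_zero),
      isDirichletEigen_of_b_eq_zero hm h0 h1 hx hb⟩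

/-- For a Dirichlet solution with x ≥ 0 the energy ∫ f'² = -x ∫ f² is both nonnegative and
nonpositive, so f is constant, hence 0. -/
lemma neg_of_realB_eq_zero (h : IsSelfSimilarMeasure α m) (h0 : 0 < α) (h1 : α < 1) {x : ℝ}
    (hx : realB m x = 0) : x < 0 := by
  obtain ⟨hp, hm, -⟩ := id h
  by_contra! hx0
  have hs := isStringSol_realSol hm x 0 1
  have e1 := hs.integral_slope_mul_slope hm hs
  rw [hs.eq_real_fst hm, hx] at e1
  simp only [mul_zero, zero_mul, add_zero, sub_zero, zero_sub] at e1
  have hpos := h.integral_realSol_mul_self_pos h0 h1 (l := x) (u := 0) (p := 1) (Or.inr one_ne_zero)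
  have hm2 := hs.memLp_slope hm
  have hnn : 0 ≤ ∫ t in (0 : ℝ)..1, slope m x 1 (realSol m x 0 1) t * slope m x 1 (realSol m x 0 1) t :=
    intervalIntegral.integral_nonneg zero_le_one fun t _ => mul_self_nonneg _
  have hz : ∫ t in (0 : ℝ)..1, slope m x 1 (realSol m x 0 1) t * slope m x 1 (realSol m x 0 1) t = 0 :=
    le_antisymm (by rw [e1]; nlinarith) hnn
  rw [intervalIntegral.integral_of_le zero_le_one, ← integral_Icc_eq_integral_Ioc,
    integral_eq_zero_iff_of_nonneg (fun t => mul_self_nonneg _) (hm2.integrable_mul hm2)] at hz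
  refine indicator_realSol_ne_zero hm (l := x) (u := 0) (p := 1) (Or.inr one_ne_zero) ?_
  funext y
  by_cases hy : y ∈ Set.Icc (0 : ℝ) 1
  · rw [Set.indicator_of_mem hy, hs.eq_integral_slope hm hy, zero_add,
      intervalIntegral.integral_of_le hy.1, integral_eq_zero_of_ae]
    · rfl
    · refine ae_restrict_of_ae_restrict_of_subset
        (Set.Ioc_subset_Icc_self.trans (Set.Icc_subset_Icc_right hy.2)) ?_
      filter_upwards [hz] with t ht
      exact mul_self_eq_zero.1 ht
  · rw [Set.indicator_of_notMem hy]; rfl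

/-- The spectrum is the zero set of the continuous function b; it is closed, nonempty and bounded
above by 0. -/
lemma exists_isGreatest_dirichletSpectrum (h : IsSelfSimilarMeasure α m) (h0 : 0 < α) (h1 : α < 1) :
    ∃ l, IsGreatest (dirichletSpectrum α m) l ∧ l < 0 := by
  obtain ⟨hp, hm, -⟩ := id h
  have hS : dirichletSpectrum α m = {x | realB m x = 0} :=
    Set.ext fun x => h.mem_dirichletSpectrum_iff h0 h1 x
  have hne : (dirichletSpectrum α m).Nonempty := by
    obtain ⟨l, -, hl⟩ := h.exists_realB_eq_zero h0 h1
    exact ⟨l, hS ▸ hl⟩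
  have hbdd : BddAbove (dirichletSpectrum α m) :=
    ⟨0, fun x hx => (h.neg_of_realB_eq_zero h0 h1 ((h.mem_dirichletSpectrum_iff h0 h1 x).1 hx)).le⟩
  have hcl : IsClosed (dirichletSpectrum α m) := by
    rw [hS]
    exact isClosed_singleton.preimage (continuous_realB hm)
  have hmem := hcl.csSup_mem hne hbdd
  exact ⟨_, ⟨hmem, fun x hx => le_csSup hbdd hx⟩,
    h.neg_of_realB_eq_zero h0 h1 ((h.mem_dirichletSpectrum_iff h0 h1 _).1 hmem)⟩

end IsSelfSimilarMeasure

open Transfer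

/-! ### The trace matrices of the string -/

/-- The curve `l ↦ A_(l)` of the trace matrices. -/
def traceCurve (m : Measure ℝ) (l : ℂ) : Fin 3 → ℂ :=
  (stringTransfer m l).b⁻¹ • (stringTransfer m l).toVec

/-- For x ≥ 0 the infimum is attained by the string solution with the prescribed boundary values.
Its energy is the boundary term f'(1)v₁ - f'(0)v₀, expressed by the transfer matrix. -/
lemma isTraceMatrix {m : Measure ℝ} [IsProbabilityMeasure m] (hm : m (Set.Icc 0 1)ᶜ = 0) {x : ℝ}
    (hx : 0 ≤ x) (hb : realB m x ≠ 0) :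
    IsTraceMatrix m x
      ![(realB m x)⁻¹ * realA m x, (realB m x)⁻¹ * realD m x, (realB m x)⁻¹ * -1] := by
  intro v₀ v₁
  set p : ℝ := (v₁ - realA m x * v₀) / realB m x with hp
  set r := realSol m x v₀ p with hr
  have hs : IsStringSol m x v₀ p r := isStringSol_realSol hm x v₀ p
  have hr0 : r 0 = v₀ := hs.zero_eq hm
  have hr1 : r 1 = v₁ := by
    rw [hs.eq_real_fst hm, hp]
    field_simp
    ring
  set σ := slope m x p r with hσ
  have hself := hs.integral_slope_mul_slope hm hs
  have hval : (Matrix.vecCons ((realB m x)⁻¹ * realA m x)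
      ![(realB m x)⁻¹ * realD m x, (realB m x)⁻¹ * -1] 0 * v₀ ^ 2 +
      (realB m x)⁻¹ * realD m x * v₁ ^ 2 + 2 * ((realB m x)⁻¹ * -1) * v₀ * v₁) =
      σ 1 * v₁ - p * v₀ := by
    rw [hσ, hs.slope_eq_real_snd hm, hp]
    simp only [Matrix.cons_val_zero]
    field_simp
    linear_combination (v₀ * v₁) * real_det hm x
  have hσm : MemLp σ 2 (volume.restrict (Set.Icc 0 1)) := hs.memLp_slope hm
  have hri : ∀ {f : ℝ → ℝ}, ContinuousOn f (Set.Icc 0 1) → Integrable (fun s => r s * f s) m :=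
    fun hf => integrable_of_continuousOn_Icc hm (hs.cont.continuousOn.mul hf)
  rw [hr1] at hself
  refine IsLeast.isGLB ⟨⟨_, σ, hs.inDomain hm, ?_, ?_, ?_⟩, ?_⟩
  · rw [Set.indicator_of_mem (by simp), hr0]
  · rw [Set.indicator_of_mem (by simp), hr1]
  · refine hval.trans ?_
    have e1 : ∫ t, (Set.Icc (0 : ℝ) 1).indicator r t ^ 2 ∂m = ∫ t, r t * r t ∂m := by
      refine integral_congr_ae ?_
      filter_upwards [ae_mem_Icc hm] with s hs
      rw [Set.indicator_of_mem hs, sq]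
    rw [e1]
    simp only [sq]
    linarith
  · rintro e ⟨f, g, hd, hf0, hf1, rfl⟩
    refine (hval.trans_le ?_)
    have hw := hd.integral_slope_mul hm hs
    rw [hf0, hf1] at hw
    have toI : ∀ {a b : ℝ → ℝ}, MemLp a 2 (volume.restrict (Set.Icc 0 1)) →
        MemLp b 2 (volume.restrict (Set.Icc 0 1)) →
        IntervalIntegrable (fun t => a t * b t) volume 0 1 := fun ha hb => by
      rw [intervalIntegrable_iff_integrableOn_Icc_of_le zero_le_one]
      exact ha.integrable_mul hb
    -- Minimality: expand the squares of g - σ and f - r. The cross terms are known from the weak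
    -- form tested with the competitor f.
    have h1 : 0 ≤ (∫ t in (0 : ℝ)..1, g t * g t) - 2 * (∫ t in (0 : ℝ)..1, σ t * g t) +
        ∫ t in (0 : ℝ)..1, σ t * σ t := by
      rw [← intervalIntegral.integral_const_mul, ← intervalIntegral.integral_sub (toI hd.2.1 hd.2.1)
        ((toI hσm hd.2.1).const_mul 2), ← intervalIntegral.integral_add
        ((toI hd.2.1 hd.2.1).sub ((toI hσm hd.2.1).const_mul 2)) (toI hσm hσm)]
      refine intervalIntegral.integral_nonneg zero_le_one fun t _ => ?_
      nlinarith [sq_nonneg (g t - σ t)]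
    have h2 : 0 ≤ (∫ s, f s * f s ∂m) - 2 * (∫ s, r s * f s ∂m) + ∫ s, r s * r s ∂m := by
      have i1 : Integrable (fun s => f s * f s) m :=
        integrable_of_continuousOn_Icc hm (hd.continuousOn.mul hd.continuousOn)
      have i2 : Integrable (fun s => f s * f s - 2 * (r s * f s)) m :=
        i1.sub ((hri hd.continuousOn).const_mul 2)
      rw [← integral_const_mul, ← integral_sub i1 ((hri hd.continuousOn).const_mul 2),
        ← integral_add i2 (hri hs.cont.continuousOn)]
      refine integral_nonneg fun s => ?_
      simp only [Pi.zero_apply]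
      nlinarith [sq_nonneg (f s - r s)]
    simp only [sq]
    nlinarith [mul_nonneg hx h2]

/-! ### The trace curve on the disc and the continuous case -/

namespace IsSelfSimilarMeasure

variable {α : ℝ} {m : Measure ℝ}

/-- Zeros of b are real, hence negative Dirichlet eigenvalues, hence at most l, so their modulus is
at least |l|. -/
lemma stringTransfer_b_ne_zero (h : IsSelfSimilarMeasure α m) (h0 : 0 < α) (h1 : α < 1) {l : ℝ}
    (hl : IsGreatest (dirichletSpectrum α m) l) {z : ℂ} (hz : ‖z‖ < |l|) :
    (stringTransfer m z).b ≠ 0 := by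
  obtain ⟨hp, hm, -⟩ := id h
  intro hb
  have him := (h.isTransferFamily h0 h1).im_eq_zero_of_b_eq_zero hb
  obtain ⟨x, rfl⟩ : ∃ x : ℝ, z = x := ⟨z.re, Complex.ext (by simp) (by simp [him])⟩
  rw [← ofReal_realB hm, Complex.ofReal_eq_zero] at hb
  have hx := hl.2 ((h.mem_dirichletSpectrum_iff h0 h1 x).2 hb)
  have hx0 := h.neg_of_realB_eq_zero h0 h1 hb
  have hl0 := h.neg_of_realB_eq_zero h0 h1 ((h.mem_dirichletSpectrum_iff h0 h1 l).1 hl.1)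
  rw [Complex.norm_real, Real.norm_eq_abs, abs_of_neg hx0, abs_of_neg hl0] at hz
  linarith

lemma isTraceCurve (h : IsSelfSimilarMeasure α m) (h0 : 0 < α) (h1 : α < 1) {l : ℝ}
    (hl : IsGreatest (dirichletSpectrum α m) l) : IsTraceCurve m |l| (traceCurve m) := by
  obtain ⟨hp, hm, -⟩ := id h
  have hT := h.isTransferFamily h0 h1
  refine ⟨?_, fun x hx hxl => ?_⟩
  · have hb : DifferentiableOn ℂ (fun z => (stringTransfer m z).b⁻¹) (Metric.ball 0 |l|) :=
      hT.diff_b.differentiableOn.inv fun z hz =>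
        h.stringTransfer_b_ne_zero h0 h1 hl (mem_ball_zero_iff.1 hz)
    refine hb.smul (differentiableOn_pi.2 fun i => ?_)
    fin_cases i
    · exact hT.diff_a.differentiableOn
    · exact hT.diff_d.differentiableOn
    · exact differentiableOn_const _
  · have hb : realB m x ≠ 0 := by
      have := h.stringTransfer_b_ne_zero h0 h1 hl (z := x)
        (by rwa [Complex.norm_real, Real.norm_eq_abs, abs_of_nonneg hx])
      rwa [← ofReal_realB hm, Complex.ofReal_ne_zero] at this
    refine ⟨_, isTraceMatrix hm hx hb, fun i => ?_⟩
    fin_cases i <;>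
      simp [traceCurve, toVec, ← ofReal_realA hm, ← ofReal_realB hm, ← ofReal_realD hm]

/-- The continuous case. -/
theorem exists_densityOfStates (h : IsSelfSimilarMeasure α m) (h0 : 0 < α) (h1 : α < 1) :
    ∃ μ : Measure ℝ,
      (∀ ω : ℕ → Fin 2,
        IsDensityOfStates (contNuNeumann α m ω) (contNuDirichlet α m ω) μ) ∧
      ∃ l : ℝ, IsGreatest (dirichletSpectrum α m) l ∧ l < 0 ∧
        ∃ Φ : ℂ → Fin 3 → ℂ, IsTraceCurve m |l| Φ ∧
          IsLaplacianMeasureOn (Metric.ball 0 |l|) (fun x => Ghat α (Φ x))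
            (μ.map (fun x : ℝ => (x : ℂ))) := by
  have hT := h.isTransferFamily h0 h1
  obtain ⟨μ, hμ, hL⟩ := hT.exists_densityOfStates h0 h1
  obtain ⟨l, hl, hl0⟩ := h.exists_isGreatest_dirichletSpectrum h0 h1
  have hb : ∀ z ∈ Metric.ball (0 : ℂ) |l|, (stringTransfer m z).b ≠ 0 := fun z hz =>
    h.stringTransfer_b_ne_zero h0 h1 hl (mem_ball_zero_iff.1 hz)
  -- The normalization by b costs -log|b|, which is harmonic on the disc and leaves the Laplacian
  -- unchanged there.
  have hG : ∀ z ∈ Metric.ball (0 : ℂ) |l|, (Ghat α (traceCurve m z)).toReal =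
      (Ghat α (stringTransfer m z).toVec).toReal - Real.log ‖(stringTransfer m z).b‖ := by
    intro z hz
    rw [traceCurve, Ghat_smul_toReal h0 h1 (by simp [toVec]) (inv_ne_zero (hb z hz)), norm_inv,
      Real.log_inv]
    ring
  have hlog : ContinuousOn (fun z => Real.log ‖(stringTransfer m z).b‖) (Metric.ball 0 |l|) :=
    hT.diff_b.continuous.norm.continuousOn.log fun z hz => norm_ne_zero_iff.2 (hb z hz)
  refine ⟨μ, fun ω => ?_, l, hl, hl0, traceCurve m, h.isTraceCurve h0 h1 hl, ?_, ?_, ?_⟩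
  · rw [funext (h.contNuNeumann_eq h0 h1 ω), funext (h.contNuDirichlet_eq h0 h1 ω)]
    exact hμ
  · filter_upwards [ae_restrict_mem Metric.isOpen_ball.measurableSet] with z hz
    have := tendsto_greenSeq h0 h1 (z := traceCurve m z) (by simp [traceCurve, toVec, hb z hz])
    exact ⟨this.1, this.2.1⟩
  · have h2 := ((hT.locallyIntegrable_green h0 h1).locallyIntegrableOn (Metric.ball 0 |l|)).sub
      (hlog.locallyIntegrableOn Metric.isOpen_ball.measurableSet)
    intro z hz
    obtain ⟨s, hs, hi⟩ := h2 z hz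
    refine ⟨s ∩ Metric.ball 0 |l|, inter_mem hs self_mem_nhdsWithin, ?_⟩
    refine (hi.mono_set Set.inter_subset_left).congr_fun_ae ?_
    filter_upwards [ae_restrict_of_ae_restrict_of_subset Set.inter_subset_right
      (ae_restrict_mem Metric.isOpen_ball.measurableSet)] with w hw
    exact (hG w hw).symm
  · intro ψ hψs hψc hsub
    have hψ : IsTest ψ := ⟨hψs, hψc⟩
    rw [hL ψ hψ]
    congr 1
    have hharm := hψ.integral_harmonic_mul_laplacian
      (h := fun z => Real.log ‖(stringTransfer m z).b‖) fun z hz =>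
        AnalyticAt.harmonicAt_log_norm (hT.diff_b.analyticAt z) (hb z (hsub hz))
    have i1 : Integrable fun z =>
        (Ghat α (stringTransfer m z).toVec).toReal * Laplacian.laplacian ψ z := by
      refine hψ.integrable_mul (hT.measurable_green h0 h1).aestronglyMeasurable fun R => ?_
      obtain ⟨C, hC⟩ := hT.exists_green_bound h0 h1 R
      exact ⟨C, fun x hx _ => (hC x hx).trans (by linarith [abs_nonneg (Real.log (|x.im|))])⟩
    have i2 : Integrable fun z =>
        Real.log ‖(stringTransfer m z).b‖ * Laplacian.laplacian ψ z := by
      refine integrable_of_continuousOn_support hψc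
        ((hlog.mono hsub).mul hψ.continuous_laplacian.continuousOn) ?_
      exact (Function.support_mul_subset_right _ _).trans IsTest.support_laplacian
    rw [← sub_zero (∫ z, _ * _), ← hharm, ← integral_sub i1 i2]
    refine integral_congr_ae (Eventually.of_forall fun z => ?_)
    by_cases hz : z ∈ tsupport ψ
    · simp only [hG z (hsub hz)]
      ring
    · have : Laplacian.laplacian ψ z = 0 := by
        by_contra hne
        exact hz (IsTest.support_laplacian hne)
      simp only [this, mul_zero, sub_zero]

end IsSelfSimilarMeasure

end

end SelfSimilarInterval

/-! ### Assembly of the theorem -/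

theorem theorem5p3 (α : ℝ) (hα0 : 0 < α) (hα1 : α < 1) :
    -- the renormalization map is algebraically stable and has a Green function
    IsAlgebraicallyStable (Rhat α) ∧
    (∀ z : Fin 3 → ℂ, Tendsto (fun n => greenApprox (Rhat α) 2 n z) atTop (𝓝 (Ghat α z))) ∧
    -- the lattice case
    (∀ b : Fin 2 → ℝ, (∀ x, 0 < b x) →
      ∃ μ : Measure ℝ,
        (∀ ω : ℕ → Fin 2,
          IsDensityOfStates (latticeNuNeumann α b ω) (latticeNuDirichlet α b ω) μ) ∧
        IsLaplacianMeasureOn Set.univ (fun x => Ghat α (latticePhi b x))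
          (μ.map (fun x : ℝ => (x : ℂ)))) ∧
    -- the continuous case
    (∃ m : Measure ℝ, IsSelfSimilarMeasure α m) ∧
    (∀ m : Measure ℝ, IsSelfSimilarMeasure α m →
      ∃ μ : Measure ℝ,
        (∀ ω : ℕ → Fin 2,
          IsDensityOfStates (contNuNeumann α m ω) (contNuDirichlet α m ω) μ) ∧
        ∃ l : ℝ, IsGreatest (dirichletSpectrum α m) l ∧ l < 0 ∧
          ∃ Φ : ℂ → Fin 3 → ℂ, IsTraceCurve m |l| Φ ∧
            IsLaplacianMeasureOn (Metric.ball 0 |l|) (fun x => Ghat α (Φ x))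
              (μ.map (fun x : ℝ => (x : ℂ)))) := by
  exact ⟨isAlgebraicallyStable_Rhat hα0 hα1, tendsto_greenApprox α,
    fun b hb => lattice_densityOfStates hα0 hα1 hb, exists_isSelfSimilarMeasure hα0 hα1,
    fun m hm => hm.exists_densityOfStates hα0 hα1⟩
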